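/- Let $(X,\mathcal O)$ be a semi-separated finite space, and let $\mathcal M$ be a quasi-coherent $\mathcal O$-module. Then there is an exact sequence of $\mathcal O$-modules $$\cdots\to\mathcal P^{-2}\to\mathcal P^{-1}\to\mathcal P^{0}\to\mathcal M\to 0$$ in which every $\mathcal P^{-n}$ ($n\ge 0$) is quasi-coherent and flat. That is, every quasi-coherent module on a semi-separated finite space has a left resolution by flat quasi-coherent modules; $\operatorname{Qcoh}(X)$ has enough flats. Here a *finite space* is a ringed space $(X,\mathcal O)$ ($\mathcal O$ a sheaf of commutative rings with unity) with finitely many points such that, writing $U_p$ for the smallest open subset containing $p$, the restriction morphism $\mathcal O_p=\mathcal O(U_p)\to\mathcal O(U_q)=\mathcal O_q$ is flat whenever $U_q\subseteq U_p$. Let $\delta\colon X\to X\times X$ be the diagonal morphism, where $X\times X$ is the product of ringed spaces: the product topological space with structure sheaf $\mathrm{pr}_1^{-1}\mathcal O\otimes_{\mathbb Z}\mathrm{pr}_2^{-1}\mathcal O$. The finite space $X$ is *semi-separated* if $R^i\delta_*\mathcal O$ is quasi-coherent for all $i\ge 0$ and $R^i\delta_*\mathcal O=0$ for all $i>0$.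 An $\mathcal O$-module is *quasi-coherent* if locally it is the cokernel of a morphism between direct sums of copies of $\mathcal O$, and *flat* if each of its stalks $\mathcal M_x$ is a flat $\mathcal O_x$-module. -/

import Mathlib

open CategoryTheory Limits TopologicalSpace AlgebraicGeometry

universe u

noncomputable section

namespace FiniteSpace

/-! ### Modules on a ringed space -/

/-- The structure sheaf of a ringed space, as a sheaf of (not necessarily commutative) rings. -/
abbrev ringCatSheaf (X : RingedSpace.{u, u}) : TopCat.Sheaf RingCat.{u} X.carrier :=
  (sheafCompose _ (forget₂ CommRingCat RingCat.{u})).obj X.sheaf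

/-- The category `Mod(X)` of sheaves of `𝒪`-modules on a ringed space. -/
abbrev Modules (X : RingedSpace.{u, u}) : Type (u + 1) :=
  SheafOfModules.{u} (ringCatSheaf X)

/-- The stalk `ℳ_x` of an `𝒪`-module; it is a module over the stalk `𝒪_x`. -/
abbrev stalk {X : RingedSpace.{u, u}} (M : Modules X) (x : X.carrier) : Ab.{u} :=
  TopCat.Presheaf.stalk (C := Ab.{u}) (X := X.carrier) M.val.presheaf x

instance stalkModule {X : RingedSpace.{u, u}} (M : Modules X) (x : X.carrier) :
    Module (X.presheaf.stalk x) (stalk M x) :=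
  letI R : TopCat.Presheaf CommRingCat.{u} X.carrier := X.presheaf
  letI M' : PresheafOfModules.{u} (R ⋙ forget₂ CommRingCat.{u} RingCat.{u}) := M.val
  inferInstanceAs (Module (R.stalk x)
    (TopCat.Presheaf.stalk (C := Ab.{u}) (X := X.carrier) M'.presheaf x))

/-- An `𝒪`-module is flat if all its stalks `ℳ_x` are flat `𝒪_x`-modules. -/
def IsFlat {X : RingedSpace.{u, u}} (M : Modules X) : Prop :=
  ∀ x : X.carrier, Module.Flat (X.presheaf.stalk x) (stalk M x)

/-- Quasi-coherent `𝒪`-modules: those which locally are the cokernel of a morphism between direct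
sums of copies of `𝒪`. -/
abbrev IsQuasicoherent {X : RingedSpace.{u, u}} (M : Modules X) : Prop :=
  SheafOfModules.IsQuasicoherent.{u} (R := ringCatSheaf X) M

/-- The morphism of sheaves of rings underlying a morphism of ringed spaces. -/
def toRingCatSheafHom {X Y : RingedSpace.{u, u}} (f : X ⟶ Y) :
    ringCatSheaf Y ⟶
      ((Opens.map f.hom.base).sheafPushforwardContinuous _ _ _).obj (ringCatSheaf X) where
  hom := Functor.whiskerRight f.hom.c _

/-- The direct image functor `f_* : Mod(X) ⥤ Mod(Y)` of a morphism of ringed spaces. -/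
def pushforward {X Y : RingedSpace.{u, u}} (f : X ⟶ Y) : Modules X ⥤ Modules Y :=
  SheafOfModules.pushforward (toRingCatSheafHom f)

instance {X Y : RingedSpace.{u, u}} (f : X ⟶ Y) : (pushforward f).Additive where
  map_add := rfl

/-! ### `Mod(X)` is a Grothendieck abelian category -/

/-- Filtered colimits of presheaves of modules are exact. -/
instance presheafOfModules_hasExactColimitsOfShape {C : Type u} [SmallCategory C]
    (R : Cᵒᵖ ⥤ RingCat.{u}) (K : Type u) [SmallCategory K] [IsFiltered K] :
    HasExactColimitsOfShape K (PresheafOfModules.{u} R) :=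
  HasExactColimitsOfShape.domain_of_functor K (PresheafOfModules.toPresheaf R)

instance modules_ab5 (X : RingedSpace.{u, u}) : AB5OfSize.{u, u} (Modules X) where
  ofShape K _ _ :=
    (PresheafOfModules.sheafificationAdjunction (𝟙 (ringCatSheaf X).obj)).hasExactColimitsOfShape K

instance modules_hasSeparator (X : RingedSpace.{u, u}) : HasSeparator (Modules X) where
  hasSeparator := by
    let adj := PresheafOfModules.sheafificationAdjunction (𝟙 (ringCatSheaf X).obj)
    let S : Opens X.carrier → Modules X := fun U ↦
      (PresheafOfModules.sheafification (𝟙 (ringCatSheaf X).obj)).obj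
        ((PresheafOfModules.free (ringCatSheaf X).obj).obj (yoneda.obj U))
    have hS : ObjectProperty.IsSeparating (.ofObj S) := by
      intro M N f g hfg
      apply (SheafOfModules.forget (ringCatSheaf X) ⋙
        PresheafOfModules.restrictScalars (𝟙 (ringCatSheaf X).obj)).map_injective
      refine PresheafOfModules.freeYoneda.isSeparating (ringCatSheaf X).obj _ _ ?_
      rintro _ ⟨U⟩ a
      apply (adj.homEquiv _ _).symm.injective
      have h := hfg _ (ObjectProperty.ofObj_apply _ U) ((adj.homEquiv _ _).symm a)
      exact (adj.homEquiv_naturality_right_symm a f).trans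
        (h.trans (adj.homEquiv_naturality_right_symm a g).symm)
    exact ⟨_, hS.isSeparator_coproduct⟩

instance modules_isGrothendieckAbelian (X : RingedSpace.{u, u}) :
    IsGrothendieckAbelian.{u} (Modules X) where

instance modules_enoughInjectives (X : RingedSpace.{u, u}) : EnoughInjectives (Modules X) :=
  inferInstance

/-- The higher direct image functors `R^i f_* : Mod(X) ⥤ Mod(Y)`. -/
def higherDirectImage {X Y : RingedSpace.{u, u}} (f : X ⟶ Y) (i : ℕ) : Modules X ⥤ Modules Y :=
  (pushforward f).rightDerived i

/-! ### Products of ringed spaces and the diagonal -/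

instance sheaf_hasColimits (X : TopCat.{u}) :
    HasColimits (TopCat.Sheaf CommRingCat.{u} X) where
  has_colimits_of_shape J _ :=
    @Sheaf.instHasColimitsOfShape _ _ (Opens.grothendieckTopology X) CommRingCat.{u} _ J _
      inferInstance inferInstance

/-- The product of the underlying topological spaces. -/
abbrev prodTop (X Y : RingedSpace.{u, u}) : TopCat.{u} := TopCat.of (X.carrier × Y.carrier)

/-- The first projection, on topological spaces. -/
def fstTop (X Y : RingedSpace.{u, u}) : prodTop X Y ⟶ X.carrier := TopCat.ofHom ContinuousMap.fst

/-- The second projection, on topological spaces. -/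
def sndTop (X Y : RingedSpace.{u, u}) : prodTop X Y ⟶ Y.carrier := TopCat.ofHom ContinuousMap.snd

/-- The continuous map `z ↦ (f z, g z)`. -/
def liftTop {X Y Z : RingedSpace.{u, u}} (f : Z ⟶ X) (g : Z ⟶ Y) : Z.carrier ⟶ prodTop X Y :=
  TopCat.ofHom (f.hom.base.hom.prodMk g.hom.base.hom)

/-- The sheaf of rings `pr₁⁻¹ 𝒪_X ⊗_ℤ pr₂⁻¹ 𝒪_Y` on `X × Y` (the coproduct of `pr₁⁻¹ 𝒪_X` and
`pr₂⁻¹ 𝒪_Y` in sheaves of commutative rings); its stalk at `(x, y)` is `𝒪_x ⊗_ℤ 𝒪_y`. -/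
def prodSheaf (X Y : RingedSpace.{u, u}) : TopCat.Sheaf CommRingCat.{u} (prodTop X Y) :=
  (TopCat.Sheaf.pullback CommRingCat.{u} (fstTop X Y)).obj X.sheaf ⨿
    (TopCat.Sheaf.pullback CommRingCat.{u} (sndTop X Y)).obj Y.sheaf

/-- The product `X × Y` of two ringed spaces (see `prodIsLimit`). -/
def prod (X Y : RingedSpace.{u, u}) : RingedSpace.{u, u} where
  carrier := prodTop X Y
  presheaf := (prodSheaf X Y).obj
  IsSheaf := (prodSheaf X Y).property

/-- The first projection. -/
def prodFst (X Y : RingedSpace.{u, u}) : prod X Y ⟶ X :=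
  InducedCategory.homMk
    { base := fstTop X Y
      c := ((TopCat.Sheaf.pullbackPushforwardAdjunction CommRingCat.{u} (fstTop X Y)).homEquiv
        X.sheaf (prodSheaf X Y) coprod.inl).hom }

/-- The second projection. -/
def prodSnd (X Y : RingedSpace.{u, u}) : prod X Y ⟶ Y :=
  InducedCategory.homMk
    { base := sndTop X Y
      c := ((TopCat.Sheaf.pullbackPushforwardAdjunction CommRingCat.{u} (sndTop X Y)).homEquiv
        Y.sheaf (prodSheaf X Y) coprod.inr).hom }

/-- The morphism of sheaves of rings `pr₁⁻¹ 𝒪_X ⊗ pr₂⁻¹ 𝒪_Y ⟶ (f, g)_* 𝒪_Z` induced by two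
morphisms `f : Z ⟶ X` and `g : Z ⟶ Y`. -/
def liftSheafHom {X Y Z : RingedSpace.{u, u}} (f : Z ⟶ X) (g : Z ⟶ Y) :
    prodSheaf X Y ⟶ (TopCat.Sheaf.pushforward CommRingCat.{u} (liftTop f g)).obj Z.sheaf :=
  coprod.desc
    (((TopCat.Sheaf.pullbackPushforwardAdjunction CommRingCat.{u} (fstTop X Y)).homEquiv
      X.sheaf ((TopCat.Sheaf.pushforward CommRingCat.{u} (liftTop f g)).obj Z.sheaf)).symm
        ⟨f.hom.c⟩)
    (((TopCat.Sheaf.pullbackPushforwardAdjunction CommRingCat.{u} (sndTop X Y)).homEquiv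
      Y.sheaf ((TopCat.Sheaf.pushforward CommRingCat.{u} (liftTop f g)).obj Z.sheaf)).symm
        ⟨g.hom.c⟩)

/-- The morphism `(f, g) : Z ⟶ X × Y`. -/
def prodLift {X Y Z : RingedSpace.{u, u}} (f : Z ⟶ X) (g : Z ⟶ Y) : Z ⟶ prod X Y :=
  InducedCategory.homMk { base := liftTop f g, c := (liftSheafHom f g).hom }

theorem prodLift_fst {X Y Z : RingedSpace.{u, u}} (f : Z ⟶ X) (g : Z ⟶ Y) :
    prodLift f g ≫ prodFst X Y = f := by
  apply InducedCategory.hom_ext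
  change PresheafedSpace.Hom.mk _ _ = PresheafedSpace.Hom.mk f.hom.base f.hom.c
  congr 1
  have h := (TopCat.Sheaf.pullbackPushforwardAdjunction CommRingCat.{u}
    (fstTop X Y)).homEquiv_naturality_right (X := X.sheaf) (coprod.inl : _ ⟶ prodSheaf X Y)
      (liftSheafHom f g)
  rw [liftSheafHom, coprod.inl_desc] at h
  exact congrArg (fun t => t.hom) (h.symm.trans (Equiv.apply_symm_apply _ _))

theorem prodLift_snd {X Y Z : RingedSpace.{u, u}} (f : Z ⟶ X) (g : Z ⟶ Y) :
    prodLift f g ≫ prodSnd X Y = g := by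
  apply InducedCategory.hom_ext
  change PresheafedSpace.Hom.mk _ _ = PresheafedSpace.Hom.mk g.hom.base g.hom.c
  congr 1
  have h := (TopCat.Sheaf.pullbackPushforwardAdjunction CommRingCat.{u}
    (sndTop X Y)).homEquiv_naturality_right (X := Y.sheaf) (coprod.inr : _ ⟶ prodSheaf X Y)
      (liftSheafHom f g)
  rw [liftSheafHom, coprod.inr_desc] at h
  exact congrArg (fun t => t.hom) (h.symm.trans (Equiv.apply_symm_apply _ _))

theorem prodLift_comp {X Y Z : RingedSpace.{u, u}} (m : Z ⟶ prod X Y) :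
    prodLift (m ≫ prodFst X Y) (m ≫ prodSnd X Y) = m := by
  apply InducedCategory.hom_ext
  change PresheafedSpace.Hom.mk _ _ = PresheafedSpace.Hom.mk m.hom.base m.hom.c
  congr 1
  let c : prodSheaf X Y ⟶ (TopCat.Sheaf.pushforward CommRingCat.{u} m.hom.base).obj Z.sheaf :=
    ⟨m.hom.c⟩
  have h : liftSheafHom (m ≫ prodFst X Y) (m ≫ prodSnd X Y) = c := by
    apply coprod.hom_ext
    · refine (coprod.inl_desc _ _).trans ((Equiv.symm_apply_eq _).2 ?_)
      exact ((TopCat.Sheaf.pullbackPushforwardAdjunction CommRingCat.{u}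
        (fstTop X Y)).homEquiv_naturality_right (X := X.sheaf)
          (coprod.inl : _ ⟶ prodSheaf X Y) c).symm
    · refine (coprod.inr_desc _ _).trans ((Equiv.symm_apply_eq _).2 ?_)
      exact ((TopCat.Sheaf.pullbackPushforwardAdjunction CommRingCat.{u}
        (sndTop X Y)).homEquiv_naturality_right (X := Y.sheaf)
          (coprod.inr : _ ⟶ prodSheaf X Y) c).symm
  exact congrArg (fun t => t.hom) h

/-- `prod X Y` is the product of `X` and `Y` in the category of ringed spaces. -/
def prodIsLimit (X Y : RingedSpace.{u, u}) :
    IsLimit (BinaryFan.mk (prodFst X Y) (prodSnd X Y)) :=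
  BinaryFan.isLimitMk (fun s => prodLift s.fst s.snd)
    (fun s => prodLift_fst _ _) (fun s => prodLift_snd _ _)
    (fun s m h₁ h₂ => by
      rw [← h₁, ← h₂]
      exact (prodLift_comp m).symm)

/-- The diagonal morphism `δ : X ⟶ X × X`. -/
def diagonal (X : RingedSpace.{u, u}) : X ⟶ prod X X :=
  prodLift (𝟙 X) (𝟙 X)

/-! ### Finite spaces -/

/-- A finite space: a ringed space with finitely many points such that the restriction morphisms
`𝒪_p ⟶ 𝒪_q` are flat for all `p ≤ q`, i.e. whenever `U_q ⊆ U_p`, where `U_p` is the smallest open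
subset containing `p`. In Mathlib's notation, `p ≤ q` is `q ⤳ p`. -/
structure IsFiniteSpace (X : RingedSpace.{u, u}) : Prop where
  finite : Finite X.carrier
  flat : ∀ (p q : X.carrier) (h : q ⤳ p), (X.presheaf.stalkSpecializes h).hom.Flat

/-- A semi-separated finite space: a finite space such that, `δ : X ⟶ X × X` being the diagonal,
`R^i δ_* 𝒪` is quasi-coherent for all `i ≥ 0` and is zero for all `i > 0`. -/
structure IsSemiSeparated (X : RingedSpace.{u, u}) : Prop extends IsFiniteSpace X where
  isQuasicoherent : ∀ i : ℕ, IsQuasicoherent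
    ((higherDirectImage (diagonal X) i).obj (SheafOfModules.unit (ringCatSheaf X)))
  isZero : ∀ i : ℕ, 0 < i → IsZero
    ((higherDirectImage (diagonal X) i).obj (SheafOfModules.unit (ringCatSheaf X)))

end FiniteSpace

end

open Opposite

noncomputable section

namespace FiniteSpace

/-! ### Sheaves of modules on a site with enough irreducible objects -/

section Site

variable {C : Type u} [SmallCategory C] {J : GrothendieckTopology C}

/-! In a finite space every point `p` has a smallest neighbourhood `U_p`, and the sections over
`U_p` are the stalk at `p`. These sets are the irreducible objects of the site of open subsets, and
evaluation at them is exact and commutes with colimits. Since the restriction maps between them are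
flat, a module `M` is quasi-coherent exactly when `M(U_p) ⊗ 𝒪(U_q) → M(U_q)` is an isomorphism for
all `U_q ⊆ U_p` (`isQuasicoherent_iff`).

Let `V` be one of these sets, with inclusion `j`, and let `j_*j^*M` be the module `U ↦ M(U ∩ V)`
(`interMod`). The sections of `M` over `V` define a map from a direct sum of copies of `j_*j^*𝒪` to
`j_*j^*M`. Its fibre product `F` with `M → j_*j^*M` is a quasi-coherent module with an epimorphism
to `M`; it is flat at `V` and stays flat wherever `M` was (`IsGoodOpen.exists_epi`). Treating the
finitely many `V` in turn gives a flat quasi-coherent cover of `M` (`exists_epi_flat`). Kernels of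
maps between quasi-coherent modules are quasi-coherent, so such covers splice to a resolution
(`exists_resolution`).

Semi-separatedness is what makes `j_*j^*` well behaved. For irreducible `B` and `V` the product `B ×
V` is irreducible in `X × X`, and its preimage under the diagonal is `B ∩ V`. So the vanishing of
`R^i δ_* 𝒪` for `i > 0` says that `𝒪` has no higher cohomology on `B ∩ V`. Then `𝒪(B ∩ V)` is the
limit of an acyclic finite system of flat `𝒪(B)`-modules; such a limit is flat and commutes with
tensor products (`Acyclic.flat_sections`). Hence `𝒪(B) → 𝒪(B ∩ V)` is flat, and `M(B ∩ V)` is the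
base change of `M(B)` for quasi-coherent `M`. Finally `𝒪(B × V) = 𝒪(B) ⊗ 𝒪(V)`, so quasi-coherence
of `δ_* 𝒪` gives `𝒪(B' ∩ V) = 𝒪(B') ⊗_{𝒪(B)} 𝒪(B ∩ V)` for `B' ⊆ B` (`IsSemiSeparated.isPushout`),
and therefore `j_*j^*M` is quasi-coherent. -/

/-- An object of a site is irreducible if its only covering sieve is the trivial one. -/
def IsIrreducible (J : GrothendieckTopology C) (B : C) : Prop := ∀ S ∈ J B, S = ⊤

/-- A site has enough irreducible objects if every object is covered by irreducible ones. -/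
def EnoughIrreducibles (J : GrothendieckTopology C) : Prop :=
  ∀ U : C, ∀ S : Sieve U, (∀ (B : C) (f : B ⟶ U), IsIrreducible J B → S f) → S ∈ J U

/-- The sieve on which a section lifts is covering, hence contains the identity of `B`. -/
lemma IsIrreducible.surjective {F G : Cᵒᵖ ⥤ Ab.{u}} (f : F ⟶ G)
    [Presheaf.IsLocallySurjective J f] {B : C} (hB : IsIrreducible J B) :
    Function.Surjective (f.app (op B)) := by
  intro s
  have h := hB _ (Presheaf.imageSieve_mem J f s)
  have h' : (Presheaf.imageSieve f s) (𝟙 B) := by rw [h]; trivial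
  obtain ⟨t, ht⟩ := h'
  refine ⟨t, ht.trans ?_⟩
  simp

lemma IsIrreducible.injective {F G : Cᵒᵖ ⥤ Ab.{u}} (f : F ⟶ G)
    [Presheaf.IsLocallyInjective J f] {B : C} (hB : IsIrreducible J B) :
    Function.Injective (f.app (op B)) := by
  intro s t hst
  have h := hB _ (Presheaf.equalizerSieve_mem J f s t hst)
  have h' : (Presheaf.equalizerSieve (F := F) s t) (𝟙 B) := by rw [h]; trivial
  simpa [Presheaf.equalizerSieve] using h'

variable {R : Sheaf J RingCat.{u}}

/-- Every diagram of sheaves is the sheafification of a diagram of presheaves, and its colimit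
cocone is the sheafification of the presheaf colimit. -/
lemma preservesColimitsOfShape_of_sheafification {D : Type (u+1)} [Category.{u} D]
    (G : SheafOfModules.{u} R ⥤ D) (K : Type u) [SmallCategory K]
    [PreservesColimitsOfShape K (PresheafOfModules.sheafification (𝟙 R.obj) ⋙ G)] :
    PreservesColimitsOfShape K G where
  preservesColimit {F} := by
    let L := PresheafOfModules.sheafification.{u} (𝟙 R.obj)
    let i := SheafOfModules.forget R ⋙ PresheafOfModules.restrictScalars (𝟙 R.obj)
    let e : F ≅ (F ⋙ i) ⋙ L :=
      Functor.isoWhiskerLeft F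
        (asIso (PresheafOfModules.sheafificationAdjunction (𝟙 R.obj)).counit).symm
    have : PreservesColimit ((F ⋙ i) ⋙ L) G :=
      preservesColimit_of_preserves_colimit_cocone
        (isColimitOfPreserves L (colimit.isColimit (F ⋙ i)))
        (isColimitOfPreserves (L ⋙ G) (colimit.isColimit (F ⋙ i)))
    exact preservesColimit_of_iso_diagram G e.symm

lemma IsIrreducible.isIso_unit {B : C} (hB : IsIrreducible J B) (P : PresheafOfModules.{u} R.obj) :
    Function.Bijective (((PresheafOfModules.sheafificationAdjunction (𝟙 R.obj)).unit.app P).app (op B)) := by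
  have h : (PresheafOfModules.toPresheaf _).map
    ((PresheafOfModules.sheafificationAdjunction (𝟙 R.obj)).unit.app P) =
      CategoryTheory.toSheafify J P.presheaf := rfl
  exact ⟨hB.injective (CategoryTheory.toSheafify J P.presheaf),
    hB.surjective (CategoryTheory.toSheafify J P.presheaf)⟩

/-- Colimits of presheaves are computed sectionwise, and sheafification does not change the sections
over an irreducible object. -/
lemma IsIrreducible.preservesColimitsOfShape {B : C} (hB : IsIrreducible J B)
    (K : Type u) [SmallCategory K] :
    PreservesColimitsOfShape K (SheafOfModules.evaluation.{u} R (op B)) := by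
  let α := Functor.whiskerRight
    (PresheafOfModules.sheafificationAdjunction.{u} (𝟙 R.obj)).unit
    (PresheafOfModules.evaluation R.obj (op B))
  have : IsIso α := by
    rw [NatTrans.isIso_iff_isIso_app]
    intro P
    rw [ConcreteCategory.isIso_iff_bijective]
    exact hB.isIso_unit P
  have e : PresheafOfModules.evaluation.{u} R.obj (op B) ≅
      PresheafOfModules.sheafification (𝟙 R.obj) ⋙ SheafOfModules.evaluation R (op B) :=
    @asIso _ _ _ _ α this
  have := preservesColimitsOfShape_of_natIso (J := K) e
  exact preservesColimitsOfShape_of_sheafification _ _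

lemma epi_of_surjective (hJ : EnoughIrreducibles J) {M N : SheafOfModules.{u} R} (f : M ⟶ N)
    (hf : ∀ B, IsIrreducible J B → Function.Surjective (f.val.app (op B))) : Epi f := by
  have : Sheaf.IsLocallySurjective ((SheafOfModules.toSheaf R).map f) := by
    constructor
    intro U s
    refine hJ _ _ fun B g hB ↦ ?_
    obtain ⟨t, ht⟩ := hf B hB (N.val.map g.op s)
    exact ⟨t, ht⟩
  have : Epi ((SheafOfModules.toSheaf R).map f) := inferInstance
  exact (SheafOfModules.toSheaf R).epi_of_epi_map this

end Site

/-! ### Base change of modules along a ring homomorphism, for semilinear maps -/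

section Linear

variable {R S : Type u} [CommRing R] [CommRing S] {φ : R →+* S}
  {M N : Type u} [AddCommGroup M] [AddCommGroup N] [Module R M] [Module S N]

/-- A semilinear map viewed as a linear map for the restricted scalars. -/
def semilinearRestrict (f : M →ₛₗ[φ] N) :
    letI := Module.compHom N φ
    M →ₗ[R] N :=
  letI := Module.compHom N φ
  { toFun := f, map_add' := f.map_add, map_smul' := f.map_smulₛₗ }

/-- A semilinear map which exhibits its target as the base change of its source. -/
def IsSemiBaseChange (f : M →ₛₗ[φ] N) : Prop :=
  letI := φ.toAlgebra
  letI := Module.compHom N φ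
  haveI : IsScalarTower R S N := ⟨fun r s n ↦ mul_smul (φ r) s n⟩
  IsBaseChange S (semilinearRestrict f)

open TensorProduct

/-- This form makes base change the invertibility of a component of a natural transformation, so
that it can be propagated through colimits. -/
lemma isSemiBaseChange_iff_isIso (M : ModuleCat.{u} R) (N : ModuleCat.{u} S)
    (g : M ⟶ (ModuleCat.restrictScalars φ).obj N) (f : M →ₛₗ[φ] N) (hf : ∀ m, f m = g m) :
    IsSemiBaseChange f ↔ IsIso ((ModuleCat.extendScalars φ).map g ≫
      (ModuleCat.extendRestrictScalarsAdj φ).counit.app N) := by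
  let := φ.toAlgebra
  let := Module.compHom N φ
  have : IsScalarTower R S N := ⟨fun r s n ↦ mul_smul (φ r) s n⟩
  rw [ConcreteCategory.isIso_iff_bijective]
  unfold IsSemiBaseChange IsBaseChange IsTensorProduct
  refine iff_of_eq (congrArg Function.Bijective ?_)
  funext x
  induction x using TensorProduct.induction_on with
  | zero => rw [map_zero]; exact (map_zero _).symm
  | tmul s m =>
    refine (TensorProduct.lift.tmul _ _).trans ?_
    exact congrArg (fun t => s • t) (hf m)
  | add x y hx hy => rw [map_add, hx, hy]; exact (map_add _ _ _).symm

end Linear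

/-! ### Quasi-coherence as base change between irreducible objects -/

section Site

variable {C : Type u} [SmallCategory C] {J : GrothendieckTopology C}

/-- The sheaf of rings underlying a sheaf of commutative rings. -/
abbrev ringSheaf (𝒪 : Sheaf J CommRingCat.{u}) : Sheaf J RingCat.{u} :=
  (sheafCompose J (forget₂ CommRingCat RingCat.{u})).obj 𝒪

/-- The category of sheaves of modules over a sheaf of commutative rings. -/
abbrev SheafMod (𝒪 : Sheaf J CommRingCat.{u}) : Type (u + 1) :=
  SheafOfModules.{u} (ringSheaf 𝒪)

variable (𝒪 : Sheaf J CommRingCat.{u})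

/-- The functor of sections over an object. -/
def ev (B : C) : SheafMod 𝒪 ⥤ ModuleCat.{u} (𝒪.obj.obj (op B)) :=
  SheafOfModules.evaluation (ringSheaf 𝒪) (op B)

/-- Restriction of sections. -/
def evRes {B B' : C} (f : B' ⟶ B) :
    ev 𝒪 B ⟶ ev 𝒪 B' ⋙ ModuleCat.restrictScalars (𝒪.obj.map f.op).hom where
  app M := M.val.map f.op
  naturality _ _ g := (g.val.naturality f.op).symm

/-- The base change morphism. -/
def evBaseChange {B B' : C} (f : B' ⟶ B) :
    ev 𝒪 B ⋙ ModuleCat.extendScalars (𝒪.obj.map f.op).hom ⟶ ev 𝒪 B' :=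
  Functor.whiskerRight (evRes 𝒪 f) _ ≫
    Functor.whiskerLeft (ev 𝒪 B') (ModuleCat.extendRestrictScalarsAdj _).counit

lemma IsIrreducible.preservesColimitsOfShape_ev {B : C} (hB : IsIrreducible J B)
    (K : Type u) [SmallCategory K] : PreservesColimitsOfShape K (ev 𝒪 B) :=
  hB.preservesColimitsOfShape K

instance {B : C} : PreservesFiniteLimits (ev 𝒪 B) :=
  inferInstanceAs (PreservesFiniteLimits (SheafOfModules.evaluation (ringSheaf 𝒪) (op B)))

variable {𝒪}

/-- Restriction of sections, as a semilinear map. -/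
def secRes (M : SheafMod 𝒪) {B B' : C} (f : B' ⟶ B) :
    (ev 𝒪 B).obj M →ₛₗ[(𝒪.obj.map f.op).hom] (ev 𝒪 B').obj M where
  toFun := (M.val.map f.op).hom
  map_add' := map_add _
  map_smul' r m := M.val.map_smul f.op r m

/-- The sections over `B'` are the base change of the sections over `B`. -/
def HasBaseChange (M : SheafMod 𝒪) {B B' : C} (f : B' ⟶ B) : Prop :=
  IsSemiBaseChange (secRes M f)

lemma hasBaseChange_iff (M : SheafMod 𝒪) {B B' : C} (f : B' ⟶ B) :
    HasBaseChange M f ↔ IsIso ((evBaseChange 𝒪 f).app M) :=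
  isSemiBaseChange_iff_isIso _ _ ((evRes 𝒪 f).app M) _ fun _ ↦ rfl

/-- Cokernels and binary coproducts are indexed by categories in universe `0`. -/
lemma IsIrreducible.preservesColimitsOfSize_ev {B : C} (hB : IsIrreducible J B) :
    PreservesColimitsOfSize.{0, 0} (ev 𝒪 B) := by
  have : PreservesColimitsOfSize.{u, u} (ev 𝒪 B) := ⟨fun {K} _ ↦ hB.preservesColimitsOfShape_ev 𝒪 K⟩
  exact preservesColimitsOfSize_shrink.{0, u, 0, u} _

/-- Extension of scalars is a left adjoint, so `evBaseChange` is a transformation between functors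
which both preserve the colimit. -/
lemma hasBaseChange_colimit {B B' : C} (f : B' ⟶ B) {K : Type*} [Category* K]
    [PreservesColimitsOfShape K (ev 𝒪 B)] [PreservesColimitsOfShape K (ev 𝒪 B')]
    (F : K ⥤ SheafMod 𝒪) (hF : ∀ k, HasBaseChange (F.obj k) f) (c : Cocone F) (hc : IsColimit c) :
    HasBaseChange c.pt f := by
  have : IsIso (Functor.whiskerLeft F (evBaseChange 𝒪 f)) := by
    rw [NatTrans.isIso_iff_isIso_app]
    exact fun k ↦ (hasBaseChange_iff _ _).1 (hF k)
  exact (hasBaseChange_iff _ _).2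
    (isIso_app_coconePt_of_preservesColimit F (evBaseChange 𝒪 f) c hc)

lemma hasBaseChange_coproduct {B B' : C} (hB : IsIrreducible J B) (hB' : IsIrreducible J B')
    (f : B' ⟶ B) {I : Type u} (F : I → SheafMod 𝒪) (hF : ∀ i, HasBaseChange (F i) f) :
    HasBaseChange (∐ F) f := by
  have := hB.preservesColimitsOfShape_ev 𝒪 (Discrete I)
  have := hB'.preservesColimitsOfShape_ev 𝒪 (Discrete I)
  exact hasBaseChange_colimit f (Discrete.functor F) (fun i ↦ hF i.as) (colimit.cocone _)
    (colimit.isColimit _)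

lemma hasBaseChange_unit {B B' : C} (f : B' ⟶ B) :
    HasBaseChange (SheafOfModules.unit (ringSheaf 𝒪) : SheafMod 𝒪) f := by
  let := (𝒪.obj.map f.op).hom.toAlgebra
  exact IsBaseChange.linearMap (𝒪.obj.obj (op B)) (𝒪.obj.obj (op B'))

lemma hasBaseChange_free {B B' : C} (hB : IsIrreducible J B) (hB' : IsIrreducible J B')
    (f : B' ⟶ B) (I : Type u) :
    HasBaseChange (SheafOfModules.free I : SheafMod 𝒪) f :=
  hasBaseChange_coproduct hB hB' f _ fun _ ↦ hasBaseChange_unit f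

instance (B : C) : (ev 𝒪 B).Additive where
  map_add := rfl

lemma ev_injective {M N : SheafMod 𝒪} (i : M ⟶ N) [Mono i] (B : C) :
    Function.Injective ((ev 𝒪 B).map i) :=
  (ModuleCat.mono_iff_injective _).1 inferInstance

lemma ev_exact (S : ShortComplex (SheafMod 𝒪)) (hS : S.Exact) [Mono S.f] (B : C) :
    Function.Exact ((ev 𝒪 B).map S.f) ((ev 𝒪 B).map S.g) :=
  (ShortComplex.ShortExact.moduleCat_exact_iff_function_exact _).1
    (hS.map_of_mono_of_preservesKernel (ev 𝒪 B) inferInstance inferInstance)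

/-- Sections are left exact and tensoring with the flat `𝒪(B')` preserves kernels, so the comparison
map for `S.X₁` is the map induced on kernels by two isomorphisms. -/
lemma hasBaseChange_of_exact {B B' : C} (f : B' ⟶ B) (hf : (𝒪.obj.map f.op).hom.Flat)
    (S : ShortComplex (SheafMod 𝒪)) (hS : S.Exact) [Mono S.f]
    (h₂ : HasBaseChange S.X₂ f) (h₃ : HasBaseChange S.X₃ f) : HasBaseChange S.X₁ f := by
  let φ := (𝒪.obj.map f.op).hom
  let := φ.toAlgebra
  let (M : SheafMod 𝒪) := Module.compHom ((ev 𝒪 B').obj M) φ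
  have (M : SheafMod 𝒪) : IsScalarTower (𝒪.obj.obj (op B)) (𝒪.obj.obj (op B')) ((ev 𝒪 B').obj M) :=
    ⟨fun r s n ↦ mul_smul (φ r) s n⟩
  have : Module.Flat (𝒪.obj.obj (op B)) (𝒪.obj.obj (op B')) := hf
  refine IsBaseChange.of_left_exact _ _ (semilinearRestrict (secRes S.X₂ f))
    (semilinearRestrict (secRes S.X₃ f)) (f := ((ev 𝒪 B).map S.f).hom)
    (g := ((ev 𝒪 B).map S.g).hom)
    (f' := ((ev 𝒪 B').map S.f).hom) (g' := ((ev 𝒪 B').map S.g).hom) ?_ ?_ h₂ h₃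
    (ev_exact S hS B) (ev_injective S.f B) (ev_exact S hS B') (ev_injective S.f B')
  · ext x
    exact (congr($((evRes 𝒪 f).naturality S.f) x))
  · ext x
    exact (congr($((evRes 𝒪 f).naturality S.g) x))

/-- A base change is generated over the new ring by the image of the original module. -/
lemma HasBaseChange.range_eq_top {M : SheafMod 𝒪} {B B' : C} {f : B' ⟶ B}
    (h : HasBaseChange M f) (N : Submodule (𝒪.obj.obj (op B')) ((ev 𝒪 B').obj M))
    (hN : ∀ m, secRes M f m ∈ N) : N = ⊤ := by
  let φ := (𝒪.obj.map f.op).hom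
  let := φ.toAlgebra
  let := Module.compHom ((ev 𝒪 B').obj M) φ
  have : IsScalarTower (𝒪.obj.obj (op B)) (𝒪.obj.obj (op B')) ((ev 𝒪 B').obj M) :=
    ⟨fun r s n ↦ mul_smul (φ r) s n⟩
  have h' : IsBaseChange (𝒪.obj.obj (op B')) (semilinearRestrict (secRes M f)) := h
  refine top_unique fun x _ ↦ ?_
  exact h'.inductionOn x (motive := fun x ↦ x ∈ N) N.zero_mem hN (fun s _ ↦ N.smul_mem s)
    fun _ _ ↦ N.add_mem

/-- The global section of a presheaf of modules attached to a section over a terminal object. -/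
def globalSection {R : Cᵒᵖ ⥤ RingCat.{u}} {T : C} (hT : IsTerminal T)
    (M : PresheafOfModules.{u} R) (m : M.obj (op T)) : M.sections :=
  PresheafOfModules.sectionsMk (fun U ↦ M.map (hT.from U.unop).op m) fun U V f ↦ by
    rw [← M.map_comp_apply]
    exact M.congr_map_apply (Quiver.Hom.unop_inj (hT.hom_ext _ _)) m

/-- Base change from a terminal object implies generation by global sections. -/
def generatingSections (hJ : EnoughIrreducibles J) {T : C} (hT : IsTerminal T)
    (M : SheafMod 𝒪) (hM : ∀ B, IsIrreducible J B → HasBaseChange M (hT.from B)) :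
    M.GeneratingSections where
  I := (ev 𝒪 T).obj M
  s := globalSection hT M.val
  epi := by
    refine epi_of_surjective hJ _ fun B hB ↦ ?_
    have h := (hM B hB).range_eq_top
      (LinearMap.range ((ev 𝒪 B).map (M.freeHomEquiv.symm (globalSection hT M.val))).hom) fun m ↦ ?_
    · exact LinearMap.range_eq_top.1 h
    · refine ⟨(SheafOfModules.freeSection m).val (op B), ?_⟩
      have h := M.sectionsMap_freeHomEquiv_symm_freeSection (globalSection hT M.val) m
      exact congr($(h).val (op B))

/-- All sections over `T` generate `M`. By flatness the kernel of the resulting free cover has base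
change again, so its sections over `T` supply the relations. -/
lemma nonempty_presentation (hJ : EnoughIrreducibles J) {T : C} (hT : IsTerminal T)
    (hT' : IsIrreducible J T)
    (hf : ∀ B, IsIrreducible J B → (𝒪.obj.map (hT.from B).op).hom.Flat)
    (M : SheafMod 𝒪) (hM : ∀ B, IsIrreducible J B → HasBaseChange M (hT.from B)) :
    Nonempty M.Presentation := by
  let G := generatingSections hJ hT M hM
  let S := ShortComplex.mk (kernel.ι G.π) G.π (kernel.condition _)
  have hS : S.Exact := ShortComplex.exact_of_f_is_kernel _ (kernelIsKernel _)
  exact ⟨⟨G, generatingSections hJ hT (kernel G.π) fun B hB ↦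
    hasBaseChange_of_exact _ (hf B hB) S hS (hasBaseChange_free hT' hB _ _) (hM B hB)⟩⟩

/-- A cokernel of free modules is a colimit of modules with base change. -/
lemma hasBaseChange_of_presentation {M : SheafMod 𝒪} (P : M.Presentation) {B B' : C}
    (hB : IsIrreducible J B) (hB' : IsIrreducible J B') (f : B' ⟶ B) : HasBaseChange M f := by
  have := hB.preservesColimitsOfSize_ev (𝒪 := 𝒪)
  have := hB'.preservesColimitsOfSize_ev (𝒪 := 𝒪)
  have h := hasBaseChange_colimit f _ (by
    rintro (_ | _)
    · exact hasBaseChange_free hB hB' f _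
    · exact hasBaseChange_free hB hB' f _) _ P.isColimit
  exact h

section Over

variable {V : C}

lemma isIrreducible_over {U : Over V} (hU : IsIrreducible J U.left) :
    IsIrreducible (J.over V) U := by
  intro S hS
  rw [GrothendieckTopology.mem_over_iff] at hS
  have := hU _ hS
  exact (Sieve.overEquiv U).injective (this.trans (by simp))

lemma enoughIrreducibles_over (hJ : EnoughIrreducibles J) : EnoughIrreducibles (J.over V) := by
  intro U S hS
  rw [GrothendieckTopology.mem_over_iff]
  refine hJ _ _ fun B f hB ↦ ?_
  rw [Sieve.overEquiv_iff]
  exact hS _ _ (isIrreducible_over hB)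

lemma isIrreducible_of_over {U : Over V} (hU : IsIrreducible (J.over V) U) :
    IsIrreducible J U.left := by
  intro S hS
  have := hU ((Sieve.overEquiv U).symm S) (by
    rw [GrothendieckTopology.mem_over_iff]; simpa using hS)
  simpa using (Sieve.overEquiv U).symm.injective (this.trans (by simp))

variable (V) in
/-- The restriction of a sheaf of modules to a slice. -/
def overMod (M : SheafMod 𝒪) : SheafMod (𝒪.over V) := SheafOfModules.over M V

end Over

lemma hasBaseChange_of_isQuasicoherent {M : SheafMod 𝒪}
    (hM : SheafOfModules.IsQuasicoherent.{u} (R := ringSheaf 𝒪) M)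
    {B B' : C} (hB : IsIrreducible J B) (hB' : IsIrreducible J B') (f : B' ⟶ B) :
    HasBaseChange M f := by
  obtain ⟨⟨q⟩⟩ := hM
  -- The objects with presentations cover the irreducible `B`, so `B` itself maps to one of them.
  obtain ⟨i, ⟨g⟩⟩ : Sieve.ofObjects q.X B (𝟙 B) := by
    rw [hB _ (q.coversTop B)]
    trivial
  exact hasBaseChange_of_presentation (𝒪 := 𝒪.over (q.X i)) (M := overMod (q.X i) M)
    (q.presentation i)
    (B := Over.mk g) (B' := Over.mk (f ≫ g)) (isIrreducible_over hB) (isIrreducible_over hB')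
    (Over.homMk f)

/-- The criterion for quasi-coherence in terms of irreducible objects. -/
theorem isQuasicoherent_iff (hJ : EnoughIrreducibles J)
    (hf : ∀ (B B' : C) (f : B' ⟶ B), IsIrreducible J B → IsIrreducible J B' →
      (𝒪.obj.map f.op).hom.Flat) (M : SheafMod 𝒪) :
    SheafOfModules.IsQuasicoherent M ↔ ∀ (B B' : C) (f : B' ⟶ B), IsIrreducible J B →
      IsIrreducible J B' → HasBaseChange M f := by
  constructor
  · exact fun hM B B' f hB hB' ↦ hasBaseChange_of_isQuasicoherent hM hB hB' f
  · intro h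
    -- In the slice over an irreducible `B` the object `B` is terminal and irreducible, and flatness
    -- and base change are inherited from the site.
    have hP (B : {B : C // IsIrreducible J B}) : Nonempty ((M.over B.1).Presentation) :=
      nonempty_presentation (𝒪 := 𝒪.over B.1) (M := overMod B.1 M) (enoughIrreducibles_over hJ)
        Over.mkIdTerminal (isIrreducible_over B.2)
        (fun U hU ↦ hf _ _ _ B.2 (isIrreducible_of_over hU))
        (fun U hU ↦ h _ _ _ B.2 (isIrreducible_of_over hU))
    let q : SheafOfModules.QuasicoherentData.{u, u, u, u} (R := ringSheaf 𝒪) M :=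
      { I := {B : C // IsIrreducible J B}
        X := fun B ↦ B.1
        coversTop := fun U ↦ hJ U _ fun B f hB ↦ ⟨⟨B, hB⟩, ⟨𝟙 B⟩⟩
        presentation := fun B ↦ (hP B).some }
    exact q.isQuasicoherent

end Site

/-! ### Systems of modules on a finite poset -/

section Poset

variable {R : Type u} [CommRing R] {ι : Type u} [PartialOrder ι]

/-- The transition maps of a system of modules. -/
def tr (F : ι ⥤ ModuleCat.{u} R) {i j : ι} (h : i ≤ j) : F.obj i →ₗ[R] F.obj j :=
  (F.map (homOfLE h)).hom

lemma tr_refl (F : ι ⥤ ModuleCat.{u} R) {i : ι} (h : i ≤ i) (x : F.obj i) : tr F h x = x :=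
  congr($(F.map_id i) x)

lemma tr_tr (F : ι ⥤ ModuleCat.{u} R) {i j k : ι} (h : i ≤ j) (h' : j ≤ k) (x : F.obj i) :
    tr F h' (tr F h x) = tr F (h.trans h') x :=
  congr($(F.map_comp (homOfLE h) (homOfLE h')) x).symm

lemma app_tr {F G : ι ⥤ ModuleCat.{u} R} (f : F ⟶ G) {i j : ι} (h : i ≤ j) (x : F.obj i) :
    f.app j (tr F h x) = tr G h (f.app i x) :=
  congr($(f.naturality (homOfLE h)) x)

/-- Families which are compatible on a subset. -/
def Compat (F : ι ⥤ ModuleCat.{u} R) (S : Set ι) (s : ∀ i, F.obj i) : Prop :=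
  ∀ ⦃i j⦄ (h : i ≤ j), i ∈ S → j ∈ S → tr F h (s i) = s j

lemma Compat.map {F G : ι ⥤ ModuleCat.{u} R} (f : F ⟶ G) {S : Set ι} {s : ∀ i, F.obj i}
    (hs : Compat F S s) : Compat G S fun i ↦ f.app i (s i) := fun i j h hi hj ↦ by
  rw [← app_tr, hs h hi hj]

lemma Compat.add {F : ι ⥤ ModuleCat.{u} R} {S : Set ι} {s t : ∀ i, F.obj i}
    (hs : Compat F S s) (ht : Compat F S t) : Compat F S fun i ↦ s i + t i := fun i j h hi hj ↦ by
  rw [map_add, hs h hi hj, ht h hi hj]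

/-- A system is flasque if every family which is compatible above an index extends to it. -/
def Flasque (F : ι ⥤ ModuleCat.{u} R) : Prop :=
  ∀ i s, Compat F (Set.Ioi i) s → ∃ a : F.obj i, ∀ j (h : i < j), tr F h.le a = s j

/-- Short exact sequences of systems of modules. -/
structure IsSES {F G H : ι ⥤ ModuleCat.{u} R} (f : F ⟶ G) (g : G ⟶ H) : Prop where
  inj : ∀ i, Function.Injective (f.app i)
  exact : ∀ i, Function.Exact (f.app i) (g.app i)
  surj : ∀ i, Function.Surjective (g.app i)

/-- A morphism which is surjective on global sections. -/
def SectionSurj {G H : ι ⥤ ModuleCat.{u} R} (g : G ⟶ H) : Prop :=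
  ∀ t, Compat H Set.univ t → ∃ s, Compat G Set.univ s ∧ ∀ i, g.app i (s i) = t i

/-- Induction on the size of `S`: lift over the complement of a minimal element `i`, choose any
preimage `b` of `t i`, and use flasqueness of `F` to correct `b` so that it restricts to the lift
already chosen. -/
lemma IsSES.lift [Finite ι] {F G H : ι ⥤ ModuleCat.{u} R} {f : F ⟶ G} {g : G ⟶ H}
    (h : IsSES f g) (hF : Flasque F) (S : Set ι) (hS : IsUpperSet S) (t : ∀ i, H.obj i)
    (ht : Compat H S t) : ∃ s, Compat G S s ∧ ∀ i ∈ S, g.app i (s i) = t i := by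
  classical
  induction hn : S.ncard using Nat.strong_induction_on generalizing S with
  | _ n ih =>
    obtain rfl | hne := S.eq_empty_or_nonempty
    · exact ⟨fun i ↦ 0, by simp [Compat], by simp⟩
    obtain ⟨i, hi⟩ := S.toFinite.exists_minimal hne
    have hS' : IsUpperSet (S \ {i}) := by
      intro j k hjk hj
      refine ⟨hS hjk hj.1, ?_⟩
      rintro rfl
      exact hj.2 (le_antisymm hjk (hi.2 hj.1 hjk))
    obtain ⟨s, hs, hst⟩ := ih _ (by
      rw [← hn]; exact Set.ncard_sdiff_singleton_lt_of_mem hi.1 S.toFinite) (S \ {i}) hS'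
      (fun j k hjk hj hk ↦ ht hjk hj.1 hk.1) rfl
    obtain ⟨b, hb⟩ := h.surj i (t i)
    have hgt : ∀ j, i < j → j ∈ S \ {i} := fun j hj ↦ ⟨hS hj.le hi.1, hj.ne'⟩
    -- Above `i` the discrepancy between `b` and `s` dies in `H`, so it comes from `F`; elsewhere
    -- the value of `e` is irrelevant.
    have key : ∀ j, ∃ e : F.obj j, ∀ hj : i < j, f.app j e = tr G hj.le b - s j := by
      intro j
      by_cases hj : i < j
      · obtain ⟨e, he⟩ := (h.exact j (tr G hj.le b - s j)).1 (by
          rw [map_sub, app_tr, hb, hst j (hgt j hj), ht hj.le hi.1 (hgt j hj).1, sub_self])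
        exact ⟨e, fun _ ↦ he⟩
      · exact ⟨0, fun h ↦ absurd h hj⟩
    choose e he using key
    obtain ⟨a, ha⟩ := hF i e (by
      intro j k hjk hj hk
      apply h.inj k
      rw [app_tr, he j hj, he k hk, map_sub, tr_tr, hs hjk (hgt j hj) (hgt k hk)])
    have hai (j) (hj : i < j) : tr G hj.le (b - f.app i a) = s j := by
      rw [map_sub, ← app_tr, ha j hj, he j hj, sub_sub_cancel]
    refine ⟨Function.update s i (b - f.app i a), ?_, ?_⟩
    · intro j k hjk hj hk
      by_cases hji : j = i
      · subst hji
        by_cases hki : k = j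
        · subst hki
          rw [tr_refl]
        · rw [Function.update_self, Function.update_of_ne hki,
            hai k (lt_of_le_of_ne hjk (Ne.symm hki))]
      · have hki : k ≠ i := by
          rintro rfl
          exact hji (le_antisymm hjk (hi.2 hj hjk))
        rw [Function.update_of_ne hji, Function.update_of_ne hki, hs hjk ⟨hj, hji⟩ ⟨hk, hki⟩]
    · intro j hj
      by_cases hji : j = i
      · subst hji
        rw [Function.update_self, map_sub, hb, (h.exact j _).2 ⟨a, rfl⟩, sub_zero]
      · rw [Function.update_of_ne hji, hst j ⟨hj, hji⟩]

lemma IsSES.sectionSurj [Finite ι] {F G H : ι ⥤ ModuleCat.{u} R} {f : F ⟶ G} {g : G ⟶ H}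
    (h : IsSES f g) (hF : Flasque F) : SectionSurj g := fun t ht ↦ by
  obtain ⟨s, hs, hst⟩ := h.lift hF Set.univ isUpperSet_univ t ht
  exact ⟨s, hs, fun i ↦ hst i trivial⟩

lemma IsSES.flasque [Finite ι] {F G H : ι ⥤ ModuleCat.{u} R} {f : F ⟶ G} {g : G ⟶ H}
    (h : IsSES f g) (hF : Flasque F) (hG : Flasque G) : Flasque H := fun i t ht ↦ by
  obtain ⟨s, hs, hst⟩ := h.lift hF (Set.Ioi i) (isUpperSet_Ioi i) t ht
  obtain ⟨a, ha⟩ := hG i s hs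
  exact ⟨g.app i a, fun j hj ↦ by rw [← app_tr, ha j hj, hst j hj]⟩

/-- The cokernel of a morphism of systems of modules. -/
@[simps]
def coker {F G : ι ⥤ ModuleCat.{u} R} (f : F ⟶ G) : ι ⥤ ModuleCat.{u} R where
  obj i := ModuleCat.of R (G.obj i ⧸ LinearMap.range (f.app i).hom)
  map {i j} h := ModuleCat.ofHom (Submodule.mapQ _ _ (G.map h).hom (by
    rintro _ ⟨x, rfl⟩
    exact ⟨F.map h x, congr($(f.naturality h) x)⟩))
  map_id i := by
    ext x
    simp
  map_comp h h' := by
    ext x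
    simp

/-- The projection to the cokernel. -/
@[simps]
def toCoker {F G : ι ⥤ ModuleCat.{u} R} (f : F ⟶ G) : G ⟶ coker f where
  app i := ModuleCat.ofHom (Submodule.mkQ _)

lemma isSES_toCoker {F G : ι ⥤ ModuleCat.{u} R} (f : F ⟶ G)
    (hf : ∀ i, Function.Injective (f.app i)) : IsSES f (toCoker f) where
  inj := hf
  exact _ _ := Submodule.Quotient.mk_eq_zero _
  surj _ := Submodule.mkQ_surjective _

/-- Morphisms from the cokernel. -/
@[simps]
def cokerDesc {F G H : ι ⥤ ModuleCat.{u} R} (f : F ⟶ G) (g : G ⟶ H)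
    (hfg : ∀ i x, g.app i (f.app i x) = 0) : coker f ⟶ H where
  app i := ModuleCat.ofHom (Submodule.liftQ _ (g.app i).hom (by
    rintro _ ⟨x, rfl⟩
    exact hfg i x))
  naturality i j h := by
    ext x
    obtain ⟨x, rfl⟩ := Submodule.mkQ_surjective _ x
    exact congr($(g.naturality h) x)

/-- The product of two systems of modules. -/
@[simps]
def prodSys (F G : ι ⥤ ModuleCat.{u} R) : ι ⥤ ModuleCat.{u} R where
  obj i := ModuleCat.of R (F.obj i × G.obj i)
  map h := ModuleCat.ofHom (LinearMap.prodMap (F.map h).hom (G.map h).hom)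

/-- If the sections of a quotient of `F ⟶ I` lift to `I` for some flasque `I`, then this holds for
any flasque system which contains `F`. -/
lemma IsSES.sectionSurj_of_sectionSurj [Finite ι] {F I Z I' Z' : ι ⥤ ModuleCat.{u} R}
    {f : F ⟶ I} {g : I ⟶ Z} {f' : F ⟶ I'} {g' : I' ⟶ Z'} (h : IsSES f g) (h' : IsSES f' g')
    (hI : Flasque I) (hg : SectionSurj g) : SectionSurj g' := by
  -- The cokernel of `d` is, up to a sign, the pushout of `f` and `f'`. It is an extension of `Z'`
  -- by `I` and of `Z` by `I'`.
  let d : F ⟶ prodSys I I' :=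
    { app := fun i ↦ ModuleCat.ofHom (LinearMap.prod (f.app i).hom (f'.app i).hom)
      naturality := fun i j a ↦ by
        refine ModuleCat.hom_ext (LinearMap.ext fun x ↦ Prod.ext ?_ ?_)
        · exact congr($(f.naturality a) x)
        · exact congr($(f'.naturality a) x) }
  let p₁ : prodSys I I' ⟶ I := { app := fun i ↦ ModuleCat.ofHom (LinearMap.fst R _ _) }
  let p₂ : prodSys I I' ⟶ I' := { app := fun i ↦ ModuleCat.ofHom (LinearMap.snd R _ _) }
  let i₁ : I ⟶ prodSys I I' :=
    { app := fun i ↦ ModuleCat.ofHom (LinearMap.inl R _ _)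
      naturality := fun i j a ↦ ModuleCat.hom_ext (LinearMap.ext fun x ↦
        Prod.ext rfl (map_zero (I'.map a).hom).symm) }
  let i₂ : I' ⟶ prodSys I I' :=
    { app := fun i ↦ ModuleCat.ofHom (LinearMap.inr R _ _)
      naturality := fun i j a ↦ ModuleCat.hom_ext (LinearMap.ext fun x ↦
        Prod.ext (map_zero (I.map a).hom).symm rfl) }
  let q₁ : coker d ⟶ Z := cokerDesc d (p₁ ≫ g) fun i x ↦ (h.exact i _).2 ⟨x, rfl⟩
  let q₂ : coker d ⟶ Z' := cokerDesc d (p₂ ≫ g') fun i x ↦ (h'.exact i _).2 ⟨x, rfl⟩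
  have hq₂ : IsSES (i₁ ≫ toCoker d) q₂ :=
    { inj := fun i ↦ by
        refine (injective_iff_map_eq_zero ((i₁ ≫ toCoker d).app i).hom).2 fun x hx ↦ ?_
        obtain ⟨y, hy⟩ := (Submodule.Quotient.mk_eq_zero _).1 hx
        have hy₁ : f.app i y = x := congr($(hy).1)
        have hy₂ : f'.app i y = 0 := congr($(hy).2)
        rw [← hy₁, h'.inj i (hy₂.trans (map_zero _).symm), map_zero]
      exact := fun i x ↦ by
        obtain ⟨x, rfl⟩ := Submodule.mkQ_surjective _ x
        constructor
        · intro hx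
          obtain ⟨y, hy⟩ := (h'.exact i x.2).1 hx
          refine ⟨x.1 - f.app i y, (Submodule.Quotient.eq _).2 ⟨-y, ?_⟩⟩
          refine Prod.ext ?_ ?_
          · change f.app i (-y) = x.1 - f.app i y - x.1
            rw [map_neg]; abel
          · change f'.app i (-y) = 0 - x.2
            rw [map_neg, hy]; abel
        · rintro ⟨y, hy⟩
          rw [← hy]
          exact map_zero (g'.app i).hom
      surj := fun i z ↦ by
        obtain ⟨y, rfl⟩ := h'.surj i z
        exact ⟨Submodule.Quotient.mk (0, y), rfl⟩ }
  -- As `I` is flasque, `t` lifts to a section `e` of the cokernel. Its image in `Z` lifts to a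
  -- section `s` of `I` by `hg`; then `e` minus the image of `s` lies in `I'` and still maps to `t`.
  intro t ht
  obtain ⟨e, he, het⟩ := hq₂.sectionSurj hI t ht
  obtain ⟨s, hs, hse⟩ := hg _ (he.map q₁)
  have key : ∀ i, ∃ y : I'.obj i, (i₂ ≫ toCoker d).app i y =
      e i - (i₁ ≫ toCoker d).app i (s i) := by
    intro i
    obtain ⟨x, hx⟩ := Submodule.mkQ_surjective _ (e i)
    have h1 : g.app i (s i) = g.app i x.1 := by
      rw [hse i, ← hx]; rfl
    obtain ⟨y, hy⟩ := (h.exact i (x.1 - s i)).1 (by rw [map_sub, h1, sub_self])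
    refine ⟨x.2 - f'.app i y, ?_⟩
    rw [← hx]
    refine (Submodule.Quotient.eq _).2 ⟨-y, Prod.ext ?_ ?_⟩
    · change f.app i (-y) = 0 - (x.1 - s i)
      rw [map_neg, hy]; abel
    · change f'.app i (-y) = x.2 - f'.app i y - (x.2 - 0)
      rw [map_neg]; abel
  choose y hy using key
  have hinj (i) : Function.Injective ((i₂ ≫ toCoker d).app i) := by
    refine (injective_iff_map_eq_zero ((i₂ ≫ toCoker d).app i).hom).2 fun x hx ↦ ?_
    obtain ⟨y, hy⟩ := (Submodule.Quotient.mk_eq_zero _).1 hx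
    have hy₁ : f.app i y = 0 := congr($(hy).1)
    have hy₂ : f'.app i y = x := congr($(hy).2)
    rw [← hy₂, h.inj i (hy₁.trans (map_zero _).symm), map_zero]
  refine ⟨y, fun i j hij _ _ ↦ hinj j ?_, fun i ↦ ?_⟩
  · rw [app_tr, hy, hy, map_sub, he hij trivial trivial, ← app_tr, hs hij trivial trivial]
  · have h2 := congr(q₂.app i $(hy i))
    rw [map_sub, het i, (hq₂.exact i _).2 ⟨s i, rfl⟩, sub_zero] at h2
    exact h2

end Poset

/-! ### Godement systems and acyclicity -/

section Poset

variable {R : Type u} [CommRing R] {ι : Type u} [PartialOrder ι]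

/-- The Godement system of a system of modules. -/
@[simps]
def godement (F : ι ⥤ ModuleCat.{u} R) : ι ⥤ ModuleCat.{u} R where
  obj i := ModuleCat.of R (∀ j : {j // i ≤ j}, F.obj j.1)
  map {i j} h := ModuleCat.ofHom
    (LinearMap.pi fun k : {k // j ≤ k} ↦
      LinearMap.proj (φ := fun k : {k // i ≤ k} ↦ F.obj k.1) ⟨k.1, h.le.trans k.2⟩)

/-- The components of a section of the Godement system. -/
def godApp {F : ι ⥤ ModuleCat.{u} R} {i : ι} (c : (godement F).obj i) (j : {j // i ≤ j}) :
    F.obj j.1 :=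
  (show ∀ j : {j // i ≤ j}, F.obj j.1 from c) j

lemma godApp_ext {F : ι ⥤ ModuleCat.{u} R} {i : ι} {c d : (godement F).obj i}
    (h : ∀ j, godApp c j = godApp d j) : c = d := funext h

/-- The section of the Godement system with given components. -/
def godMk {F : ι ⥤ ModuleCat.{u} R} {i : ι} (c : ∀ j : {j // i ≤ j}, F.obj j.1) :
    (godement F).obj i := c

/-- The functoriality of the Godement system. -/
@[simps]
def godementMap {F G : ι ⥤ ModuleCat.{u} R} (f : F ⟶ G) : godement F ⟶ godement G where
  app i := ModuleCat.ofHom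
    (show (∀ j : {j // i ≤ j}, F.obj j.1) →ₗ[R] ∀ j : {j // i ≤ j}, G.obj j.1 from
      LinearMap.pi fun k ↦ (f.app k.1).hom ∘ₗ LinearMap.proj k)

/-- The embedding of a system of modules in its Godement system. -/
@[simps]
def toGodement (F : ι ⥤ ModuleCat.{u} R) : F ⟶ godement F where
  app i := ModuleCat.ofHom
    (show F.obj i →ₗ[R] ∀ j : {j // i ≤ j}, F.obj j.1 from LinearMap.pi fun k ↦ tr F k.2)
  naturality i j h := by
    refine ModuleCat.hom_ext (LinearMap.ext fun x ↦ godApp_ext fun k ↦ ?_)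
    exact tr_tr F h.le k.2 x

/-- The cokernel of the embedding of a system of modules in its Godement system. -/
abbrev godementQuot (F : ι ⥤ ModuleCat.{u} R) : ι ⥤ ModuleCat.{u} R := coker (toGodement F)

lemma toGodement_naturality {F G : ι ⥤ ModuleCat.{u} R} (f : F ⟶ G) :
    toGodement F ≫ godementMap f = f ≫ toGodement G := by
  ext i : 2
  refine ModuleCat.hom_ext (LinearMap.ext fun x ↦ godApp_ext fun k ↦ ?_)
  exact app_tr f k.2 x

lemma toGodement_self {F : ι ⥤ ModuleCat.{u} R} {i : ι} (x : F.obj i) :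
    godApp ((toGodement F).app i x) ⟨i, le_rfl⟩ = x := tr_refl F le_rfl x

/-- The functoriality of the Godement quotient. -/
def godementQuotMap {F G : ι ⥤ ModuleCat.{u} R} (f : F ⟶ G) :
    godementQuot F ⟶ godementQuot G :=
  cokerDesc _ (godementMap f ≫ toCoker _) fun i x ↦
    (Submodule.Quotient.mk_eq_zero _).2
      ⟨f.app i x, congr($((toGodement_naturality f).symm).app i x)⟩

lemma isSES_toGodement (F : ι ⥤ ModuleCat.{u} R) :
    IsSES (toGodement F) (toCoker (toGodement F)) :=
  isSES_toCoker _ fun i x y h ↦ by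
    rw [← toGodement_self x, h, toGodement_self]

lemma flasque_godement (F : ι ⥤ ModuleCat.{u} R) : Flasque (godement F) := by
  classical
  intro i s hs
  -- The component at `i` itself is not seen by restriction to any `j > i`, so it may be `0`; the
  -- others are forced.
  refine ⟨godMk fun j ↦ if h : i < j.1 then godApp (s j.1) ⟨j.1, le_rfl⟩ else 0, fun j hj ↦ godApp_ext fun k ↦ ?_⟩
  have hk : i < k.1 := hj.trans_le k.2
  refine (dif_pos hk).trans ?_
  exact congr(godApp $((hs k.2 hj hk).symm) ⟨k.1, le_rfl⟩)

/-- A global section of a Godement system is an arbitrary family of elements, so preimages can be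
chosen index by index. -/
lemma IsSES.sectionSurj_godementMap {G H : ι ⥤ ModuleCat.{u} R} {g : G ⟶ H}
    (hg : ∀ i, Function.Surjective (g.app i)) : SectionSurj (godementMap g) := fun t ht ↦ by
  choose y hy using fun j ↦ hg j (godApp (t j) ⟨j, le_rfl⟩)
  refine ⟨fun i ↦ godMk fun j ↦ y j.1, fun i j h _ _ ↦ rfl, fun i ↦ godApp_ext fun j ↦ (hy j.1).trans ?_⟩
  exact congr(godApp $((ht j.2 trivial trivial).symm) ⟨j.1, le_rfl⟩)

/-- An instance of the nine lemma: products of exact sequences are exact, and an element of `F.obj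
i` is recovered from its image in the Godement system as the component at `i`. -/
lemma IsSES.godementQuot {F G H : ι ⥤ ModuleCat.{u} R} {f : F ⟶ G} {g : G ⟶ H}
    (h : IsSES f g) : IsSES (godementQuotMap f) (godementQuotMap g) where
  inj i := by
    refine (injective_iff_map_eq_zero ((godementQuotMap f).app i).hom).2 fun x hx ↦ ?_
    obtain ⟨c, rfl⟩ := Submodule.mkQ_surjective _ x
    obtain ⟨y, hy⟩ := (Submodule.Quotient.mk_eq_zero _).1 hx
    have hy' : y = f.app i (godApp c ⟨i, le_rfl⟩) := by
      rw [← toGodement_self y]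
      exact congr(godApp $hy ⟨i, le_rfl⟩)
    refine (Submodule.Quotient.mk_eq_zero _).2 ⟨godApp c ⟨i, le_rfl⟩, godApp_ext fun j ↦ h.inj j.1 ?_⟩
    refine (app_tr f j.2 _).trans ?_
    rw [← hy']
    exact congr(godApp $hy j)
  exact i x := by
    obtain ⟨c, rfl⟩ := Submodule.mkQ_surjective _ x
    constructor
    · intro hx
      obtain ⟨z, hz⟩ := (Submodule.Quotient.mk_eq_zero _).1 hx
      obtain ⟨y, rfl⟩ := h.surj i z
      have hc (j : {j // i ≤ j}) : g.app j.1 (godApp c j - tr G j.2 y) = 0 := by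
        rw [map_sub, app_tr, sub_eq_zero]
        exact congr(godApp $(hz.symm) j)
      choose e he using fun j ↦ (h.exact j.1 _).1 (hc j)
      refine ⟨Submodule.Quotient.mk (godMk e), (Submodule.Quotient.eq _).2 ⟨-y, godApp_ext fun j ↦ ?_⟩⟩
      change tr G j.2 (-y) = f.app j.1 (e j) - godApp c j
      rw [he, map_neg]; abel
    · rintro ⟨y, hy⟩
      obtain ⟨y, rfl⟩ := Submodule.mkQ_surjective _ y
      rw [← hy]
      refine (Submodule.Quotient.mk_eq_zero _).2 ⟨0, (map_zero _).trans (godApp_ext fun j ↦ ?_)⟩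
      exact ((h.exact j.1 _).2 ⟨godApp y j, rfl⟩).symm
  surj i x := by
    obtain ⟨c, rfl⟩ := Submodule.mkQ_surjective _ x
    choose e he using fun j : {j // i ≤ j} ↦ h.surj j.1 (godApp c j)
    exact ⟨Submodule.Quotient.mk (godMk e), congrArg (Submodule.Quotient.mk) (funext he)⟩

/-- Systems of modules whose first `k` cohomology groups in positive degrees vanish. -/
def Acyclic : ℕ → (ι ⥤ ModuleCat.{u} R) → Prop
  | 0, _ => True
  | k + 1, F => ∃ (I Z : ι ⥤ ModuleCat.{u} R) (f : F ⟶ I) (g : I ⟶ Z),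
      IsSES f g ∧ Flasque I ∧ SectionSurj g ∧ Acyclic k Z

variable [Finite ι]

/-- Acyclicity is witnessed by some flasque embedding; the comparison lemma moves the lifting
property to the Godement embedding. -/
lemma Acyclic.sectionSurj {k : ℕ} {F : ι ⥤ ModuleCat.{u} R} (h : Acyclic (k + 1) F) :
    SectionSurj (toCoker (toGodement F)) := by
  obtain ⟨I, Z, f, g, hfg, hI, hg, _⟩ := h
  exact hfg.sectionSurj_of_sectionSurj (isSES_toGodement F) hI hg

/-- Dimension shifting: the Godement quotients of `F`, `I`, `Z` form a short exact sequence with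
flasque middle term. A section of the last one lifts to the Godement system of `Z` because `Z` is
acyclic, and from there to that of `I`. -/
lemma Acyclic.godementQuot {k : ℕ} {F : ι ⥤ ModuleCat.{u} R} (h : Acyclic (k + 1) F) :
    Acyclic k (godementQuot F) := by
  induction k generalizing F with
  | zero => trivial
  | succ k ih =>
    obtain ⟨I, Z, f, g, hfg, hI, hg, hZ⟩ := h
    refine ⟨FiniteSpace.godementQuot I, FiniteSpace.godementQuot Z, godementQuotMap f,
      godementQuotMap g, hfg.godementQuot,
      (isSES_toGodement I).flasque hI (flasque_godement I), fun t ht ↦ ?_, ih hZ⟩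
    obtain ⟨s, hs, hst⟩ := hZ.sectionSurj t ht
    obtain ⟨r, hr, hrs⟩ := IsSES.sectionSurj_godementMap hfg.surj s hs
    refine ⟨_, hr.map (toCoker _), fun i ↦ ?_⟩
    rw [← hst i, ← hrs i]
    rfl

open TensorProduct

variable (F : ι ⥤ ModuleCat.{u} R) in
/-- The module of global sections of a system of modules. -/
def sections : Submodule R (∀ i, F.obj i) where
  carrier := {s | Compat F Set.univ s}
  add_mem' hs ht := hs.add ht
  zero_mem' _ _ _ _ _ := map_zero _
  smul_mem' r s hs i j h hi hj := by
    simp only [Pi.smul_apply, map_smul, hs h hi hj]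

variable (F : ι ⥤ ModuleCat.{u} R) in
/-- The evaluation of global sections. -/
def sectionsProj (i : ι) : sections F →ₗ[R] F.obj i := LinearMap.proj i ∘ₗ (sections F).subtype

end Poset

/-! ### Flatness in short exact sequences, and tensor products with finite products -/

section Flat

open TensorProduct

variable {R : Type u} [CommRing R]

lemma flat_pi {κ : Type*} [Finite κ] (M : κ → Type*) [∀ k, AddCommGroup (M k)]
    [∀ k, Module R (M k)] [∀ k, Module.Flat R (M k)] : Module.Flat R (∀ k, M k) := by
  classical
  have := Fintype.ofFinite κ
  exact Module.Flat.of_linearEquiv (DFinsupp.linearEquivFunOnFintype (R := R) (M := M)).symm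

/-- The kernel of a surjection between flat modules is flat. -/
lemma flat_of_exact {A B C : Type u} [AddCommGroup A] [AddCommGroup B] [AddCommGroup C]
    [Module R A] [Module R B] [Module R C] {f : A →ₗ[R] B} {g : B →ₗ[R] C}
    (hf : Function.Injective f) (hfg : Function.Exact f g) (hg : Function.Surjective g)
    [Module.Flat R B] [Module.Flat R C] : Module.Flat R A := by
  rw [Module.Flat.iff_rTensor_preserves_injective_linearMap]
  intro N P _ _ _ _ h hh
  -- The composite `N ⊗ A → P ⊗ A → P ⊗ B` also factors through `N ⊗ B`; there the first map is
  -- injective because `C` is flat, the second because `B` is.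
  have h1 : Function.Injective (f.lTensor P ∘ₗ h.rTensor A) := by
    rw [LinearMap.lTensor_comp_rTensor, ← LinearMap.rTensor_comp_lTensor]
    exact (Module.Flat.rTensor_preserves_injective_linearMap h hh).comp
      (LinearMap.lTensor_injective_of_exact_of_flat g hg f hf hfg N)
  exact Function.Injective.of_comp h1

/-- An extension of flat modules is flat. -/
lemma flat_of_exact_middle {A B C : Type u} [AddCommGroup A] [AddCommGroup B] [AddCommGroup C]
    [Module R A] [Module R B] [Module R C] {f : A →ₗ[R] B} {g : B →ₗ[R] C}
    (hfg : Function.Exact f g) (hg : Function.Surjective g) (hf : Function.Injective f)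
    [Module.Flat R A] [Module.Flat R C] : Module.Flat R B := by
  rw [Module.Flat.iff_rTensor_preserves_injective_linearMap]
  intro N P _ _ _ _ h hh
  refine (injective_iff_map_eq_zero _).2 fun x hx ↦ ?_
  have h1 : h.rTensor C (g.lTensor N x) = 0 := by
    rw [← LinearMap.comp_apply, LinearMap.rTensor_comp_lTensor, ← LinearMap.lTensor_comp_rTensor,
      LinearMap.comp_apply, hx, map_zero]
  have h2 := (injective_iff_map_eq_zero _).1
    (Module.Flat.rTensor_preserves_injective_linearMap (M := C) h hh) _ h1
  obtain ⟨y, rfl⟩ := (lTensor_exact N hfg hg x).1 h2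
  have h3 : f.lTensor P (h.rTensor A y) = 0 := by
    rw [← LinearMap.comp_apply, LinearMap.lTensor_comp_rTensor, ← LinearMap.rTensor_comp_lTensor,
      LinearMap.comp_apply, hx]
  have h4 := (injective_iff_map_eq_zero _).1
    (LinearMap.lTensor_injective_of_exact_of_flat g hg f hf hfg P) _ h3
  rw [(injective_iff_map_eq_zero _).1
    (Module.Flat.rTensor_preserves_injective_linearMap (M := A) h hh) _ h4, map_zero]

variable (N : Type u) [AddCommGroup N] [Module R N] {κ : Type u}
  {M : κ → Type u} [∀ k, AddCommGroup (M k)] [∀ k, Module R (M k)]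

lemma piRight_eq [Fintype κ] [DecidableEq κ] (y : N ⊗[R] (∀ k, M k)) (k : κ) :
    piRight R R N M y k = (LinearMap.proj k : (∀ k, M k) →ₗ[R] M k).lTensor N y := by
  induction y using TensorProduct.induction_on with
  | zero => simp
  | tmul n m => simp
  | add x y hx hy => rw [map_add, map_add, Pi.add_apply, hx, hy]

lemma tensor_pi_ext [Finite κ] {x y : N ⊗[R] (∀ k, M k)}
    (h : ∀ k, (LinearMap.proj k : (∀ k, M k) →ₗ[R] M k).lTensor N x =
      (LinearMap.proj k : (∀ k, M k) →ₗ[R] M k).lTensor N y) : x = y := by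
  classical
  have := Fintype.ofFinite κ
  refine (piRight R R N M).injective (funext fun k ↦ ?_)
  rw [piRight_eq, piRight_eq, h]

lemma exists_tensor_pi [Finite κ] (t : ∀ k, N ⊗[R] M k) :
    ∃ y : N ⊗[R] (∀ k, M k), ∀ k, (LinearMap.proj k : (∀ k, M k) →ₗ[R] M k).lTensor N y = t k := by
  classical
  have := Fintype.ofFinite κ
  refine ⟨(piRight R R N M).symm t, fun k ↦ ?_⟩
  rw [← piRight_eq, LinearEquiv.apply_symm_apply]

end Flat

/-! ### Flatness of global sections of acyclic flat systems -/

section Poset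

open TensorProduct

variable {R : Type u} [CommRing R] {ι : Type u} [PartialOrder ι]

/-- The formation of global sections of a system of modules commutes with tensor products. -/
structure TensorSections (F : ι ⥤ ModuleCat.{u} R) : Prop where
  inj : ∀ (N : Type u) [AddCommGroup N] [Module R N] (x : N ⊗[R] sections F),
    (∀ i, (sectionsProj F i).lTensor N x = 0) → x = 0
  exists_lift : ∀ (N : Type u) [AddCommGroup N] [Module R N] (t : ∀ i, N ⊗[R] F.obj i),
    (∀ (i j : ι) (h : i ≤ j), (tr F h).lTensor N (t i) = t j) →
      ∃ x : N ⊗[R] sections F, ∀ i, (sectionsProj F i).lTensor N x = t i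

/-- The components of a section of the Godement system. -/
def godProj (F : ι ⥤ ModuleCat.{u} R) (i : ι) :
    (godement F).obj i →ₗ[R] F.obj i where
  toFun c := godApp c ⟨i, le_rfl⟩
  map_add' _ _ := rfl
  map_smul' _ _ := rfl

/-- At each index the embedding in the Godement system is split by `godProj`, so the quotient is a
retract of a finite product of flat modules. -/
lemma flat_godementQuot [Finite ι] (F : ι ⥤ ModuleCat.{u} R) (hF : ∀ i, Module.Flat R (F.obj i)) (i : ι) :
    Module.Flat R ((godementQuot F).obj i) := by
  have : Module.Flat R ((godement F).obj i) := flat_pi fun j : {j // i ≤ j} ↦ F.obj j.1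
  let p : (godement F).obj i →ₗ[R] (godementQuot F).obj i :=
    ((toCoker (toGodement F)).app i).hom
  let e : (godement F).obj i →ₗ[R] (godement F).obj i :=
    LinearMap.id - ((toGodement F).app i).hom ∘ₗ godProj F i
  refine Module.Flat.of_retract (M := (godement F).obj i) (Submodule.liftQ _ e ?_) p ?_
  · rintro _ ⟨x, rfl⟩
    have h : godProj F i ((toGodement F).app i x) = x := toGodement_self x
    change (toGodement F).app i x - (toGodement F).app i (godProj F i ((toGodement F).app i x)) = 0
    rw [h, sub_self]
  · refine LinearMap.ext fun x ↦ ?_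
    obtain ⟨c, rfl⟩ := Submodule.mkQ_surjective _ x
    change p (c - (toGodement F).app i (godProj F i c)) = p c
    rw [map_sub, sub_eq_self]
    exact ((isSES_toGodement F).exact i _).2 ⟨_, rfl⟩

/-- If only the component at `i` can be nonzero, every element comes from `F.obj i`. Thus the
support shrinks with each Godement quotient. -/
lemma subsingleton_godementQuot (F : ι ⥤ ModuleCat.{u} R) (i : ι)
    (hF : ∀ j, i < j → Subsingleton (F.obj j)) : Subsingleton ((godementQuot F).obj i) := by
  refine subsingleton_of_forall_eq 0 fun x ↦ ?_
  obtain ⟨c, rfl⟩ := Submodule.mkQ_surjective _ x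
  refine (Submodule.Quotient.mk_eq_zero _).2 ⟨godProj F i c, godApp_ext fun j ↦ ?_⟩
  obtain ⟨j, hj⟩ := j
  obtain rfl | hj' := hj.eq_or_lt
  · exact toGodement_self _
  · have := hF j hj'
    exact Subsingleton.elim _ _

/-- The projection from the global sections of the Godement system to those of the quotient. -/
def godementSections (F : ι ⥤ ModuleCat.{u} R) :
    (∀ i, F.obj i) →ₗ[R] sections (godementQuot F) where
  toFun a := ⟨fun i ↦ (toCoker (toGodement F)).app i (godMk fun j ↦ a j.1),
    fun _ _ _ _ _ ↦ rfl⟩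
  map_add' _ _ := rfl
  map_smul' _ _ := rfl

/-- This is the sequence of global sections of `F`, its Godement system and the quotient, the
sections of the Godement system being arbitrary families. -/
lemma exact_godementSections (F : ι ⥤ ModuleCat.{u} R) :
    Function.Exact (sections F).subtype (godementSections F) := by
  intro a
  constructor
  · intro ha
    refine ⟨⟨a, fun i j h _ _ ↦ ?_⟩, rfl⟩
    obtain ⟨y, hy⟩ := ((isSES_toGodement F).exact i _).1 congr($(ha).1 i)
    have hy' : y = a i := by
      rw [← toGodement_self y, hy]
      rfl
    rw [← hy']
    exact congr(godApp $hy ⟨j, h⟩)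
  · rintro ⟨s, rfl⟩
    refine Subtype.ext (funext fun i ↦ ((isSES_toGodement F).exact i _).2 ⟨s.1 i, ?_⟩)
    exact godApp_ext fun j ↦ s.2 j.2 trivial trivial

lemma Acyclic.surjective_godementSections [Finite ι] {F : ι ⥤ ModuleCat.{u} R} {k : ℕ}
    (h : Acyclic (k + 1) F) : Function.Surjective (godementSections F) := fun t ↦ by
  obtain ⟨s, hs, hst⟩ := h.sectionSurj t.1 t.2
  refine ⟨fun i ↦ godProj F i (s i), Subtype.ext (funext fun i ↦ ?_)⟩
  rw [← hst i]
  refine congrArg ((toCoker (toGodement F)).app i) (godApp_ext fun j ↦ ?_)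
  exact congr(godApp $((hs j.2 trivial trivial).symm) ⟨j.1, le_rfl⟩)

/-- Induction along `0 → Γ(F) → ∏ F_i → Γ(Q) → 0`, where `Q` is the Godement quotient. It loses one
degree of acyclicity but stays flat, and its support shrinks so that `hF'` persists. Since `Γ(Q)` is
flat, so is `Γ(F)`, and the sequence remains exact after tensoring. The support condition is void
for `k = Nat.card ι`. -/
theorem Acyclic.flat_sections_aux [Finite ι] (k : ℕ) (F : ι ⥤ ModuleCat.{u} R) (h : Acyclic k F)
    (hF : ∀ i, Module.Flat R (F.obj i))
    (hF' : ∀ i, (Set.Ioi i).ncard + k < Nat.card ι → Subsingleton (F.obj i)) :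
    Module.Flat R (sections F) ∧ TensorSections F := by
  induction k generalizing F with
  | zero =>
    -- As `i` is not in `Set.Ioi i`, the bound in `hF'` always holds for `k = 0`, so `F` is zero.
    have (i : ι) : Subsingleton (F.obj i) := hF' i <| by
      rw [add_zero, ← Set.ncard_univ]
      exact Set.ncard_lt_ncard ((Set.ssubset_univ_iff).2 fun h ↦ lt_irrefl i
        (h.symm.subset (Set.mem_univ i))) (Set.toFinite _)
    have : Subsingleton (sections F) := inferInstance
    exact ⟨inferInstance, fun N _ _ x _ ↦ Subsingleton.elim _ _,
      fun N _ _ t _ ↦ ⟨0, fun i ↦ Subsingleton.elim _ _⟩⟩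
  | succ k ih =>
    obtain ⟨hQ, hQ'⟩ := ih (FiniteSpace.godementQuot F) h.godementQuot (flat_godementQuot F hF) fun i hi ↦
      subsingleton_godementQuot F i fun j hj ↦ hF' j <| by
        have : (Set.Ioi j).ncard < (Set.Ioi i).ncard :=
          Set.ncard_lt_ncard (Set.Ioi_ssubset_Ioi hj) (Set.toFinite _)
        omega
    have hA : Module.Flat R (∀ i, F.obj i) := flat_pi fun i ↦ F.obj i
    have hex := exact_godementSections F
    have hsurj := h.surjective_godementSections
    have hinj := (sections F).injective_subtype
    refine ⟨flat_of_exact hinj hex hsurj, fun N _ _ x hx ↦ ?_, fun N _ _ t ht ↦ ?_⟩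
    · refine (injective_iff_map_eq_zero _).1
        (LinearMap.lTensor_injective_of_exact_of_flat _ hsurj _ hinj hex N) x ?_
      refine tensor_pi_ext N fun i ↦ ?_
      rw [map_zero, ← LinearMap.comp_apply, ← LinearMap.lTensor_comp]
      exact hx i
    · obtain ⟨y, hy⟩ := exists_tensor_pi N t
      -- By induction it suffices to look at each index `i`. There compatibility of `t` says that
      -- `y` restricts to the image of `t i` under the Godement embedding, which dies in the
      -- quotient.
      have hy' : (godementSections F).lTensor N y = 0 := by
        refine hQ'.inj N _ fun i ↦ ?_
        let ρ : (∀ i, F.obj i) →ₗ[R] (∀ j : {j // i ≤ j}, F.obj j.1) :=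
          LinearMap.pi fun j ↦ LinearMap.proj j.1
        let η : F.obj i →ₗ[R] (∀ j : {j // i ≤ j}, F.obj j.1) := ((toGodement F).app i).hom
        let p : (∀ j : {j // i ≤ j}, F.obj j.1) →ₗ[R] (FiniteSpace.godementQuot F).obj i :=
          ((toCoker (toGodement F)).app i).hom
        have h1 : ρ.lTensor N y = η.lTensor N (t i) := by
          refine tensor_pi_ext N fun j ↦ ?_
          rw [← LinearMap.comp_apply, ← LinearMap.lTensor_comp, ← LinearMap.comp_apply,
            ← LinearMap.lTensor_comp]
          exact (hy j.1).trans (ht i j.1 j.2).symm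
        have h2 : p ∘ₗ η = 0 :=
          LinearMap.ext fun x ↦ ((isSES_toGodement F).exact i _).2 ⟨x, rfl⟩
        rw [← LinearMap.comp_apply, ← LinearMap.lTensor_comp]
        change (p ∘ₗ ρ).lTensor N y = 0
        rw [LinearMap.lTensor_comp, LinearMap.comp_apply, h1, ← LinearMap.comp_apply,
          ← LinearMap.lTensor_comp, h2, LinearMap.lTensor_zero, LinearMap.zero_apply]
      obtain ⟨x, rfl⟩ := (lTensor_exact N hex hsurj y).1 hy'
      refine ⟨x, fun i ↦ ?_⟩
      rw [← hy i, ← LinearMap.comp_apply, ← LinearMap.lTensor_comp]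
      rfl

/-- The global sections of an acyclic system of flat modules are flat, and their formation
commutes with tensor products. -/
theorem Acyclic.flat_sections [Finite ι] {F : ι ⥤ ModuleCat.{u} R} (h : Acyclic (Nat.card ι) F)
    (hF : ∀ i, Module.Flat R (F.obj i)) : Module.Flat R (sections F) ∧ TensorSections F :=
  h.flat_sections_aux _ _ hF fun i hi ↦ by omega

end Poset

/-! ### Irreducible open subsets of a finite topological space -/

section Top

variable {T : TopCat.{u}}

/-- `B` is the smallest open neighbourhood of `x`. -/
structure IsMinNhd (x : T) (B : Opens T) : Prop where
  mem : x ∈ B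
  le : ∀ V : Opens T, x ∈ V → B ≤ V

lemma IsMinNhd.isIrreducible {x : T} {B : Opens T} (h : IsMinNhd x B) :
    IsIrreducible (Opens.grothendieckTopology T) B := by
  intro S hS
  obtain ⟨V, f, hf, hx⟩ := hS x h.mem
  obtain rfl : V = B := le_antisymm f.le (h.le V hx)
  rw [← Sieve.id_mem_iff_eq_top]
  exact hf

lemma exists_isMinNhd [Finite T] (x : T) : ∃ B : Opens T, IsMinNhd x B :=
  ⟨⟨nhdsKer {x}, isOpen_nhdsKer⟩, subset_nhdsKer rfl, fun V hV ↦
    nhdsKer_minimal (Set.singleton_subset_iff.2 hV) V.2⟩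

lemma enoughIrreducibles_opens [Finite T] : EnoughIrreducibles (Opens.grothendieckTopology T) := by
  intro U S hS x hx
  obtain ⟨B, hB⟩ := exists_isMinNhd x
  exact ⟨B, homOfLE (hB.le U hx), hS _ _ hB.isIrreducible, hB.mem⟩

/-- The smallest neighbourhoods of the points of `B` cover `B`, so one of them is all of `B`. -/
lemma IsIrreducible.exists_isMinNhd [Finite T] {B : Opens T}
    (hB : IsIrreducible (Opens.grothendieckTopology T) B) : ∃ x, IsMinNhd x B := by
  let S : Sieve B :=
    { arrows := fun V _ ↦ ∃ x V', IsMinNhd x V' ∧ V' ≤ B ∧ V ≤ V'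
      downward_closed := by
        rintro V W f ⟨x, V', h, h', h''⟩ g
        exact ⟨x, V', h, h', g.le.trans h''⟩ }
  have hS : S ∈ Opens.grothendieckTopology T B := by
    intro x hx
    obtain ⟨V, hV⟩ := FiniteSpace.exists_isMinNhd x
    exact ⟨V, homOfLE (hV.le B hx), ⟨x, V, hV, hV.le B hx, le_rfl⟩, hV.mem⟩
  have : S.arrows (𝟙 B) := by
    rw [hB S hS]
    trivial
  obtain ⟨x, V, h, h', h''⟩ := this
  obtain rfl := le_antisymm h' h''
  exact ⟨x, h⟩

/-- An irreducible open subset of a union of open subsets is contained in one of them. -/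
lemma IsIrreducible.exists_le_of_le_sSup {B : Opens T}
    (hB : IsIrreducible (Opens.grothendieckTopology T) B) {𝒰 : Set (Opens T)} (h : B ≤ sSup 𝒰) :
    ∃ U ∈ 𝒰, B ≤ U := by
  let S : Sieve B :=
    { arrows := fun V _ ↦ ∃ U ∈ 𝒰, V ≤ U
      downward_closed := by
        rintro V W f ⟨U, hU, h⟩ g
        exact ⟨U, hU, g.le.trans h⟩ }
  have hS : S ∈ Opens.grothendieckTopology T B := by
    intro x hx
    obtain ⟨U, hU, hxU⟩ := Opens.mem_sSup.1 (h hx)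
    exact ⟨U ⊓ B, homOfLE inf_le_right, ⟨U, hU, inf_le_left⟩, ⟨hxU, hx⟩⟩
  have : S.arrows (𝟙 B) := by
    rw [hB S hS]
    trivial
  exact this

variable {𝒪 : Sheaf (Opens.grothendieckTopology T) CommRingCat.{u}}

lemma secRes_id (M : SheafMod 𝒪) {B : Opens T} (f : B ⟶ B) (m : (ev 𝒪 B).obj M) :
    secRes M f m = m := by
  obtain rfl : f = 𝟙 B := rfl
  exact congr($(M.val.presheaf.map_id _) m)

lemma secRes_secRes (M : SheafMod 𝒪) {B B' B'' : Opens T} (f : B' ⟶ B) (g : B'' ⟶ B')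
    (h : B'' ⟶ B) (m : (ev 𝒪 B).obj M) :
    secRes M g (secRes M f m) = secRes M h m := by
  obtain rfl : h = g ≫ f := rfl
  exact congr($(M.val.presheaf.map_comp f.op g.op) m).symm

lemma ev_secRes {M N : SheafMod 𝒪} (φ : M ⟶ N) {B B' : Opens T} (f : B' ⟶ B) (m : (ev 𝒪 B).obj M) :
    (ev 𝒪 B').map φ (secRes M f m) = secRes N f ((ev 𝒪 B).map φ m) :=
  (congr($((evRes 𝒪 f).naturality φ) m)).symm

/-- Sections are determined by their restrictions to the irreducible open subsets, and can be
glued from them. -/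
lemma existsUnique_section [Finite T] (M : SheafMod 𝒪) (W : Opens T)
    (s : ∀ B, IsIrreducible (Opens.grothendieckTopology T) B → B ≤ W → (ev 𝒪 B).obj M)
    (hs : ∀ B B' hB hB' hBW hBW' (h : B' ≤ B), secRes M (homOfLE h) (s B hB hBW) = s B' hB' hBW') :
    ∃! t : (ev 𝒪 W).obj M, ∀ B hB hBW, secRes M (homOfLE hBW) t = s B hB hBW := by
  have hM : Presieve.IsSheaf (Opens.grothendieckTopology T)
      (M.val.presheaf ⋙ CategoryTheory.forget _) :=
    (isSheaf_iff_isSheaf_of_type _ _).1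
      ((sheafCompose _ (CategoryTheory.forget Ab.{u})).obj ⟨M.val.presheaf, M.isSheaf⟩).property
  let P : Presieve W := fun B _ ↦ IsIrreducible (Opens.grothendieckTopology T) B
  have hP : Sieve.generate P ∈ Opens.grothendieckTopology T W :=
    enoughIrreducibles_opens _ _ fun B f hB ↦ ⟨_, 𝟙 B, f, hB, by simp⟩
  have hsh : P.IsSheafFor (M.val.presheaf ⋙ CategoryTheory.forget _) :=
    Presieve.isSheafFor_iff_generate _ |>.2 (hM _ hP)
  let x : P.FamilyOfElements (M.val.presheaf ⋙ CategoryTheory.forget _) := fun B f hB ↦ s B hB f.le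
  have hx : x.Compatible := by
    intro Y₁ Y₂ Z g₁ g₂ f₁ f₂ h₁ h₂ _
    -- The overlap `Z` need not be irreducible, so agreement is tested on the irreducible subsets
    -- covering it.
    let Q : Presieve Z := fun B _ ↦ IsIrreducible (Opens.grothendieckTopology T) B
    have hQ : Sieve.generate Q ∈ Opens.grothendieckTopology T Z :=
      enoughIrreducibles_opens _ _ fun B f hB ↦ ⟨_, 𝟙 B, f, hB, by simp⟩
    have hsep : Q.IsSeparatedFor (M.val.presheaf ⋙ CategoryTheory.forget _) :=
      (Presieve.isSheafFor_iff_generate _ |>.2 (hM _ hQ)).isSeparatedFor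
    refine hsep.ext fun B f hB ↦ ?_
    change secRes M f (secRes M g₁ (s Y₁ h₁ f₁.le)) = secRes M f (secRes M g₂ (s Y₂ h₂ f₂.le))
    rw [secRes_secRes M g₁ f (f ≫ g₁), secRes_secRes M g₂ f (f ≫ g₂)]
    exact (hs _ _ _ hB _ (f.le.trans (g₁ ≫ f₁).le) (f ≫ g₁).le).trans
      (hs _ _ _ _ _ _ (f ≫ g₂).le).symm
  obtain ⟨t, ht, ht'⟩ := hsh x hx
  exact ⟨t, fun B hB hBW ↦ ht (homOfLE hBW) hB, fun t' h ↦ ht' t' fun B f hB ↦ h B hB f.le⟩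

lemma section_ext [Finite T] (M : SheafMod 𝒪) {W : Opens T} {t t' : (ev 𝒪 W).obj M}
    (h : ∀ B (_ : IsIrreducible (Opens.grothendieckTopology T) B) (hBW : B ≤ W),
      secRes M (homOfLE hBW) t = secRes M (homOfLE hBW) t') : t = t' :=
  (existsUnique_section M W (fun B _ hBW ↦ secRes M (homOfLE hBW) t')
    fun B B' _ _ _ _ _ ↦ secRes_secRes M _ _ _ _).unique h fun _ _ _ ↦ rfl

end Top

/-! ### The system of modules attached to a sheaf of modules and an open subset -/

section System

variable {T : TopCat.{u}} {𝒪 : Sheaf (Opens.grothendieckTopology T) CommRingCat.{u}} {V W : Opens T}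

/-- The irreducible open subsets of `W`, ordered by reverse inclusion. -/
abbrev IrrOpens (W : Opens T) : Type u :=
  {B : Opens T // IsIrreducible (Opens.grothendieckTopology T) B ∧ B ≤ W}ᵒᵈ

instance [Finite T] : Finite (IrrOpens W) :=
  have : Finite (Opens T) := Finite.of_injective _ SetLike.coe_injective
  inferInstanceAs (Finite {B : Opens T // _})

/-- The sections over `B`, as a module over the sections of the structure sheaf over `V`. -/
def resEv (M : SheafMod 𝒪) {B V : Opens T} (h : B ≤ V) : ModuleCat.{u} (𝒪.obj.obj (op V)) :=
  (ModuleCat.restrictScalars (𝒪.obj.map (homOfLE h).op).hom).obj ((ev 𝒪 B).obj M)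

/-- Restriction of sections, as a linear map over the sections of the structure sheaf over `V`. -/
def resLin (M : SheafMod 𝒪) {B B' V : Opens T} (h : B ≤ V) (h' : B' ≤ B) :
    resEv M h →ₗ[𝒪.obj.obj (op V)] resEv M (h'.trans h) where
  toFun m := secRes M (homOfLE h') m
  map_add' := map_add (secRes M (homOfLE h'))
  map_smul' r m := by
    refine ((secRes M (homOfLE h')).map_smulₛₗ _ m).trans ?_
    exact congr($(congr($(𝒪.obj.map_comp (homOfLE h).op (homOfLE h').op).hom r)) •
      secRes M (homOfLE h') m).symm

/-- The sections over the irreducible open subsets of `W`, as modules over the sections of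
the structure sheaf over `V`. -/
def system (h : W ≤ V) (M : SheafMod 𝒪) : IrrOpens W ⥤ ModuleCat.{u} (𝒪.obj.obj (op V)) where
  obj B := resEv M (B.2.2.trans h)
  map {B B'} f := ModuleCat.ofHom (X := resEv M (B.2.2.trans h)) (Y := resEv M (B'.2.2.trans h))
    (resLin M (B.2.2.trans h) f.le)
  map_id B := by
    ext m
    exact secRes_id M (𝟙 B.1) m
  map_comp {B B' B''} f g := by
    ext m
    exact (secRes_secRes M (homOfLE f.le : B'.1 ⟶ B.1) (homOfLE g.le : B''.1 ⟶ B'.1)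
      (homOfLE (f ≫ g).le : B''.1 ⟶ B.1) m).symm

/-- The functoriality of `system`. -/
def systemMap (h : W ≤ V) {M N : SheafMod 𝒪} (φ : M ⟶ N) : system h M ⟶ system h N where
  app B := (ModuleCat.restrictScalars (𝒪.obj.map (homOfLE (B.2.2.trans h)).op).hom).map
    ((ev 𝒪 B.1).map φ)
  naturality B B' f := by
    ext m
    exact ev_secRes φ (homOfLE f.le : B'.1 ⟶ B.1) m

lemma isSES_systemMap (h : W ≤ V) (S : ShortComplex (SheafMod 𝒪)) (hS : S.ShortExact) :
    IsSES (systemMap h S.f) (systemMap h S.g) where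
  inj B := by
    have := hS.mono_f
    exact ev_injective S.f B.1
  exact B := by
    have := hS.mono_f
    exact ev_exact S hS.exact B.1
  surj B := by
    have := hS.epi_g
    have := B.2.1.preservesColimitsOfSize_ev (𝒪 := 𝒪)
    exact (ModuleCat.epi_iff_surjective ((ev 𝒪 B.1).map S.g)).1 inferInstance

lemma exists_section_of_compat [Finite T] (h : W ≤ V) (M : SheafMod 𝒪) {s : ∀ B, (system h M).obj B}
    (hs : Compat (system h M) Set.univ s) :
    ∃ t : (ev 𝒪 W).obj M, ∀ B : IrrOpens W, secRes M (homOfLE B.2.2) t = s B := by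
  obtain ⟨t, ht, -⟩ := existsUnique_section M W (fun B hB hBW ↦ s ⟨B, hB, hBW⟩)
    fun B B' hB hB' hBW hBW' h ↦ hs (i := ⟨B, hB, hBW⟩) (j := ⟨B', hB', hBW'⟩) h trivial trivial
  exact ⟨t, fun B ↦ ht _ B.2.1 B.2.2⟩

lemma compat_secRes (h : W ≤ V) (M : SheafMod 𝒪) (t : (ev 𝒪 W).obj M) :
    Compat (system h M) Set.univ fun B ↦ secRes M (homOfLE B.2.2) t :=
  fun _ _ _ _ _ ↦ secRes_secRes M _ _ _ t

lemma sectionSurj_systemMap [Finite T] (h : W ≤ V) {M N : SheafMod 𝒪} (φ : M ⟶ N)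
    (hφ : Function.Surjective ((ev 𝒪 W).map φ)) : SectionSurj (systemMap h φ) := by
  intro t ht
  obtain ⟨t', ht'⟩ := exists_section_of_compat h N ht
  obtain ⟨s, rfl⟩ := hφ t'
  exact ⟨_, compat_secRes h M s, fun B ↦ (ev_secRes φ _ s).trans (ht' B)⟩

lemma freeYonedaEquiv_naturality {C : Type u} [SmallCategory C] {R : Cᵒᵖ ⥤ RingCat.{u}}
    {M : PresheafOfModules.{u} R} {X Y : C} (f : X ⟶ Y)
    (g : (PresheafOfModules.free R).obj (yoneda.obj Y) ⟶ M) :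
    PresheafOfModules.freeYonedaEquiv ((PresheafOfModules.free R).map (yoneda.map f) ≫ g) =
      M.map f.op (PresheafOfModules.freeYonedaEquiv g) := by
  have h := (PresheafOfModules.freeAdjunction R).homEquiv_naturality_left (yoneda.map f) g
  simp only [PresheafOfModules.freeAdjunction_homEquiv] at h
  exact (congrArg yonedaEquiv h).trans (yonedaEquiv_naturality _ f).symm

/-- Sections of injective modules extend. -/
lemma surjective_secRes_of_injective (I : SheafMod 𝒪) [Injective I] (f : W ⟶ V) :
    Function.Surjective (secRes I f) := by
  intro s
  let adj := PresheafOfModules.sheafificationAdjunction (𝟙 (ringSheaf 𝒪).obj)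
  -- A section over `W` is a morphism from the free module on `W`; injectivity of `I` extends it
  -- along the monomorphism to the free module on `V`.
  let j := (PresheafOfModules.free (ringSheaf 𝒪).obj).map (yoneda.map f)
  have : Mono j := PresheafOfModules.mono_of_injective fun Z ↦
    Finsupp.mapDomain_injective (f := fun g : Z.unop ⟶ W ↦ g ≫ f) fun _ _ _ ↦ Subsingleton.elim _ _
  let L := PresheafOfModules.sheafification (𝟙 (ringSheaf 𝒪).obj)
  have : Mono (L.map j) := inferInstance
  let s' : (PresheafOfModules.free (ringSheaf 𝒪).obj).obj (yoneda.obj W) ⟶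
    (SheafOfModules.forget (ringSheaf 𝒪) ⋙
      PresheafOfModules.restrictScalars (𝟙 (ringSheaf 𝒪).obj)).obj I :=
    PresheafOfModules.freeYonedaEquiv.symm s
  let g := Injective.factorThru ((adj.homEquiv _ _).symm s') (L.map j)
  have hg : j ≫ adj.homEquiv _ _ g = s' := by
    rw [← adj.homEquiv_naturality_left, Injective.comp_factorThru, Equiv.apply_symm_apply]
  refine ⟨PresheafOfModules.freeYonedaEquiv (adj.homEquiv _ _ g), ?_⟩
  refine (freeYonedaEquiv_naturality f (adj.homEquiv _ _ g)).symm.trans ?_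
  refine (congrArg PresheafOfModules.freeYonedaEquiv hg).trans ?_
  exact Equiv.apply_symm_apply _ _

/-- A compatible family strictly below `B` glues to a section over the union `U` of the smaller
irreducible subsets, and sections of an injective module extend from `U` to `B`. -/
lemma flasque_system [Finite T] (h : W ≤ V) (I : SheafMod 𝒪) [Injective I] :
    Flasque (system h I) := by
  intro B s hs
  let U : Opens T := sSup {B' | IsIrreducible (Opens.grothendieckTopology T) B' ∧ B' < B.1}
  have hU : U ≤ B.1 := sSup_le fun B' h ↦ h.2.le
  have key {B' : Opens T} (hB' : IsIrreducible (Opens.grothendieckTopology T) B') (h : B' ≤ U) :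
      B' < B.1 := by
    obtain ⟨B'', hB'', h'⟩ := hB'.exists_le_of_le_sSup h
    exact h'.trans_lt hB''.2
  obtain ⟨t, ht, -⟩ := existsUnique_section I U (fun B' hB' h ↦ s ⟨B', hB', (h.trans hU).trans B.2.2⟩)
    fun B' B'' hB' hB'' hBW hBW' h ↦ hs (i := ⟨B', hB', (hBW.trans hU).trans B.2.2⟩)
      (j := ⟨B'', hB'', (hBW'.trans hU).trans B.2.2⟩) h (key hB' hBW) (key hB'' hBW')
  obtain ⟨a, rfl⟩ := surjective_secRes_of_injective I (homOfLE hU) t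
  refine ⟨a, fun j hj ↦ ?_⟩
  have hj' : j.1 ≤ U := le_sSup ⟨j.2.1, hj⟩
  exact (secRes_secRes I (homOfLE hU) (homOfLE hj') (homOfLE hj.le) a).symm.trans (ht j.1 j.2.1 hj')

end System

/-! ### Flatness and base change over open subsets without higher cohomology -/

section Acyclic

variable {T : TopCat.{u}} {𝒪 : Sheaf (Opens.grothendieckTopology T) CommRingCat.{u}} {V W : Opens T}

lemma acyclic_succ_system [Finite T] (h : W ≤ V) (S : ShortComplex (SheafMod 𝒪)) (hS : S.ShortExact)
    [Injective S.X₂] (hg : Function.Surjective ((ev 𝒪 W).map S.g)) {k : ℕ}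
    (hk : Acyclic k (system h S.X₃)) : Acyclic (k + 1) (system h S.X₁) :=
  ⟨_, _, _, _, isSES_systemMap h S hS, flasque_system h S.X₂, sectionSurj_systemMap h S.g hg, hk⟩

/-- Dimension shifting along the kernels of the differentials: `K` is the kernel in degree `n` and
the quotient `I.X n / K` is the next kernel. Exactness of sections over `W` provides the lifts. -/
lemma acyclic_system_of_exact [Finite T] (h : W ≤ V) (I : CochainComplex (SheafMod 𝒪) ℕ)
    [∀ n, Injective (I.X n)]
    (hI : ∀ n, (ShortComplex.mk _ _ (I.d_comp_d n (n + 1) (n + 2))).Exact)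
    (hW : ∀ n, Function.Exact ((ev 𝒪 W).map (I.d n (n + 1))) ((ev 𝒪 W).map (I.d (n + 1) (n + 2))))
    (k : ℕ) : ∀ (n : ℕ) (K : SheafMod 𝒪) (i : K ⟶ I.X n) [Mono i] (w : i ≫ I.d n (n + 1) = 0),
      (ShortComplex.mk _ _ w).Exact → Acyclic k (system h K) := by
  induction k with
  | zero => exact fun n K i _ _ _ ↦ trivial
  | succ k ih =>
    intro n K i _ w hex
    let Z := kernel (I.d (n + 1) (n + 2))
    let g : I.X n ⟶ Z := kernel.lift _ (I.d n (n + 1)) (I.d_comp_d _ _ _)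
    have hg : g ≫ kernel.ι _ = I.d n (n + 1) := kernel.lift_ι _ _ _
    have wg : i ≫ g = 0 := by
      rw [← cancel_mono (kernel.ι _), Category.assoc, hg, w, zero_comp]
    have : Epi g := (hI n).epi_kernelLift
    let S := ShortComplex.mk i g wg
    have hS : S.ShortExact :=
      { exact := by
          let φ : S ⟶ ShortComplex.mk _ _ w :=
            { τ₁ := 𝟙 _, τ₂ := 𝟙 _, τ₃ := kernel.ι _ }
          have : Mono φ.τ₃ := inferInstanceAs (Mono (kernel.ι _))
          have : Epi φ.τ₁ := inferInstanceAs (Epi (𝟙 _))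
          have : IsIso φ.τ₂ := inferInstanceAs (IsIso (𝟙 _))
          exact (ShortComplex.exact_iff_of_epi_of_isIso_of_mono φ).2 hex
        mono_f := inferInstanceAs (Mono i)
        epi_g := inferInstanceAs (Epi g) }
    have : Injective S.X₂ := inferInstanceAs (Injective (I.X n))
    refine acyclic_succ_system h S hS ?_ (ih (n + 1) Z (kernel.ι _) (kernel.condition _)
      (ShortComplex.exact_of_f_is_kernel _ (kernelIsKernel _)))
    intro z
    obtain ⟨y, hy⟩ := (hW n ((ev 𝒪 W).map (kernel.ι _) z)).1 (by
      rw [← ConcreteCategory.comp_apply, ← Functor.map_comp, kernel.condition, Functor.map_zero]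
      rfl)
    refine ⟨y, ev_injective (kernel.ι (I.d (n + 1) (n + 2))) W ?_⟩
    rw [← hy, ← ConcreteCategory.comp_apply, ← Functor.map_comp]
    exact congr($(congrArg (ev 𝒪 W).map hg) y)

/-- The comparison of sections over `W` with families of sections over the irreducible open
subsets. -/
def toSections (h : W ≤ V) (M : SheafMod 𝒪) :
    resEv M h →ₗ[𝒪.obj.obj (op V)] sections (system h M) where
  toFun m := ⟨fun B ↦ resLin M h B.2.2 m, compat_secRes h M m⟩
  map_add' m m' := Subtype.ext (funext fun B ↦ map_add (resLin M h B.2.2) m m')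
  map_smul' r m := Subtype.ext (funext fun B ↦ map_smul (resLin M h B.2.2) r m)

/-- Sections over `W` are families of sections over the irreducible open subsets. -/
def sectionsEquiv [Finite T] (h : W ≤ V) (M : SheafMod 𝒪) :
    resEv M h ≃ₗ[𝒪.obj.obj (op V)] sections (system h M) :=
  LinearEquiv.ofBijective (toSections h M) ⟨fun m m' hm ↦ section_ext M fun B hB hBW ↦
      congr(($hm).1 ⟨B, hB, hBW⟩), fun s ↦ by
    obtain ⟨t, ht⟩ := exists_section_of_compat h M s.2
    exact ⟨t, Subtype.ext (funext ht)⟩⟩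

variable (𝒪) in
/-- The structure sheaf as a module. -/
abbrev unitMod : SheafMod 𝒪 := SheafOfModules.unit (ringSheaf 𝒪)

/-- As an `𝒪(V)`-module, `𝒪(W)` is the module of global sections of the system of the flat modules
`𝒪(B)`. -/
theorem flat_map_of_acyclic [Finite T] (h : W ≤ V)
    (hf : ∀ B, IsIrreducible (Opens.grothendieckTopology T) B → ∀ hB : B ≤ V,
      (𝒪.obj.map (homOfLE hB).op).hom.Flat)
    (hA : ∀ k, Acyclic k (system h (unitMod 𝒪))) : (𝒪.obj.map (homOfLE h).op).hom.Flat := by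
  have := ((hA _).flat_sections fun B ↦ hf B.1 B.2.1 (B.2.2.trans h)).1
  have : Module.Flat (𝒪.obj.obj (op V)) (resEv (unitMod 𝒪) h) :=
    Module.Flat.of_linearEquiv (sectionsEquiv h (unitMod 𝒪))
  exact this

open TensorProduct

/-- Multiplication of sections of the structure sheaf over `W` with restrictions of sections
of a module over `V`. -/
def tensorRes (h : W ≤ V) (M : SheafMod 𝒪) :
    (ev 𝒪 V).obj M ⊗[𝒪.obj.obj (op V)] resEv (unitMod 𝒪) h →ₗ[𝒪.obj.obj (op V)] resEv M h :=
  TensorProduct.lift (LinearMap.mk₂ _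
    (fun n s ↦ (show 𝒪.obj.obj (op W) from s) • secRes M (homOfLE h) n)
    (fun n n' s ↦ by rw [map_add, smul_add]; rfl)
    (fun r n s ↦ by
      rw [LinearMap.map_smulₛₗ, smul_smul, mul_comm, mul_smul]
      rfl)
    (fun n s s' ↦ add_smul (R := 𝒪.obj.obj (op W)) (M := (ev 𝒪 W).obj M) _ _ _)
    (fun r n s ↦ mul_smul (α := 𝒪.obj.obj (op W)) (β := (ev 𝒪 W).obj M) _ _ _))

lemma hasBaseChange_iff_tensorRes (h : W ≤ V) (M : SheafMod 𝒪) :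
    HasBaseChange M (homOfLE h) ↔ Function.Bijective (tensorRes h M) := by
  let φ := (𝒪.obj.map (homOfLE h).op).hom
  let := φ.toAlgebra
  let := Module.compHom ((ev 𝒪 W).obj M) φ
  have : IsScalarTower (𝒪.obj.obj (op V)) (𝒪.obj.obj (op W)) ((ev 𝒪 W).obj M) :=
    ⟨fun r s n ↦ mul_smul (φ r) s n⟩
  unfold HasBaseChange IsSemiBaseChange IsBaseChange IsTensorProduct
  let e := TensorProduct.comm (𝒪.obj.obj (op V)) (resEv (unitMod 𝒪) h) ((ev 𝒪 V).obj M)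
  rw [← (e.bijective.of_comp_iff (tensorRes h M))]
  refine iff_of_eq (congrArg Function.Bijective ?_)
  funext x
  refine TensorProduct.induction_on x (map_zero _) (fun s n ↦ ?_) (fun x y hx hy ↦ ?_)
  · exact TensorProduct.lift.tmul _ _
  · rw [map_add]
    exact (congrArg₂ (· + ·) hx hy).trans (map_add ((tensorRes h M) ∘ₗ e.toLinearMap) x y).symm

lemma resLin_tensorRes (h : W ≤ V) {B : Opens T} (hB : B ≤ W) (M : SheafMod 𝒪)
    (x : (ev 𝒪 V).obj M ⊗[𝒪.obj.obj (op V)] resEv (unitMod 𝒪) h) :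
    resLin M h hB (tensorRes h M x) =
      tensorRes (hB.trans h) M ((resLin (unitMod 𝒪) h hB).lTensor _ x) := by
  induction x using TensorProduct.induction_on with
  | zero => simp only [map_zero]
  | add x y hx hy => simp only [map_add, hx, hy]
  | tmul n s =>
    refine ((secRes M (homOfLE hB)).map_smulₛₗ _ _).trans ?_
    rw [secRes_secRes M (homOfLE h) (homOfLE hB) (homOfLE (hB.trans h))]
    rfl

/-- With limits over the irreducible `B ⊆ W`: `M(V) ⊗ 𝒪(W) = M(V) ⊗ lim 𝒪(B) = lim (M(V) ⊗ 𝒪(B)) =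
lim M(B) = M(W)`. Acyclicity is used for the second equality. -/
theorem hasBaseChange_of_acyclic [Finite T] (h : W ≤ V)
    (hf : ∀ B, IsIrreducible (Opens.grothendieckTopology T) B → ∀ hB : B ≤ V,
      (𝒪.obj.map (homOfLE hB).op).hom.Flat)
    (hA : ∀ k, Acyclic k (system h (unitMod 𝒪))) (M : SheafMod 𝒪)
    (hM : ∀ B, IsIrreducible (Opens.grothendieckTopology T) B → ∀ hB : B ≤ V,
      HasBaseChange M (homOfLE hB)) : HasBaseChange M (homOfLE h) := by
  have hTS := ((hA _).flat_sections fun B ↦ hf B.1 B.2.1 (B.2.2.trans h)).2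
  have hM' (B : IrrOpens W) := (hasBaseChange_iff_tensorRes (B.2.2.trans h) M).1
    (hM B.1 B.2.1 (B.2.2.trans h))
  rw [hasBaseChange_iff_tensorRes]
  let N := (ev 𝒪 V).obj M
  let e := (sectionsEquiv h (unitMod 𝒪)).lTensor N
  have he (x) (B : IrrOpens W) : (sectionsProj (system h (unitMod 𝒪)) B).lTensor N (e x) =
      (resLin (unitMod 𝒪) h B.2.2).lTensor N x := by
    exact (LinearMap.lTensor_comp_apply N (sectionsProj (system h (unitMod 𝒪)) B)
      (sectionsEquiv h (unitMod 𝒪)).toLinearMap x).symm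
  refine ⟨(injective_iff_map_eq_zero _).2 fun x hx ↦ ?_, fun m ↦ ?_⟩
  · refine e.injective ((hTS.inj N _ fun B ↦ (hM' B).1 ?_).trans (map_zero e).symm)
    rw [he]
    refine (resLin_tensorRes h B.2.2 M x).symm.trans ?_
    rw [hx, map_zero]
    exact (map_zero _).symm
  · choose t ht using fun B : IrrOpens W ↦ (hM' B).2 (resLin M h B.2.2 m)
    obtain ⟨x, hx⟩ := hTS.exists_lift N t fun B B' hBB' ↦ (hM' B').1 (by
      refine (resLin_tensorRes (B.2.2.trans h) hBB' M (t B)).symm.trans ?_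
      rw [ht, ht]
      exact secRes_secRes M (homOfLE B.2.2) (homOfLE hBB') (homOfLE B'.2.2) m)
    obtain ⟨y, rfl⟩ := e.surjective x
    refine ⟨y, section_ext M (W := W) (t := tensorRes h M y) (t' := m) fun B hB hBW ↦ ?_⟩
    refine (resLin_tensorRes h hBW M y).trans ?_
    refine (congrArg (tensorRes (hBW.trans h) M) ?_).trans (ht ⟨B, hB, hBW⟩)
    exact (he y ⟨B, hB, hBW⟩).symm.trans (hx ⟨B, hB, hBW⟩)

end Acyclic

/-! ### Sections over intersections of irreducible open subsets of semi-separated finite spaces -/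

section Diagonal

/-- The product of two open subsets. -/
def prodOpen {S T : TopCat.{u}} (B : Opens S) (B' : Opens T) : Opens (TopCat.of (S × T)) :=
  ⟨(B : Set S) ×ˢ (B' : Set T), B.2.prod B'.2⟩

lemma IsIrreducible.prod {S T : TopCat.{u}} [Finite S] [Finite T] {B : Opens S} {B' : Opens T}
    (hB : IsIrreducible (Opens.grothendieckTopology S) B)
    (hB' : IsIrreducible (Opens.grothendieckTopology T) B') :
    IsIrreducible (Opens.grothendieckTopology (TopCat.of (S × T))) (prodOpen B B') := by
  obtain ⟨x, hx⟩ := hB.exists_isMinNhd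
  obtain ⟨y, hy⟩ := hB'.exists_isMinNhd
  refine IsMinNhd.isIrreducible (x := (x, y)) ⟨⟨hx.mem, hy.mem⟩, fun V hV ↦ ?_⟩
  obtain ⟨U, U', hU, hU', hxU, hyU', h⟩ := isOpen_prod_iff.1 V.2 x y hV
  exact (Set.prod_mono (hx.le ⟨U, hU⟩ hxU) (hy.le ⟨U', hU'⟩ hyU')).trans h

variable {X : RingedSpace.{u, u}}

lemma ev_exact_of_isIrreducible {T : TopCat.{u}}
    {𝒪 : Sheaf (Opens.grothendieckTopology T) CommRingCat.{u}}
    (S : ShortComplex (SheafMod 𝒪)) (hS : S.Exact) {B : Opens T}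
    (hB : IsIrreducible (Opens.grothendieckTopology T) B) :
    Function.Exact ((ev 𝒪 B).map S.f) ((ev 𝒪 B).map S.g) := by
  have := hB.preservesColimitsOfSize_ev (𝒪 := 𝒪)
  have : (ev 𝒪 B).PreservesHomology := inferInstance
  exact (ShortComplex.ShortExact.moduleCat_exact_iff_function_exact _).1 (hS.map (ev 𝒪 B))

/-- The cohomology of `δ_* I` in degree `n + 1` is `R^(n+1) δ_* 𝒪 = 0`. Sections over the
irreducible `B × B'` keep this exactness, and they are the sections of `I` over `B ⊓ B'`. -/
lemma IsSemiSeparated.exact (hX : IsSemiSeparated X)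
    (I : InjectiveResolution (SheafOfModules.unit (ringCatSheaf X))) (n : ℕ) {B B' : Opens X.carrier}
    (hB : IsIrreducible (Opens.grothendieckTopology X.carrier) B)
    (hB' : IsIrreducible (Opens.grothendieckTopology X.carrier) B') :
    Function.Exact ((ev X.sheaf (B ⊓ B')).map (I.cocomplex.d n (n + 1)))
      ((ev X.sheaf (B ⊓ B')).map (I.cocomplex.d (n + 1) (n + 2))) := by
  have := hX.finite
  have h0 := (hX.isZero (n + 1) n.succ_pos).of_iso (I.isoRightDerivedObj (pushforward (diagonal X)) (n + 1)).symm
  have h1 : ((((pushforward (diagonal X)).mapHomologicalComplex _).obj I.cocomplex)).ExactAt (n + 1) :=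
    (HomologicalComplex.exactAt_iff_isZero_homology _ _).2 h0
  have h2 := (HomologicalComplex.exactAt_iff' _ n (n + 1) (n + 2) (by simp)
    (by simp only [CochainComplex.next]; rfl)).1 h1
  exact ev_exact_of_isIrreducible (𝒪 := (prod X X).sheaf) _ h2 (hB.prod hB')

lemma IsSemiSeparated.acyclic (hX : IsSemiSeparated X) {B B' : Opens X.carrier}
    (hB : IsIrreducible (Opens.grothendieckTopology X.carrier) B)
    (hB' : IsIrreducible (Opens.grothendieckTopology X.carrier) B') (k : ℕ) :
    Acyclic k (system (𝒪 := X.sheaf) (inf_le_left : B ⊓ B' ≤ B) (unitMod X.sheaf)) := by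
  have := hX.finite
  let I : InjectiveResolution (SheafOfModules.unit (ringCatSheaf X)) := InjectiveResolution.of _
  have : Mono (I.ι.f 0) := inferInstance
  exact @acyclic_system_of_exact _ _ _ _ _ _ I.cocomplex _ I.exact_succ
    (fun n ↦ hX.exact I n hB hB') k 0 _ (I.ι.f 0) this I.ι_f_zero_comp_complex_d (ShortComplex.exact_of_f_is_kernel _ I.isLimitKernelFork)

end Diagonal

/-! ### Stalks as sections over smallest neighbourhoods -/

section Stalk

variable {X : RingedSpace.{u, u}}

lemma IsMinNhd.bijective_germ {T : TopCat.{u}} {C : Type (u + 1)} [Category.{u} C] [HasColimits C]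
    {FC : C → C → Type*} {CC : C → Type u} [∀ X Y, FunLike (FC X Y) (CC X) (CC Y)]
    [ConcreteCategory.{u} C FC] [PreservesFilteredColimits (CategoryTheory.forget C)]
    (F : TopCat.Presheaf C T) {x : T} {B : Opens T} (hB : IsMinNhd x B) :
    Function.Bijective (F.germ B x hB.mem) := by
  constructor
  · intro s t hst
    obtain ⟨W, hxW, iU, iV, h⟩ := F.germ_eq x hB.mem hB.mem s t hst
    obtain rfl : W = B := le_antisymm iU.le (hB.le W hxW)
    obtain rfl : iU = 𝟙 _ := rfl
    obtain rfl : iV = 𝟙 _ := rfl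
    simpa using h
  · intro s
    obtain ⟨W, hxW, t, rfl⟩ := F.exists_germ_eq s
    exact ⟨F.map (homOfLE (hB.le W hxW)).op t, F.germ_res_apply _ _ _ _⟩

lemma IsFiniteSpace.flat_map (hX : IsFiniteSpace X) {B B' : Opens X.carrier}
    (hB : IsIrreducible (Opens.grothendieckTopology X.carrier) B)
    (hB' : IsIrreducible (Opens.grothendieckTopology X.carrier) B') (f : B' ⟶ B) :
    (X.sheaf.obj.map f.op).hom.Flat := by
  have := hX.finite
  obtain ⟨p, hp⟩ := hB.exists_isMinNhd
  obtain ⟨q, hq⟩ := hB'.exists_isMinNhd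
  have h : q ⤳ p := specializes_iff_forall_open.2 fun V hV hpV ↦
    hp.le ⟨V, hV⟩ hpV (f.le hq.mem)
  let e := RingEquiv.ofBijective (X.presheaf.germ B' q hq.mem).hom (hq.bijective_germ X.presheaf)
  have h1 : X.presheaf.map f.op ≫ X.presheaf.germ B' q hq.mem =
      X.presheaf.germ B p hp.mem ≫ X.presheaf.stalkSpecializes h := by
    rw [X.presheaf.germ_res, X.presheaf.germ_stalkSpecializes]
  have h2 : (X.sheaf.obj.map f.op).hom = e.symm.toRingHom.comp
      ((X.presheaf.stalkSpecializes h).hom.comp (X.presheaf.germ B p hp.mem).hom) := by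
    ext x
    exact ((RingEquiv.symm_apply_eq e).2 congr(($h1).hom x).symm).symm
  rw [h2]
  exact .comp (.comp (.of_bijective (hp.bijective_germ X.presheaf)) (hX.flat p q h))
    (.of_bijective e.symm.bijective)

lemma flat_of_bijective {R S M N : Type u} [CommRing R] [CommRing S] [AddCommGroup M]
    [AddCommGroup N] [Module R M] [Module S N] (φ : R →+* S) (hφ : Function.Bijective φ) (f : M →+ N)
    (hf : Function.Bijective f) (hφf : ∀ r m, f (r • m) = φ r • f m) (hM : Module.Flat R M) :
    Module.Flat S N := by
  let e := RingEquiv.ofBijective φ hφ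
  let := e.symm.toRingHom.toAlgebra
  let := Module.compHom M e.symm.toRingHom
  have : IsScalarTower S R M := ⟨fun s r m ↦ mul_smul (e.symm s) r m⟩
  have : Module.Flat S R := RingHom.Flat.of_bijective (f := e.symm.toRingHom) e.symm.bijective
  have := Module.Flat.trans S R M
  let g : M →ₗ[S] N :=
    { f with
      map_smul' := fun s m ↦ by
        refine (hφf (e.symm s) m).trans ?_
        exact congrArg (fun t ↦ t • f m) (e.apply_symm_apply s) }
  exact Module.Flat.of_linearEquiv (LinearEquiv.ofBijective g hf).symm

lemma isFlat_of_flat [Finite X.carrier] (M : Modules X)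
    (hM : ∀ B, IsIrreducible (Opens.grothendieckTopology X.carrier) B →
      Module.Flat (X.sheaf.obj.obj (op B)) ((ev X.sheaf B).obj M)) : IsFlat M := by
  intro x
  obtain ⟨B, hB⟩ := exists_isMinNhd x
  have h1 := hB.bijective_germ X.presheaf
  have h2 := hB.bijective_germ (C := Ab.{u}) M.val.presheaf
  exact flat_of_bijective (M := (ev X.sheaf B).obj M) (R := X.sheaf.obj.obj (op B))
    (X.presheaf.germ B x hB.mem).hom h1
    (TopCat.Presheaf.germ M.val.presheaf B x hB.mem).hom h2
    (PresheafOfModules.germ_smul (R := X.presheaf) M.val x B hB.mem) (hM B hB.isIrreducible)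

end Stalk

/-! ### Sections of the structure sheaf of a product -/

section Category

variable {C : Type*} [Category* C] {a a' b b' c c' d : C}

lemma comp_square {α : a ⟶ b} {m : b ⟶ b'} {ψ : b ⟶ c} {ψ' : b' ⟶ c'} {k : c ⟶ c'} {e : c ⟶ d}
    {e' : c' ⟶ d} (h₁ : k ≫ e' = e) (h₂ : m ≫ ψ' = ψ ≫ k) :
    (α ≫ ψ) ≫ e = (α ≫ m) ≫ ψ' ≫ e' := by
  rw [← h₁, Category.assoc, Category.assoc, reassoc_of% h₂]

lemma eq_comp_square {m : b ⟶ b'} {ψ : b ⟶ c} {ψ' : b' ⟶ c'} {k : c ⟶ c'} {e : c ≅ d}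
    {e' : c' ≅ d} (h₁ : k ≫ e'.hom = e.hom) (h₂ : m ≫ ψ' = ψ ≫ k) :
    ψ = m ≫ (ψ' ≫ e'.hom) ≫ e.inv := by
  rw [← cancel_mono e.hom]
  simp only [Category.assoc, Iso.inv_hom_id, Category.comp_id, reassoc_of% h₂, h₁]

lemma comp_inv_comp (f : a ⟶ b) [IsIso f] (g : a ⟶ c) (e : c ⟶ d) :
    f ≫ (inv f ≫ g) ≫ e = g ≫ e := by simp

lemma comp_pair {x : a ⟶ a'} {α : a ⟶ b} {α' : a' ⟶ b'} {k : b ⟶ b'} {r : b ⟶ c} {r' : b' ⟶ c'}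
    {g : c ⟶ c'} (h₁ : x ≫ α' = α ≫ k) (h₂ : k ≫ r' = r ≫ g) : (α ≫ r) ≫ g = x ≫ α' ≫ r' := by
  rw [Category.assoc, ← h₂, reassoc_of% h₁]

/-- A morphism between coproducts with a common summand is a pushout. -/
lemma isPushout_of_hom_ext {R R' P P' Q : C} {x : R ⟶ R'} {a : R ⟶ P} {a' : R' ⟶ P'} {p : P ⟶ P'}
    {b : Q ⟶ P} {b' : Q ⟶ P'} (sq : a ≫ p = x ≫ a') (tri : b ≫ p = b')
    (ext : ∀ (A : C) (γ γ' : P ⟶ A), a ≫ γ = a ≫ γ' → b ≫ γ = b ≫ γ' → γ = γ')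
    (ext' : ∀ (A : C) (γ γ' : P' ⟶ A), a' ≫ γ = a' ≫ γ' → b' ≫ γ = b' ≫ γ' → γ = γ')
    (ex : ∀ (A : C) (α : R' ⟶ A) (β : Q ⟶ A), ∃ γ : P' ⟶ A, a' ≫ γ = α ∧ b' ≫ γ = β) :
    IsPushout x a a' p := by
  choose γ h₁ h₂ using ex
  refine ⟨⟨sq.symm⟩, ⟨PushoutCocone.IsColimit.mk _ (fun s ↦ γ _ s.inl (b ≫ s.inr))
    (fun s ↦ h₁ _ _ _) (fun s ↦ ext _ _ _ ?_ ?_) (fun s m h h' ↦ ext' _ _ _ ?_ ?_)⟩⟩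
  · rw [reassoc_of% sq, h₁, s.condition]
  · rw [reassoc_of% tri, h₂]
  · rw [h, h₁]
  · rw [h₂, ← h', reassoc_of% tri]

end Category

/-! ### Ring maps out of a stalk as morphisms to skyscraper sheaves -/

section Skyscraper

variable {T : TopCat.{u}} {F : TopCat.Presheaf CommRingCat.{u} T} {x : T} {B : Opens T}
  {A : CommRingCat.{u}}

open Classical in
variable (x A) in
/-- The skyscraper presheaf of rings. -/
def sky : TopCat.Presheaf CommRingCat.{u} T := skyscraperPresheaf x A

open Classical in
variable (x A) in
lemma sky_isSheaf : (sky x A).IsSheaf := skyscraperPresheaf_isSheaf x A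

/-- The sections of a skyscraper presheaf. -/
def skyIso {U : Opens T} (hU : x ∈ U) : (sky x A).obj (op U) ≅ A := eqToIso (if_pos hU)

lemma sky_map {U V : Opens T} (hV : x ∈ V) (f : V ⟶ U) :
    (sky x A).map f.op ≫ (skyIso hV).hom = (skyIso (f.le hV)).hom := by
  refine (congrArg (· ≫ (skyIso hV).hom) (dif_pos hV)).trans ?_
  exact eqToHom_trans (X := (sky x A).obj (op U)) (Y := (sky x A).obj (op V)) (Z := A)
    ((if_pos (f.le hV)).trans (if_pos hV).symm) (if_pos hV)

/-- A morphism to a skyscraper presheaf, on the smallest open neighbourhood. -/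
def skyVal (hB : IsMinNhd x B) (ψ : F ⟶ sky x A) : F.obj (op B) ⟶ A :=
  ψ.app (op B) ≫ (skyIso hB.mem).hom

lemma exists_skyVal_eq (hB : IsMinNhd x B) (γ : F.obj (op B) ⟶ A) :
    ∃ ψ : F ⟶ sky x A, skyVal hB ψ = γ := by
  classical
  have : IsIso (F.germ B x hB.mem) :=
    (ConcreteCategory.isIso_iff_bijective _).2 (hB.bijective_germ F)
  refine ⟨StalkSkyscraperPresheafAdjunctionAuxs.toSkyscraperPresheaf x
    (inv (F.germ B x hB.mem) ≫ γ), ?_⟩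
  refine (congrArg (· ≫ (skyIso hB.mem).hom) ((dif_pos hB.mem).trans
    (comp_inv_comp (F.germ B x hB.mem) γ (skyIso hB.mem).inv))).trans ?_
  rw [Category.assoc, Iso.inv_hom_id, Category.comp_id]

/-- On open sets containing `x` a morphism factors through restriction to `B`; on the others the
target is terminal. -/
lemma sky_hom_ext (hB : IsMinNhd x B) {ψ ψ' : F ⟶ sky x A}
    (h : skyVal hB ψ = skyVal hB ψ') : ψ = ψ' := by
  classical
  refine NatTrans.ext (funext fun U ↦ ?_)
  by_cases hU : x ∈ U.unop
  · have key (ψ : F ⟶ sky x A) : ψ.app U =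
        F.map (homOfLE (hB.le U.unop hU)).op ≫ skyVal hB ψ ≫ (skyIso hU).inv :=
      eq_comp_square (sky_map hB.mem (homOfLE (hB.le U.unop hU))) (ψ.naturality _)
    rw [key, key, h]
  · exact ((if_neg hU).symm.ndrec terminalIsTerminal).hom_ext _ _

end Skyscraper

/-! ### The product sheaf on products of smallest neighbourhoods -/

section Prod

variable {X Y : RingedSpace.{u, u}}

lemma prodFst_c (S : TopCat.Sheaf CommRingCat.{u} (prodTop X Y)) (θ : prodSheaf X Y ⟶ S) :
    (prodFst X Y).hom.c ≫ Functor.whiskerLeft (Opens.map (fstTop X Y)).op θ.hom =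
      ((TopCat.Sheaf.pullbackPushforwardAdjunction CommRingCat.{u} (fstTop X Y)).homEquiv
        X.sheaf S (coprod.inl ≫ θ)).hom :=
  congrArg (fun t ↦ t.hom) ((TopCat.Sheaf.pullbackPushforwardAdjunction CommRingCat.{u}
    (fstTop X Y)).homEquiv_naturality_right (X := X.sheaf)
      (coprod.inl : _ ⟶ prodSheaf X Y) θ).symm

lemma prodSnd_c (S : TopCat.Sheaf CommRingCat.{u} (prodTop X Y)) (θ : prodSheaf X Y ⟶ S) :
    (prodSnd X Y).hom.c ≫ Functor.whiskerLeft (Opens.map (sndTop X Y)).op θ.hom =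
      ((TopCat.Sheaf.pullbackPushforwardAdjunction CommRingCat.{u} (sndTop X Y)).homEquiv
        Y.sheaf S (coprod.inr ≫ θ)).hom :=
  congrArg (fun t ↦ t.hom) ((TopCat.Sheaf.pullbackPushforwardAdjunction CommRingCat.{u}
    (sndTop X Y)).homEquiv_naturality_right (X := Y.sheaf)
      (coprod.inr : _ ⟶ prodSheaf X Y) θ).symm

lemma prodSheaf_hom_ext {S : TopCat.Sheaf CommRingCat.{u} (prodTop X Y)} {θ θ' : prodSheaf X Y ⟶ S}
    (h₁ : (prodFst X Y).hom.c ≫ Functor.whiskerLeft (Opens.map (fstTop X Y)).op θ.hom =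
      (prodFst X Y).hom.c ≫ Functor.whiskerLeft (Opens.map (fstTop X Y)).op θ'.hom)
    (h₂ : (prodSnd X Y).hom.c ≫ Functor.whiskerLeft (Opens.map (sndTop X Y)).op θ.hom =
      (prodSnd X Y).hom.c ≫ Functor.whiskerLeft (Opens.map (sndTop X Y)).op θ'.hom) : θ = θ' := by
  rw [prodFst_c, prodFst_c] at h₁
  rw [prodSnd_c, prodSnd_c] at h₂
  exact coprod.hom_ext (Equiv.injective _ (Sheaf.hom_ext h₁)) (Equiv.injective _ (Sheaf.hom_ext h₂))

lemma exists_prodSheaf_hom (S : TopCat.Sheaf CommRingCat.{u} (prodTop X Y))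
    (a : X.presheaf ⟶ (Opens.map (fstTop X Y)).op ⋙ S.obj)
    (b : Y.presheaf ⟶ (Opens.map (sndTop X Y)).op ⋙ S.obj) :
    ∃ θ : prodSheaf X Y ⟶ S,
      (prodFst X Y).hom.c ≫ Functor.whiskerLeft (Opens.map (fstTop X Y)).op θ.hom = a ∧
      (prodSnd X Y).hom.c ≫ Functor.whiskerLeft (Opens.map (sndTop X Y)).op θ.hom = b := by
  let a' : X.sheaf ⟶ (TopCat.Sheaf.pushforward CommRingCat.{u} (fstTop X Y)).obj S := ⟨a⟩
  let b' : Y.sheaf ⟶ (TopCat.Sheaf.pushforward CommRingCat.{u} (sndTop X Y)).obj S := ⟨b⟩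
  refine ⟨coprod.desc
    (((TopCat.Sheaf.pullbackPushforwardAdjunction CommRingCat.{u} (fstTop X Y)).homEquiv _ _).symm a')
    (((TopCat.Sheaf.pullbackPushforwardAdjunction CommRingCat.{u} (sndTop X Y)).homEquiv _ _).symm b'),
    ?_, ?_⟩
  · refine (prodFst_c S _).trans ?_
    rw [coprod.inl_desc, Equiv.apply_symm_apply]
  · refine (prodSnd_c S _).trans ?_
    rw [coprod.inr_desc, Equiv.apply_symm_apply]

variable (B : Opens X.carrier) (V : Opens Y.carrier)

/-- The pullback of sections along the first projection. -/
def fstApp : X.presheaf.obj (op B) ⟶ (prod X Y).presheaf.obj (op (prodOpen B V)) :=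
  (prodFst X Y).hom.c.app (op B) ≫ (prod X Y).presheaf.map
    (homOfLE (fun _ h ↦ h.1 : prodOpen B V ≤ (Opens.map (fstTop X Y)).obj B)).op

/-- The pullback of sections along the second projection. -/
def sndApp : Y.presheaf.obj (op V) ⟶ (prod X Y).presheaf.obj (op (prodOpen B V)) :=
  (prodSnd X Y).hom.c.app (op V) ≫ (prod X Y).presheaf.map
    (homOfLE (fun _ h ↦ h.2 : prodOpen B V ≤ (Opens.map (sndTop X Y)).obj V)).op

variable {B V}

lemma IsMinNhd.prod {x : X.carrier} {y : Y.carrier} (hx : IsMinNhd x B) (hy : IsMinNhd y V) :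
    IsMinNhd (T := prodTop X Y) (x, y) (prodOpen B V) := by
  refine ⟨⟨hx.mem, hy.mem⟩, fun W hW ↦ ?_⟩
  obtain ⟨U, U', hU, hU', hxU, hyU', h⟩ := isOpen_prod_iff.1 W.2 x y hW
  exact (Set.prod_mono (hx.le ⟨U, hU⟩ hxU) (hy.le ⟨U', hU'⟩ hyU')).trans h

variable {A : CommRingCat.{u}} {x : X.carrier} {y : Y.carrier}

lemma skyVal_fst (hx : IsMinNhd x B) (hy : IsMinNhd y V)
    (ψ : (prod X Y).presheaf ⟶ sky (T := prodTop X Y) (x, y) A) :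
    skyVal (F := X.presheaf) (A := A) hx
      ((prodFst X Y).hom.c ≫ Functor.whiskerLeft (Opens.map (fstTop X Y)).op ψ) =
    fstApp B V ≫ skyVal (hx.prod hy) ψ := by
  let f : prodOpen B V ⟶ (Opens.map (fstTop X Y)).obj B := homOfLE fun _ h ↦ h.1
  exact comp_square (sky_map (A := A) (hx.prod hy).mem f) (ψ.naturality f.op)

lemma skyVal_snd (hx : IsMinNhd x B) (hy : IsMinNhd y V)
    (ψ : (prod X Y).presheaf ⟶ sky (T := prodTop X Y) (x, y) A) :
    skyVal (F := Y.presheaf) (A := A) hy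
      ((prodSnd X Y).hom.c ≫ Functor.whiskerLeft (Opens.map (sndTop X Y)).op ψ) =
    sndApp B V ≫ skyVal (hx.prod hy) ψ := by
  let f : prodOpen B V ⟶ (Opens.map (sndTop X Y)).obj V := homOfLE fun _ h ↦ h.2
  exact comp_square (sky_map (A := A) (hx.prod hy).mem f) (ψ.naturality f.op)

/-- Ring maps out of `𝒪(B × V)` are sheaf morphisms from `prodSheaf` to a skyscraper, and these are
determined by their components on the two factors. With `exists_prod_hom` this makes `𝒪(B × V)` the
coproduct of `𝒪(B)` and `𝒪(V)`. -/
lemma prod_hom_ext (hx : IsMinNhd x B) (hy : IsMinNhd y V)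
    {γ γ' : (prod X Y).presheaf.obj (op (prodOpen B V)) ⟶ A}
    (h₁ : fstApp B V ≫ γ = fstApp B V ≫ γ') (h₂ : sndApp B V ≫ γ = sndApp B V ≫ γ') : γ = γ' := by
  let S : TopCat.Sheaf CommRingCat.{u} (prodTop X Y) := ⟨sky (x, y) A, sky_isSheaf _ _⟩
  obtain ⟨ψ, rfl⟩ := exists_skyVal_eq (F := (prod X Y).presheaf) (hx.prod hy) γ
  obtain ⟨ψ', rfl⟩ := exists_skyVal_eq (F := (prod X Y).presheaf) (hx.prod hy) γ'
  replace h₁ := (skyVal_fst hx hy ψ).trans (h₁.trans (skyVal_fst hx hy ψ').symm)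
  replace h₂ := (skyVal_snd hx hy ψ).trans (h₂.trans (skyVal_snd hx hy ψ').symm)
  let s : prodSheaf X Y ⟶ S := ⟨ψ⟩
  let s' : prodSheaf X Y ⟶ S := ⟨ψ'⟩
  have key : s = s' := prodSheaf_hom_ext (sky_hom_ext hx h₁) (sky_hom_ext hy h₂)
  exact congrArg (fun t : prodSheaf X Y ⟶ S ↦ skyVal (hx.prod hy) t.hom) key

lemma exists_prod_hom (hx : IsMinNhd x B) (hy : IsMinNhd y V)
    (α : X.presheaf.obj (op B) ⟶ A) (β : Y.presheaf.obj (op V) ⟶ A) :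
    ∃ γ : (prod X Y).presheaf.obj (op (prodOpen B V)) ⟶ A,
      fstApp B V ≫ γ = α ∧ sndApp B V ≫ γ = β := by
  let S : TopCat.Sheaf CommRingCat.{u} (prodTop X Y) := ⟨sky (x, y) A, sky_isSheaf _ _⟩
  obtain ⟨a, rfl⟩ := exists_skyVal_eq (F := X.presheaf) hx α
  obtain ⟨b, rfl⟩ := exists_skyVal_eq (F := Y.presheaf) hy β
  obtain ⟨θ, rfl, rfl⟩ := exists_prodSheaf_hom S a b
  exact ⟨skyVal (hx.prod hy) θ.hom, (skyVal_fst hx hy θ.hom).symm, (skyVal_snd hx hy θ.hom).symm⟩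

lemma fstApp_map {B' : Opens X.carrier} (f : B' ⟶ B) (g : prodOpen B' V ⟶ prodOpen B V) :
    fstApp B V ≫ (prod X Y).presheaf.map g.op = X.presheaf.map f.op ≫ fstApp B' V := by
  let r : prodOpen B V ⟶ (Opens.map (fstTop X Y)).obj B := homOfLE fun _ h ↦ h.1
  exact comp_pair ((prodFst X Y).hom.c.naturality f.op)
    (((prod X Y).presheaf.map_comp _ _).symm.trans ((prod X Y).presheaf.map_comp r.op g.op))

lemma sndApp_map {B' : Opens X.carrier} (g : prodOpen B' V ⟶ prodOpen B V) :
    sndApp B V ≫ (prod X Y).presheaf.map g.op = sndApp B' V := by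
  exact (Category.assoc _ _ _).trans
    (congrArg ((prodSnd X Y).hom.c.app (op V) ≫ ·) ((prod X Y).presheaf.map_comp _ _).symm)

/-- Both product rings are coproducts with the common summand `𝒪(V)`. -/
lemma isPushout_prod [Finite X.carrier] [Finite Y.carrier] {B' : Opens X.carrier}
    (hB : IsIrreducible (Opens.grothendieckTopology X.carrier) B)
    (hB' : IsIrreducible (Opens.grothendieckTopology X.carrier) B')
    (hV : IsIrreducible (Opens.grothendieckTopology Y.carrier) V)
    (f : B' ⟶ B) (g : prodOpen B' V ⟶ prodOpen B V) :
    IsPushout (X.presheaf.map f.op) (fstApp B V) (fstApp B' V) ((prod X Y).presheaf.map g.op) := by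
  obtain ⟨x, hx⟩ := hB.exists_isMinNhd
  obtain ⟨x', hx'⟩ := hB'.exists_isMinNhd
  obtain ⟨y, hy⟩ := hV.exists_isMinNhd
  exact isPushout_of_hom_ext (fstApp_map f g) (sndApp_map g) (fun _ _ _ ↦ prod_hom_ext hx hy)
    (fun _ _ _ ↦ prod_hom_ext hx' hy) (fun _ ↦ exists_prod_hom hx' hy)

lemma fstApp_diagonal (B V : Opens X.carrier) :
    fstApp B V ≫ (diagonal X).hom.c.app (op (prodOpen B V)) =
      X.presheaf.map (homOfLE (inf_le_left : B ⊓ V ≤ B)).op := by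
  let r : prodOpen B V ⟶ (Opens.map (fstTop X X)).obj B := homOfLE fun _ h ↦ h.1
  have h₁ : (prodFst X X).hom.c.app (op B) ≫ (diagonal X).hom.c.app (op ((Opens.map (fstTop X X)).obj B)) =
      𝟙 (X.presheaf.obj (op B)) := by
    refine (PresheafedSpace.congr_app (congrArg (fun t ↦ t.hom)
      (prodLift_fst (𝟙 X) (𝟙 X))) (op B)).trans ?_
    refine (congrArg (· ≫ _) (PresheafedSpace.id_c_app X.toPresheafedSpace (op B))).trans ?_
    refine (X.presheaf.map_comp _ _).symm.trans ?_
    exact X.presheaf.map_id (op B)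
  refine (comp_pair (x := 𝟙 _) (α' := 𝟙 _) ((Category.comp_id _).trans h₁.symm)
    ((diagonal X).hom.c.naturality r.op).symm).trans ?_
  exact (Category.id_comp _).trans (Category.id_comp _)

end Prod

/-! ### Composition and descent of base change -/

section BaseChange

variable {R S T : Type u} [CommRing R] [CommRing S] [CommRing T] {φ : R →+* S} {ψ : S →+* T}
  {χ : R →+* T} {M N P : Type u} [AddCommGroup M] [AddCommGroup N] [AddCommGroup P]
  [Module R M] [Module S N] [Module T P]

lemma IsSemiBaseChange.comp_iff {f : M →ₛₗ[φ] N} (hf : IsSemiBaseChange f) (g : N →ₛₗ[ψ] P)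
    (h : M →ₛₗ[χ] P) (hχ : χ = ψ.comp φ) (hgf : ∀ m, h m = g (f m)) :
    IsSemiBaseChange h ↔ IsSemiBaseChange g := by
  subst hχ
  let := φ.toAlgebra
  let := ψ.toAlgebra
  let := (ψ.comp φ).toAlgebra
  let := Module.compHom N φ
  let := Module.compHom P ψ
  let := Module.compHom P (ψ.comp φ)
  have : IsScalarTower R S N := ⟨fun r s n ↦ mul_smul (φ r) s n⟩
  have : IsScalarTower S T P := ⟨fun r s n ↦ mul_smul (ψ r) s n⟩
  have : IsScalarTower R T P := ⟨fun r s n ↦ mul_smul (ψ (φ r)) s n⟩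
  have : IsScalarTower R S P := ⟨fun r s n ↦ by
    change ψ (φ r * s) • n = ψ (φ r) • ψ s • n
    rw [map_mul, mul_smul]⟩
  have : IsScalarTower R S T := .of_algebraMap_eq fun _ ↦ rfl
  have key := IsBaseChange.comp_iff (T := T) (f := semilinearRestrict f) hf (h := semilinearRestrict g)
  have e : (semilinearRestrict g).restrictScalars R ∘ₗ semilinearRestrict f = semilinearRestrict h :=
    LinearMap.ext fun m ↦ (hgf m).symm
  rw [e] at key
  exact key

lemma IsSemiBaseChange.flat {f : M →ₛₗ[φ] N} (hf : IsSemiBaseChange f) (hM : Module.Flat R M) :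
    Module.Flat S N := by
  let := φ.toAlgebra
  let := Module.compHom N φ
  have : IsScalarTower R S N := ⟨fun r s n ↦ mul_smul (φ r) s n⟩
  exact Module.Flat.isBaseChange R S M N hf

end BaseChange

/-! ### Base change along pushouts of commutative rings -/

section Pushout

open TensorProduct

variable {R R' P P' : CommRingCat.{u}} {φ : R ⟶ R'} {a : R ⟶ P} {b : R' ⟶ P'} {ψ : P ⟶ P'}
  {M M' : Type u} [AddCommGroup M] [AddCommGroup M'] [Module R M] [Module P M] [Module R' M']
  [Module P' M']

/-- Base change along a pushout of rings is base change along the original morphism. -/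
lemma IsSemiBaseChange.of_isPushout (sq : IsPushout φ a b ψ) {f : M →ₛₗ[ψ.hom] M'}
    (hf : IsSemiBaseChange f) (ha : ∀ (r : R) (m : M), r • m = a.hom r • m)
    (hb : ∀ (r : R') (m : M'), r • m = b.hom r • m)
    (g : M →ₛₗ[φ.hom] M') (hgf : ∀ m, g m = f m) : IsSemiBaseChange g := by
  let := φ.hom.toAlgebra
  let := a.hom.toAlgebra
  let := b.hom.toAlgebra
  let := ψ.hom.toAlgebra
  let := (a ≫ ψ).hom.toAlgebra
  let := Module.compHom M' ψ.hom
  let := Module.compHom M' φ.hom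
  have : IsScalarTower P P' M' := ⟨fun r s n ↦ mul_smul (ψ.hom r) s n⟩
  have : IsScalarTower R R' M' := ⟨fun r s n ↦ mul_smul (φ.hom r) s n⟩
  have : IsScalarTower R P M := ⟨fun r s n ↦ by
    rw [ha r]
    exact mul_smul (a.hom r) s n⟩
  have : IsScalarTower R' P' M' := ⟨fun r s n ↦ by
    rw [hb r]
    exact mul_smul (b.hom r) s n⟩
  have : IsScalarTower R R' P' := .of_algebraMap_eq fun x ↦ congr($(sq.w.symm).hom x)
  have : IsScalarTower R P P' := .of_algebraMap_eq fun _ ↦ rfl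
  have hp : Algebra.IsPushout R R' P P' := CommRingCat.isPushout_iff_isPushout.1 sq
  let e := Algebra.IsPushout.cancelBaseChange R R' P P' M
  have hf' : IsBaseChange P' (semilinearRestrict f) := hf
  refine IsBaseChange.of_equiv (e.symm ≪≫ₗ hf'.equiv.restrictScalars R') fun m ↦ ?_
  change hf'.equiv (e.symm (1 ⊗ₜ m)) = g m
  rw [Algebra.IsPushout.cancelBaseChange_symm_tmul, map_one, IsBaseChange.equiv_tmul, one_smul, hgf]
  rfl

/-- A morphism of algebras which is a base change of modules is a pushout. -/
lemma isPushout_of_isSemiBaseChange (w : φ ≫ b = a ≫ ψ)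
    [i : Module R P] [i' : Module R' P'] (ha : ∀ (r : R) (m : P), r • m = a.hom r * m)
    (hb : ∀ (r : R') (m : P'), r • m = b.hom r * m)
    (g : P →ₛₗ[φ.hom] P') (hg : ∀ m, g m = ψ m) (h : IsSemiBaseChange g) :
    IsPushout φ a b ψ := by
  obtain rfl : i = a.hom.toAlgebra.toModule := Module.ext' _ _ ha
  obtain rfl : i' = b.hom.toAlgebra.toModule := Module.ext' _ _ hb
  let := φ.hom.toAlgebra
  let := a.hom.toAlgebra
  let := b.hom.toAlgebra
  let := ψ.hom.toAlgebra
  let := (φ ≫ b).hom.toAlgebra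
  have : IsScalarTower R R' P' := .of_algebraMap_eq fun _ ↦ rfl
  have : IsScalarTower R P P' := .of_algebraMap_eq fun x ↦ congr(($w).hom x)
  refine CommRingCat.isPushout_iff_isPushout.2 ⟨?_⟩
  have e : (IsScalarTower.toAlgHom R P P').toLinearMap = semilinearRestrict g :=
    LinearMap.ext fun m ↦ (hg m).symm
  rw [e]
  exact h

end Pushout

/-! ### The direct image of the restriction to an open subset -/

section Inter

variable {T : TopCat.{u}}

/-- Intersection with an open subset. -/
def interFunctor (V : Opens T) : Opens T ⥤ Opens T where
  obj U := U ⊓ V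
  map f := homOfLE (inf_le_inf_right V f.le)

instance (V : Opens T) : (interFunctor V).IsContinuous (Opens.grothendieckTopology T)
    (Opens.grothendieckTopology T) := by
  refine Functor.isContinuous_of_coverPreserving ⟨?_⟩ ⟨?_⟩
  · intro ℱ Z S x hx Y₁ Y₂ W f₁ f₂ g₁ g₂ hg₁ hg₂ _
    let h₁ : Y₁ ⊓ Y₂ ⟶ Y₁ := homOfLE inf_le_left
    let h₂ : Y₁ ⊓ Y₂ ⟶ Y₂ := homOfLE inf_le_right
    -- `W` lies in `Y₁ ⊓ Y₂ ⊓ V`, so agreement over `Y₁ ⊓ Y₂` restricts to agreement over `W`.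
    let k : W ⟶ (interFunctor V).obj (Y₁ ⊓ Y₂) :=
      homOfLE (le_inf (le_inf (f₁.le.trans inf_le_left) (f₂.le.trans inf_le_left))
        (f₁.le.trans inf_le_right))
    have h := hx h₁ h₂ hg₁ hg₂ rfl
    have h' := congrArg (ℱ.obj.map k.op) h
    change (ℱ.obj.map ((interFunctor V).map h₁).op ≫ ℱ.obj.map k.op) _ =
      (ℱ.obj.map ((interFunctor V).map h₂).op ≫ ℱ.obj.map k.op) _ at h'
    rw [← Functor.map_comp, ← Functor.map_comp] at h'
    exact h'
  · intro U S hS x hx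
    obtain ⟨W, f, hf, hxW⟩ := hS x hx.1
    exact ⟨W ⊓ V, (interFunctor V).map f, ⟨W, f, 𝟙 _, hf, rfl⟩, ⟨hxW, hx.2⟩⟩

variable {𝒪 : Sheaf (Opens.grothendieckTopology T) CommRingCat.{u}} (V : Opens T)

variable (𝒪) in
/-- The restriction morphism from the structure sheaf to the direct image of its restriction. -/
def interRing : ringSheaf 𝒪 ⟶ ((interFunctor V).sheafPushforwardContinuous RingCat.{u}
    (Opens.grothendieckTopology T) (Opens.grothendieckTopology T)).obj (ringSheaf 𝒪) where
  hom :=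
    { app := fun U ↦ (ringSheaf 𝒪).obj.map (homOfLE (inf_le_left : U.unop ⊓ V ≤ U.unop)).op
      naturality := fun _ _ f ↦ ((ringSheaf 𝒪).obj.map_comp _ _).symm.trans
        ((ringSheaf 𝒪).obj.map_comp _ ((interFunctor V).map f.unop).op) }

/-- The direct image of the restriction of a sheaf of modules to `V`. -/
def interMod : SheafMod 𝒪 ⥤ SheafMod 𝒪 := SheafOfModules.pushforward (interRing 𝒪 V)

/-- The restriction to `V`. -/
def toInter (M : SheafMod 𝒪) : M ⟶ (interMod V).obj M where
  val := PresheafOfModules.homMk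
    { app := fun U ↦ M.val.presheaf.map (homOfLE (inf_le_left : U.unop ⊓ V ≤ U.unop)).op
      naturality := fun _ _ f ↦ (M.val.presheaf.map_comp _ _).symm.trans
        (M.val.presheaf.map_comp _ ((interFunctor V).map f.unop).op) }
    fun U r m ↦ M.val.map_smul (homOfLE (inf_le_left : U.unop ⊓ V ≤ U.unop)).op r m

/-- The morphism attached to a section over `V`. -/
def interSection (M : SheafMod 𝒪) (s : (ev 𝒪 V).obj M) :
    (interMod V).obj (unitMod 𝒪) ⟶ (interMod V).obj M where
  val := PresheafOfModules.homMk
    { app := fun U ↦ AddCommGrpCat.ofHom (X := 𝒪.obj.obj (op (U.unop ⊓ V)))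
        (Y := (ev 𝒪 (U.unop ⊓ V)).obj M)
        ((AddMonoidHom.flip (smulAddHom (𝒪.obj.obj (op (U.unop ⊓ V))) ((ev 𝒪 (U.unop ⊓ V)).obj M)))
          (secRes M (homOfLE inf_le_right) s))
      naturality := fun U U' f ↦ by
        ext a
        refine Eq.trans ?_ ((secRes M ((interFunctor V).map f.unop)).map_smulₛₗ a _).symm
        exact congrArg _ (secRes_secRes M _ _ _ _).symm }
    fun U r m ↦ mul_smul (α := 𝒪.obj.obj (op (U.unop ⊓ V)))
      (β := (ev 𝒪 (U.unop ⊓ V)).obj M)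
      (𝒪.obj.map (homOfLE (inf_le_left : U.unop ⊓ V ≤ U.unop)).op r)
      (show 𝒪.obj.obj (op (U.unop ⊓ V)) from m) _

lemma ev_interSection (M : SheafMod 𝒪) (s : (ev 𝒪 V).obj M) (U : Opens T)
    (a : 𝒪.obj.obj (op (U ⊓ V))) :
    (ev 𝒪 U).map (interSection V M s) a =
      (a • secRes M (homOfLE inf_le_right) s : (ev 𝒪 (U ⊓ V)).obj M) := rfl

end Inter

section Inter

variable {T : TopCat.{u}} {𝒪 : Sheaf (Opens.grothendieckTopology T) CommRingCat.{u}}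

/-- The map `M(B) → M(B' ⊓ V)` is a base change through `M(B')`, and cancelling `M(B) → M(B ⊓ V)`
leaves one from `M(B ⊓ V)`. The pushout square turns base change along `𝒪(B ⊓ V) → 𝒪(B' ⊓ V)` into
base change along `𝒪(B) → 𝒪(B')`. -/
lemma hasBaseChange_interMod {M : SheafMod 𝒪} {B B' V : Opens T} (f : B' ⟶ B)
    (hf : HasBaseChange M f) (h₁ : HasBaseChange M (homOfLE (inf_le_left : B ⊓ V ≤ B)))
    (h₂ : HasBaseChange M (homOfLE (inf_le_left : B' ⊓ V ≤ B')))
    (sq : IsPushout (𝒪.obj.map f.op) (𝒪.obj.map (homOfLE (inf_le_left : B ⊓ V ≤ B)).op)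
      (𝒪.obj.map (homOfLE (inf_le_left : B' ⊓ V ≤ B')).op)
      (𝒪.obj.map ((interFunctor V).map f).op)) :
    HasBaseChange ((interMod V).obj M) f := by
  let i : B' ⊓ V ⟶ B ⊓ V := (interFunctor V).map f
  let r := secRes M (homOfLE (inf_le_left : B ⊓ V ≤ B))
  let r' := secRes M (homOfLE (inf_le_left : B' ⊓ V ≤ B'))
  let h : (ev 𝒪 B).obj M →ₛₗ[_] (ev 𝒪 (B' ⊓ V)).obj M :=
    secRes M (homOfLE (inf_le_left.trans f.le) : B' ⊓ V ⟶ B)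
  have k₁ : IsSemiBaseChange h :=
    (IsSemiBaseChange.comp_iff (f := secRes M f) hf r' h
      congr(($(𝒪.obj.map_comp f.op (homOfLE (inf_le_left : B' ⊓ V ≤ B')).op)).hom)
      fun m ↦ (secRes_secRes M _ _ _ m).symm).2 h₂
  have k₂ : IsSemiBaseChange (secRes M i) :=
    (IsSemiBaseChange.comp_iff (f := r) h₁ _ h
      congr(($(𝒪.obj.map_comp (homOfLE (inf_le_left : B ⊓ V ≤ B)).op i.op)).hom)
      fun m ↦ (secRes_secRes M _ _ _ m).symm).1 k₁
  let : Module (𝒪.obj.obj (op B)) ((ev 𝒪 (B ⊓ V)).obj M) :=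
    inferInstanceAs (Module _ ((ev 𝒪 B).obj ((interMod V).obj M)))
  let : Module (𝒪.obj.obj (op B')) ((ev 𝒪 (B' ⊓ V)).obj M) :=
    inferInstanceAs (Module _ ((ev 𝒪 B').obj ((interMod V).obj M)))
  exact IsSemiBaseChange.of_isPushout sq k₂ (fun _ _ ↦ rfl) (fun _ _ ↦ rfl)
    (secRes ((interMod V).obj M) f) fun _ ↦ rfl

end Inter

/-! ### Intersections of irreducible open subsets in a semi-separated space -/

section SemiSeparated

variable {X : RingedSpace.{u, u}}

lemma IsSemiSeparated.flat_inf (hX : IsSemiSeparated X) {B V : Opens X.carrier}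
    (hB : IsIrreducible (Opens.grothendieckTopology X.carrier) B)
    (hV : IsIrreducible (Opens.grothendieckTopology X.carrier) V) :
    (X.sheaf.obj.map (homOfLE (inf_le_left : B ⊓ V ≤ B)).op).hom.Flat := by
  have := hX.finite
  exact flat_map_of_acyclic (𝒪 := X.sheaf) _
    (fun B' hB' h ↦ hX.toIsFiniteSpace.flat_map hB hB' (homOfLE h)) (hX.acyclic hB hV)

lemma IsSemiSeparated.hasBaseChange_inf_left (hX : IsSemiSeparated X) {M : Modules X}
    (hM : IsQuasicoherent M) {B V : Opens X.carrier}
    (hB : IsIrreducible (Opens.grothendieckTopology X.carrier) B)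
    (hV : IsIrreducible (Opens.grothendieckTopology X.carrier) V) :
    HasBaseChange (𝒪 := X.sheaf) M (homOfLE (inf_le_left : B ⊓ V ≤ B)) := by
  have := hX.finite
  exact hasBaseChange_of_acyclic (𝒪 := X.sheaf) _
    (fun B' hB' h ↦ hX.toIsFiniteSpace.flat_map hB hB' (homOfLE h)) (hX.acyclic hB hV) M
    fun B' hB' h ↦ hasBaseChange_of_isQuasicoherent (𝒪 := X.sheaf) hM hB hB' (homOfLE h)

lemma IsSemiSeparated.hasBaseChange_inf_right (hX : IsSemiSeparated X) {M : Modules X}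
    (hM : IsQuasicoherent M) {B V : Opens X.carrier}
    (hB : IsIrreducible (Opens.grothendieckTopology X.carrier) B)
    (hV : IsIrreducible (Opens.grothendieckTopology X.carrier) V) :
    HasBaseChange (𝒪 := X.sheaf) M (homOfLE (inf_le_right : B ⊓ V ≤ V)) := by
  have h := hX.hasBaseChange_inf_left hM hV hB
  have key : ∀ W (hW : W = B ⊓ V) (h : W ≤ V), HasBaseChange (𝒪 := X.sheaf) M (homOfLE h) →
      HasBaseChange (𝒪 := X.sheaf) M (homOfLE (inf_le_right : B ⊓ V ≤ V)) := by
    rintro W rfl h h'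
    exact h'
  exact key _ (inf_comm _ _) _ h

lemma isRightAdjoint_presheafPushforward {C D : Type u} [SmallCategory C] [SmallCategory D]   {F : C ⥤ D} {R : Dᵒᵖ ⥤ RingCat.{u}} {S : Cᵒᵖ ⥤ RingCat.{u}} (φ : S ⟶ F.op ⋙ R) :
   (PresheafOfModules.pushforward.{u} φ).IsRightAdjoint := inferInstance

/-- Left exactness identifies `R^0 δ_*` with `δ_*`. -/
lemma preservesFiniteLimits_pushforward {C D : Type u} [SmallCategory C] [SmallCategory D] {J : GrothendieckTopology C}
   {K : GrothendieckTopology D} {F : C ⥤ D}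
  {S : Sheaf J RingCat.{u}} {R : Sheaf K RingCat.{u}}
  [Functor.IsContinuous F J K]
  (φ : S ⟶ (F.sheafPushforwardContinuous RingCat.{u} J K).obj R) : PreservesFiniteLimits (SheafOfModules.pushforward.{u} φ) := by
  have : (PresheafOfModules.pushforward.{u} φ.hom).IsRightAdjoint := isRightAdjoint_presheafPushforward φ.hom
  have : (SheafOfModules.pushforward.{u} φ).IsRightAdjoint := inferInstance
  infer_instance

instance {X Y : RingedSpace.{u, u}} (f : X ⟶ Y) : PreservesFiniteLimits (pushforward f) :=
  preservesFiniteLimits_pushforward (toRingCatSheafHom f)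

lemma IsSemiSeparated.isQuasicoherent_pushforward (hX : IsSemiSeparated X) :
    IsQuasicoherent ((pushforward (diagonal X)).obj (SheafOfModules.unit (ringCatSheaf X))) :=
  ObjectProperty.prop_of_iso (SheafOfModules.isQuasicoherent.{u} (ringCatSheaf (prod X X)))
    ((pushforward (diagonal X)).rightDerivedZeroIsoSelf.app _) (hX.isQuasicoherent 0)

/-- Quasi-coherence of `δ_* 𝒪` makes `𝒪(B' ⊓ V)` the base change of `𝒪(B ⊓ V)` along `𝒪(B × V) →
𝒪(B' × V)`, and by `isPushout_prod` this ring map is itself the pushout of `𝒪(B) → 𝒪(B')`. -/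
lemma IsSemiSeparated.isPushout (hX : IsSemiSeparated X) {B B' V : Opens X.carrier}
    (hB : IsIrreducible (Opens.grothendieckTopology X.carrier) B)
    (hB' : IsIrreducible (Opens.grothendieckTopology X.carrier) B')
    (hV : IsIrreducible (Opens.grothendieckTopology X.carrier) V) (f : B' ⟶ B) :
    IsPushout (X.sheaf.obj.map f.op)
      (X.sheaf.obj.map (homOfLE (inf_le_left : B ⊓ V ≤ B)).op)
      (X.sheaf.obj.map (homOfLE (inf_le_left : B' ⊓ V ≤ B')).op)
      (X.sheaf.obj.map ((interFunctor V).map f).op) := by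
  have := hX.finite
  let g : prodOpen B' V ⟶ prodOpen B V := homOfLE (Set.prod_mono f.le le_rfl)
  have h1 := hasBaseChange_of_isQuasicoherent (𝒪 := (prod X X).sheaf)
    hX.isQuasicoherent_pushforward (hB.prod hV) (hB'.prod hV) g
  let ρ := X.sheaf.obj.map (homOfLE (inf_le_left : B ⊓ V ≤ B)).op
  let ρ' := X.sheaf.obj.map (homOfLE (inf_le_left : B' ⊓ V ≤ B')).op
  let φ := X.sheaf.obj.map f.op
  let ψ := X.sheaf.obj.map ((interFunctor V).map f).op
  have w : φ ≫ ρ' = ρ ≫ ψ := (X.sheaf.obj.map_comp _ _).symm.trans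
    (X.sheaf.obj.map_comp (homOfLE (inf_le_left : B ⊓ V ≤ B)).op
      (homOfLE (inf_le_inf_right V f.le) : B' ⊓ V ⟶ B ⊓ V).op)
  let P := X.sheaf.obj.obj (op (B ⊓ V))
  let P' := X.sheaf.obj.obj (op (B' ⊓ V))
  let i : Module (X.sheaf.obj.obj (op B)) P := Module.compHom P ρ.hom
  let i' : Module (X.sheaf.obj.obj (op B')) P' := Module.compHom P' ρ'.hom
  let r : P →ₛₗ[φ.hom] P' :=
    { toFun := ψ
      map_add' := map_add ψ.hom
      map_smul' := fun a m ↦ by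
        refine (map_mul ψ.hom (ρ a) m).trans ?_
        exact congrArg (fun t ↦ t * ψ.hom m) congr(($w).hom a).symm }
  refine isPushout_of_isSemiBaseChange w (fun _ _ ↦ rfl) (fun _ _ ↦ rfl) r (fun _ ↦ rfl) ?_
  let N := (pushforward (diagonal X)).obj (SheafOfModules.unit (ringCatSheaf X))
  let : Module (X.presheaf.obj (op B)) ((ev (prod X X).sheaf (prodOpen B V)).obj N) := i
  let : Module (X.presheaf.obj (op B')) ((ev (prod X X).sheaf (prodOpen B' V)).obj N) := i'
  let : Module ((prod X X).presheaf.obj (op (prodOpen B V)))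
      ((ev (prod X X).sheaf (prodOpen B V)).obj N) :=
    inferInstanceAs (Module ((prod X X).sheaf.obj.obj (op (prodOpen B V)))
      ((ev (prod X X).sheaf (prodOpen B V)).obj N))
  let : Module ((prod X X).presheaf.obj (op (prodOpen B' V)))
      ((ev (prod X X).sheaf (prodOpen B' V)).obj N) :=
    inferInstanceAs (Module ((prod X X).sheaf.obj.obj (op (prodOpen B' V)))
      ((ev (prod X X).sheaf (prodOpen B' V)).obj N))
  refine IsSemiBaseChange.of_isPushout (isPushout_prod hB hB' hV f g) h1
    (fun a m ↦ ?_) (fun a m ↦ ?_) r fun _ ↦ rfl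
  -- Pulling back to the product and then along the diagonal is restriction to the intersection, so
  -- the two actions agree.
  · exact congrArg (fun t : P ↦ t * (show P from m)) congr(($(fstApp_diagonal B V)).hom a).symm
  · exact congrArg (fun t : P' ↦ t * (show P' from m)) congr(($(fstApp_diagonal B' V)).hom a).symm

lemma IsFiniteSpace.isQuasicoherent_iff (hX : IsFiniteSpace X) (M : Modules X) :
    IsQuasicoherent M ↔ ∀ (B B' : Opens X.carrier) (f : B' ⟶ B),
      IsIrreducible (Opens.grothendieckTopology X.carrier) B →
      IsIrreducible (Opens.grothendieckTopology X.carrier) B' → HasBaseChange (𝒪 := X.sheaf) M f :=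
  have := hX.finite
  FiniteSpace.isQuasicoherent_iff (𝒪 := X.sheaf) enoughIrreducibles_opens
    (fun _ _ f hB hB' ↦ hX.flat_map hB hB' f) M

lemma IsSemiSeparated.isQuasicoherent_interMod (hX : IsSemiSeparated X) {M : Modules X}
    (hM : IsQuasicoherent M) {V : Opens X.carrier}
    (hV : IsIrreducible (Opens.grothendieckTopology X.carrier) V) :
    IsQuasicoherent (X := X) ((interMod (𝒪 := X.sheaf) V).obj M) := by
  rw [hX.toIsFiniteSpace.isQuasicoherent_iff]
  intro B B' f hB hB'
  exact hasBaseChange_interMod (𝒪 := X.sheaf) f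
    (hasBaseChange_of_isQuasicoherent (𝒪 := X.sheaf) hM hB hB' f)
    (hX.hasBaseChange_inf_left hM hB hV) (hX.hasBaseChange_inf_left hM hB' hV)
    (hX.isPushout hB hB' hV f)

end SemiSeparated

lemma exists_binaryCofan_biprod {D : Type*} [Category* D] [HasZeroMorphisms D] (M N : D)
    [HasBinaryBiproduct M N] :
    ∃ c : BinaryCofan M N, Nonempty (IsColimit c) ∧ c.pt = (M ⊞ N) :=
  ⟨_, ⟨BinaryBiproduct.isColimit M N⟩, rfl⟩

/-! ### Coproducts and fibre products: base change and flatness -/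

section Site

variable {C : Type u} [SmallCategory C] {J : GrothendieckTopology C} {𝒪 : Sheaf J CommRingCat.{u}}

open Classical in
lemma flat_ev_sigma {B : C} (hB : IsIrreducible J B) {I : Type u} (F : I → SheafMod 𝒪)
    (hF : ∀ i, Module.Flat (𝒪.obj.obj (op B)) ((ev 𝒪 B).obj (F i))) :
    Module.Flat (𝒪.obj.obj (op B)) ((ev 𝒪 B).obj (∐ F)) := by
  have := hB.preservesColimitsOfShape_ev 𝒪 (Discrete I)
  let Z (i : I) := (ev 𝒪 B).obj (F i)
  have (i : I) : Module.Flat (𝒪.obj.obj (op B)) (Z i) := hF i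
  let e : (ev 𝒪 B).obj (∐ F) ≅ ModuleCat.of _ (DirectSum I fun i ↦ Z i) :=
    (PreservesCoproduct.iso (ev 𝒪 B) F) ≪≫ ModuleCat.coprodIsoDirectSum Z
  exact Module.Flat.of_linearEquiv e.toLinearEquiv

lemma hasBaseChange_binaryCofan {B B' : C} (hB : IsIrreducible J B) (hB' : IsIrreducible J B')
    (f : B' ⟶ B) {M N : SheafMod 𝒪} (hM : HasBaseChange M f) (hN : HasBaseChange N f)
    (c : BinaryCofan M N) (hc : IsColimit c) : HasBaseChange c.pt f := by
  have := hB.preservesColimitsOfSize_ev (𝒪 := 𝒪)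
  have := hB'.preservesColimitsOfSize_ev (𝒪 := 𝒪)
  refine hasBaseChange_colimit f (pair M N) (fun k ↦ ?_) c hc
  match k with
  | ⟨.left⟩ => exact hM
  | ⟨.right⟩ => exact hN

lemma hasBaseChange_biprod {B B' : C} (hB : IsIrreducible J B) (hB' : IsIrreducible J B')
    (f : B' ⟶ B) {M N : SheafMod 𝒪} (hM : HasBaseChange M f) (hN : HasBaseChange N f) :
    HasBaseChange (M ⊞ N) f := by
  obtain ⟨c, ⟨hc⟩, h⟩ := exists_binaryCofan_biprod M N
  have hc := hasBaseChange_binaryCofan hB hB' f hM hN c hc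
  rw [h] at hc
  exact hc

/-- The fibre product is the kernel of a map `M₂ ⊞ M₃ ⟶ M₄`. -/
lemma hasBaseChange_of_isPullback {B B' : C}
    (f : B' ⟶ B) (hf : (𝒪.obj.map f.op).hom.Flat) {M₁ M₂ M₃ M₄ : SheafMod 𝒪} {t : M₁ ⟶ M₂}
    {l : M₁ ⟶ M₃} {r : M₂ ⟶ M₄} {b : M₃ ⟶ M₄} (sq : IsPullback t l r b)
    (h₂ : HasBaseChange (M₂ ⊞ M₃) f) (h₄ : HasBaseChange M₄ f) :
    HasBaseChange M₁ f := by
  have := sq.mono_shortComplex'_f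
  have h : HasBaseChange sq.shortComplex'.X₁ f :=
    hasBaseChange_of_exact f hf _ sq.exact_shortComplex' h₂ h₄
  exact h

lemma ev_ext_of_isPullback {M₁ M₂ M₃ M₄ : SheafMod 𝒪} {t : M₁ ⟶ M₂}
    {l : M₁ ⟶ M₃} {r : M₂ ⟶ M₄} {b : M₃ ⟶ M₄} (sq : IsPullback t l r b) {B : C}
    {x y : (ev 𝒪 B).obj M₁} (h₁ : (ev 𝒪 B).map t x = (ev 𝒪 B).map t y)
    (h₂ : (ev 𝒪 B).map l x = (ev 𝒪 B).map l y) : x = y :=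
  Types.ext_of_isPullback ((sq.map (ev 𝒪 B)).map (CategoryTheory.forget _)) h₁ h₂

lemma exists_of_isPullback {M₁ M₂ M₃ M₄ : SheafMod 𝒪} {t : M₁ ⟶ M₂}
    {l : M₁ ⟶ M₃} {r : M₂ ⟶ M₄} {b : M₃ ⟶ M₄} (sq : IsPullback t l r b) {B : C}
    (x : (ev 𝒪 B).obj M₂) (y : (ev 𝒪 B).obj M₃) (h : (ev 𝒪 B).map r x = (ev 𝒪 B).map b y) :
    ∃ z, (ev 𝒪 B).map t z = x ∧ (ev 𝒪 B).map l z = y :=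
  Types.exists_of_isPullback ((sq.map (ev 𝒪 B)).map (CategoryTheory.forget _)) x y h

/-- In a pullback square along an epimorphism onto a flat module, flatness is inherited. -/
lemma flat_of_isPullback {M₁ M₂ M₃ M₄ : SheafMod 𝒪} {t : M₁ ⟶ M₂}
    {l : M₁ ⟶ M₃} {r : M₂ ⟶ M₄} {b : M₃ ⟶ M₄} (sq : IsPullback t l r b) {B : C}
    (hb : Function.Surjective ((ev 𝒪 B).map b))
    (h₂ : Module.Flat (𝒪.obj.obj (op B)) ((ev 𝒪 B).obj M₂))
    (h₃ : Module.Flat (𝒪.obj.obj (op B)) ((ev 𝒪 B).obj M₃))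
    (h₄ : Module.Flat (𝒪.obj.obj (op B)) ((ev 𝒪 B).obj M₄)) :
    Module.Flat (𝒪.obj.obj (op B)) ((ev 𝒪 B).obj M₁) := by
  -- The kernel of `t` is also the kernel of the surjection `b`, hence flat; and `M₁` is an
  -- extension of `M₂` by it.
  let A := LinearMap.ker ((ev 𝒪 B).map t).hom
  let f : A →ₗ[𝒪.obj.obj (op B)] (ev 𝒪 B).obj M₃ := ((ev 𝒪 B).map l).hom ∘ₗ A.subtype
  have w (x : (ev 𝒪 B).obj M₁) :
      (ev 𝒪 B).map r ((ev 𝒪 B).map t x) = (ev 𝒪 B).map b ((ev 𝒪 B).map l x) :=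
    congr(($((sq.map (ev 𝒪 B)).w)).hom x)
  have : Module.Flat (𝒪.obj.obj (op B)) A := by
    refine flat_of_exact (f := f) (g := ((ev 𝒪 B).map b).hom) (fun x y hxy ↦ ?_) (fun y ↦ ⟨fun h ↦ ?_, ?_⟩) hb
    · exact Subtype.ext (ev_ext_of_isPullback sq (x.2.trans y.2.symm) hxy)
    · obtain ⟨z, hz, hz'⟩ := exists_of_isPullback sq 0 y ((map_zero _).trans h.symm)
      exact ⟨⟨z, hz⟩, hz'⟩
    · rintro ⟨x, rfl⟩
      refine (w x.1).symm.trans ?_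
      exact (congrArg _ x.2).trans (map_zero ((ev 𝒪 B).map r).hom)
  refine flat_of_exact_middle (f := A.subtype) (g := ((ev 𝒪 B).map t).hom)
    (LinearMap.exact_subtype_ker_map _) (fun x ↦ ?_) A.subtype_injective
  obtain ⟨y, hy⟩ := hb ((ev 𝒪 B).map r x)
  obtain ⟨z, hz, _⟩ := exists_of_isPullback sq x y hy.symm
  exact ⟨z, hz⟩

end Site

/-! ### Covering the direct image of a restriction by copies of that of the structure sheaf -/

section Inter

variable {T : TopCat.{u}} {𝒪 : Sheaf (Opens.grothendieckTopology T) CommRingCat.{u}}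

lemma bijective_ev_toInter (V : Opens T) (M : SheafMod 𝒪) :
    Function.Bijective ((ev 𝒪 V).map (toInter V M)) := by
  let r : (ev 𝒪 (V ⊓ V)).obj M → (ev 𝒪 V).obj M := secRes M (homOfLE (le_inf le_rfl le_rfl))
  refine Function.bijective_iff_has_inverse.2 ⟨r, fun m ↦ ?_, fun m ↦ ?_⟩
  · exact (secRes_secRes M _ _ (𝟙 V) m).trans (secRes_id M _ m)
  · exact (secRes_secRes M _ _ (𝟙 (V ⊓ V)) m).trans (secRes_id (B := V ⊓ V) M _ m)

/-- The morphism to the direct image of the restriction of `M` to `V` induced by all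
sections over `V`. -/
def interCover (V : Opens T) (M : SheafMod 𝒪) :
    (∐ fun _ : (ev 𝒪 V).obj M ↦ (interMod V).obj (unitMod 𝒪)) ⟶ (interMod V).obj M :=
  Sigma.desc fun s ↦ interSection V M s

/-- By base change from `V`, restrictions of sections over `V` generate `M(B ⊓ V)` over `𝒪(B ⊓ V)`,
and the summand of `s` maps onto all multiples of the restriction of `s`. -/
lemma surjective_interCover {B V : Opens T} {M : SheafMod 𝒪}
    (h : HasBaseChange M (homOfLE (inf_le_right : B ⊓ V ≤ V))) :
    Function.Surjective ((ev 𝒪 B).map (interCover V M)) := by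
  let φ : (ev 𝒪 B).obj (∐ fun _ : (ev 𝒪 V).obj M ↦ (interMod V).obj (unitMod 𝒪)) →+
      (ev 𝒪 (B ⊓ V)).obj M := ((ev 𝒪 B).map (interCover V M)).hom.toAddMonoidHom
  -- The map is only `𝒪(B)`-linear, so its image is not visibly an `𝒪(B ⊓ V)`-submodule; `N`
  -- consists of the elements all of whose multiples lie in the image.
  let N : Submodule (𝒪.obj.obj (op (B ⊓ V))) ((ev 𝒪 (B ⊓ V)).obj M) :=
    { carrier := {x | ∀ a : 𝒪.obj.obj (op (B ⊓ V)), ∃ y, φ y = a • x}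
      add_mem' := fun {x x'} hx hx' a ↦ by
        obtain ⟨y, hy⟩ := hx a
        obtain ⟨y', hy'⟩ := hx' a
        refine ⟨y + y', (map_add φ y y').trans ?_⟩
        rw [smul_add, hy, hy']
      zero_mem' := fun a ↦ ⟨0, (map_zero φ).trans (smul_zero a).symm⟩
      smul_mem' := fun b x hx a ↦ by
        obtain ⟨y, hy⟩ := hx (a * b)
        exact ⟨y, hy.trans (mul_smul _ _ _)⟩ }
  have hN := h.range_eq_top N fun s a ↦ by
    refine ⟨(ev 𝒪 B).map (Sigma.ι (fun _ : (ev 𝒪 V).obj M ↦ (interMod V).obj (unitMod 𝒪)) s) a, ?_⟩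
    refine Eq.trans ?_ (ev_interSection V M s B a)
    have h := (ev 𝒪 B).map_comp
      (Sigma.ι (fun _ : (ev 𝒪 V).obj M ↦ (interMod V).obj (unitMod 𝒪)) s) (interCover V M)
    exact congr(($(h.symm.trans (congrArg _ (Sigma.ι_desc _ _)))).hom a)
  intro x
  have hx : x ∈ N := by
    rw [hN]
    trivial
  obtain ⟨y, hy⟩ := hx 1
  exact ⟨y, hy.trans (one_smul _ _)⟩

end Inter

/-! ### Resolutions spliced from covers -/

section Resolution

universe v w

variable {A : Type w} [Category.{v} A] [Abelian A]

lemma exact_comp_kernel_ι {F F' M : A} (f : F ⟶ M) (p : F' ⟶ kernel f) [Epi p] :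
    (ShortComplex.mk (p ≫ kernel.ι f) f (by simp)).Exact := by
  let α : ShortComplex.mk (p ≫ kernel.ι f) f (by simp) ⟶
      ShortComplex.mk (kernel.ι f) f (by simp) := { τ₁ := p, τ₂ := 𝟙 _, τ₃ := 𝟙 _ }
  rw [ShortComplex.exact_iff_of_epi_of_isIso_of_mono α]
  exact ShortComplex.exact_of_f_is_kernel _ (kernelIsKernel _)

lemma exact_comp_kernel_ι_comp {F F' M N : A} (f : F ⟶ M) (p : F' ⟶ kernel f) [Epi p] (m : M ⟶ N)
    [Mono m] : (ShortComplex.mk (p ≫ kernel.ι f) (f ≫ m) (by simp)).Exact := by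
  let α : ShortComplex.mk (p ≫ kernel.ι f) f (by simp) ⟶
      ShortComplex.mk (p ≫ kernel.ι f) (f ≫ m) (by simp) := { τ₁ := 𝟙 _, τ₂ := 𝟙 _, τ₃ := m }
  rw [← ShortComplex.exact_iff_of_epi_of_isIso_of_mono α]
  exact exact_comp_kernel_ι f p

lemma quasiIso_toSingle₀ (K : ChainComplex A ℕ) {M : A} (f : K.X 0 ⟶ M) (hf : K.d 1 0 ≫ f = 0)
    [Epi f] (h₀ : (ShortComplex.mk _ f hf).Exact) (h : ∀ n, K.ExactAt (n + 1)) :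
    QuasiIso ((ChainComplex.toSingle₀Equiv K M).symm ⟨f, hf⟩) := ⟨fun n ↦ by
  cases n
  · rw [ChainComplex.quasiIsoAt₀_iff, ShortComplex.quasiIso_iff_of_zeros']
    · refine (ShortComplex.exact_and_epi_g_iff_of_iso ?_).2 ⟨h₀, inferInstance⟩
      refine ShortComplex.isoMk (Iso.refl _) (Iso.refl _) (Iso.refl _) ?_ ?_
      · exact (Category.id_comp _).trans (Category.comp_id _).symm
      · refine (Category.id_comp _).trans (Eq.trans ?_ (Category.comp_id _).symm)
        exact (ChainComplex.toSingle₀Equiv_symm_apply_f_zero f hf).symm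
    · exact K.shape 0 0 (by simp)
    · exact HomologicalComplex.single_obj_d (ComplexShape.down ℕ) 0 M 1 0
    · exact HomologicalComplex.single_obj_d (ComplexShape.down ℕ) 0 M 0 0
  · rw [quasiIsoAt_iff_exactAt']
    · exact h _
    · apply ChainComplex.exactAt_succ_single_obj⟩

/-- Objects covered by objects satisfying `R`, with kernels which are again covered, have
resolutions by objects satisfying `R`. -/
theorem exists_resolution (Q R : A → Prop)
    (h : ∀ M, Q M → ∃ (F : A) (π : F ⟶ M), Epi π ∧ R F ∧ Q (kernel π)) (M : A) (hM : Q M) :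
    ∃ (K : ChainComplex A ℕ) (π : K ⟶ (ChainComplex.single₀ A).obj M),
      (∀ n, R (K.X n)) ∧ QuasiIso π := by
  choose F p hp hR hQ using h
  -- The successive syzygies, starting with `M` itself.
  let syz : ℕ → {M // Q M} := fun n ↦ Nat.rec ⟨M, hM⟩ (fun _ N ↦ ⟨kernel (p N.1 N.2), hQ N.1 N.2⟩) n
  let X (n : ℕ) : A := F (syz n).1 (syz n).2
  let q (n : ℕ) : X n ⟶ (syz n).1 := p _ _
  let d (n : ℕ) : X (n + 1) ⟶ X n := q (n + 1) ≫ kernel.ι (q n)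
  have hd (n : ℕ) : d (n + 1) ≫ d n = 0 := by simp [d, X]
  have hq (n : ℕ) : Epi (q n) := hp _ _
  let K := ChainComplex.of X d hd
  have hd0 : K.d 1 0 = d 0 := ChainComplex.of_d X d 0
  have hd0' : d 0 ≫ q 0 = 0 := by simp [d]
  have h₀ : K.d 1 0 ≫ q 0 = 0 := by rw [hd0, hd0']
  refine ⟨K, (ChainComplex.toSingle₀Equiv K M).symm ⟨q 0, h₀⟩, fun n ↦ hR _ _, ?_⟩
  have := hq 0
  refine quasiIso_toSingle₀ K (q 0) h₀ ?_ fun n ↦ ?_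
  -- The differential of `K` equals `d 0` only propositionally, so exactness is stated for a
  -- variable `a` to allow substitution.
  · have key (a : X 1 ⟶ X 0) (w) (ha : a = d 0) : (ShortComplex.mk a (q 0) w).Exact := by
      subst ha
      have := hq 1
      exact exact_comp_kernel_ι (q 0) (q 1)
    exact key _ _ hd0
  · rw [HomologicalComplex.exactAt_iff' _ (n + 1 + 1) (n + 1) n (by simp) (by simp)]
    have key (a : X (n + 2) ⟶ X (n + 1)) (b : X (n + 1) ⟶ X n) (w) (ha : a = d (n + 1))
        (hb : b = d n) : (ShortComplex.mk a b w).Exact := by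
      subst ha hb
      have := hq (n + 2)
      exact exact_comp_kernel_ι_comp (q (n + 1)) (q (n + 2)) (kernel.ι (q n))
    exact key _ _ _ (ChainComplex.of_d X d (n + 1)) (ChainComplex.of_d X d n)

end Resolution

/-! ### Flat quasi-coherent covers -/

section FlatCover

variable {T : TopCat.{u}} {𝒪 : Sheaf (Opens.grothendieckTopology T) CommRingCat.{u}}

/-- Base change along the inclusions of irreducible open subsets. -/
def HasIrreducibleBaseChange (M : SheafMod 𝒪) : Prop :=
  ∀ (B B' : Opens T) (f : B' ⟶ B), IsIrreducible (Opens.grothendieckTopology T) B →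
    IsIrreducible (Opens.grothendieckTopology T) B' → HasBaseChange M f

lemma flat_interMod (V B : Opens T) (M : SheafMod 𝒪)
    (hV : (𝒪.obj.map (homOfLE (inf_le_left : B ⊓ V ≤ B)).op).hom.Flat)
    (hM : Module.Flat (𝒪.obj.obj (op (B ⊓ V))) ((ev 𝒪 (B ⊓ V)).obj M)) :
    Module.Flat (𝒪.obj.obj (op B)) ((ev 𝒪 B).obj ((interMod V).obj M)) := by
  let := (𝒪.obj.map (homOfLE (inf_le_left : B ⊓ V ≤ B)).op).hom.toAlgebra
  let : Module (𝒪.obj.obj (op B)) ((ev 𝒪 (B ⊓ V)).obj M) :=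
    inferInstanceAs (Module _ ((ev 𝒪 B).obj ((interMod V).obj M)))
  have : IsScalarTower (𝒪.obj.obj (op B)) (𝒪.obj.obj (op (B ⊓ V))) ((ev 𝒪 (B ⊓ V)).obj M) :=
    ⟨fun r s n ↦ mul_smul (𝒪.obj.map (homOfLE (inf_le_left : B ⊓ V ≤ B)).op r) s n⟩
  have : Module.Flat (𝒪.obj.obj (op B)) (𝒪.obj.obj (op (B ⊓ V))) := hV
  exact Module.Flat.trans (𝒪.obj.obj (op B)) (𝒪.obj.obj (op (B ⊓ V))) ((ev 𝒪 (B ⊓ V)).obj M)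

/-- The conditions on an open subset `V` under which the direct image of the restriction to `V`
is well behaved. -/
structure IsGoodOpen (𝒪 : Sheaf (Opens.grothendieckTopology T) CommRingCat.{u}) (V : Opens T) :
    Prop where
  isIrreducible : IsIrreducible (Opens.grothendieckTopology T) V
  flat : ∀ B, IsIrreducible (Opens.grothendieckTopology T) B →
    (𝒪.obj.map (homOfLE (inf_le_left : B ⊓ V ≤ B)).op).hom.Flat
  left : ∀ M : SheafMod 𝒪, HasIrreducibleBaseChange M →
    ∀ B, IsIrreducible (Opens.grothendieckTopology T) B →
      HasBaseChange M (homOfLE (inf_le_left : B ⊓ V ≤ B))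
  right : ∀ M : SheafMod 𝒪, HasIrreducibleBaseChange M →
    ∀ B, IsIrreducible (Opens.grothendieckTopology T) B →
      HasBaseChange M (homOfLE (inf_le_right : B ⊓ V ≤ V))
  interMod : ∀ M : SheafMod 𝒪, HasIrreducibleBaseChange M →
    HasIrreducibleBaseChange ((interMod V).obj M)

/-- `F` is the fibre product of `toInter V M` and `interCover V M`. Over `V` the former is
bijective, so `F(V)` is the value of a sum of copies of `j_*j^*𝒪`, which is flat. Where `M` is flat,
so is `j_*j^*M`, and `flat_of_isPullback` applies. -/
lemma IsGoodOpen.exists_epi [Finite T]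
    (hfl : ∀ (B B' : Opens T) (f : B' ⟶ B), IsIrreducible (Opens.grothendieckTopology T) B →
      IsIrreducible (Opens.grothendieckTopology T) B' → (𝒪.obj.map f.op).hom.Flat)
    {V : Opens T} (hV : IsGoodOpen 𝒪 V) (M : SheafMod 𝒪) (hM : HasIrreducibleBaseChange M) :
    ∃ (F : SheafMod 𝒪) (π : F ⟶ M), Epi π ∧ HasIrreducibleBaseChange F ∧
      Module.Flat (𝒪.obj.obj (op V)) ((ev 𝒪 V).obj F) ∧
      ∀ B, IsIrreducible (Opens.grothendieckTopology T) B →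
        Module.Flat (𝒪.obj.obj (op B)) ((ev 𝒪 B).obj M) →
        Module.Flat (𝒪.obj.obj (op B)) ((ev 𝒪 B).obj F) := by
  have hO : HasIrreducibleBaseChange (unitMod 𝒪) := fun _ _ f _ _ ↦ hasBaseChange_unit f
  have hs (B) (hB : IsIrreducible (Opens.grothendieckTopology T) B) :=
    surjective_interCover (hV.right M hM B hB)
  have : Epi (interCover V M) := epi_of_surjective enoughIrreducibles_opens _ hs
  have hG (B) (hB : IsIrreducible (Opens.grothendieckTopology T) B) :
      Module.Flat (𝒪.obj.obj (op B)) ((ev 𝒪 B).obj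
        (∐ fun _ : (ev 𝒪 V).obj M ↦ (FiniteSpace.interMod V).obj (unitMod 𝒪))) :=
    flat_ev_sigma hB _ fun _ ↦ flat_interMod V B _ (hV.flat B hB)
      (inferInstanceAs (Module.Flat (𝒪.obj.obj (op (B ⊓ V))) (𝒪.obj.obj (op (B ⊓ V)))))
  have sq := IsPullback.of_hasPullback (toInter V M) (interCover V M)
  refine ⟨pullback (toInter V M) (interCover V M), pullback.fst _ _, inferInstance, ?_, ?_, ?_⟩
  · intro B B' f hB hB'
    exact hasBaseChange_of_isPullback f (hfl B B' f hB hB') sq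
      (hasBaseChange_biprod hB hB' f (hM B B' f hB hB') (hasBaseChange_coproduct hB hB' f _
        fun _ ↦ hV.interMod _ hO B B' f hB hB'))
      (hV.interMod M hM B B' f hB hB')
  · have := hG V hV.isIrreducible
    have hb := bijective_ev_toInter V M
    have w (x) : (ev 𝒪 V).map (toInter V M) ((ev 𝒪 V).map (pullback.fst _ _) x) =
        (ev 𝒪 V).map (interCover V M) ((ev 𝒪 V).map (pullback.snd _ _) x) :=
      congr(($((sq.map (ev 𝒪 V)).w)).hom x)
    refine Module.Flat.of_linearEquiv (LinearEquiv.ofBijective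
      ((ev 𝒪 V).map (pullback.snd (toInter V M) (interCover V M))).hom ⟨fun x y hxy ↦ ?_, fun y ↦ ?_⟩)
    · refine ev_ext_of_isPullback sq (hb.1 ?_) hxy
      exact (w x).trans ((congrArg _ hxy).trans (w y).symm)
    · obtain ⟨x, hx⟩ := hb.2 ((ev 𝒪 V).map (interCover V M) y)
      obtain ⟨z, _, hz⟩ := exists_of_isPullback sq x y hx
      exact ⟨z, hz⟩
  · intro B hB hMB
    exact flat_of_isPullback sq (hs B hB) hMB (hG B hB)
      (flat_interMod V B M (hV.flat B hB) ((hV.left M hM B hB).flat hMB))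

/-- One application of `IsGoodOpen.exists_epi` for each irreducible open subset; flatness gained
earlier is not lost. -/
theorem exists_epi_flat [Finite T]
    (hfl : ∀ (B B' : Opens T) (f : B' ⟶ B), IsIrreducible (Opens.grothendieckTopology T) B →
      IsIrreducible (Opens.grothendieckTopology T) B' → (𝒪.obj.map f.op).hom.Flat)
    (hgood : ∀ V, IsIrreducible (Opens.grothendieckTopology T) V → IsGoodOpen 𝒪 V)
    (M : SheafMod 𝒪) (hM : HasIrreducibleBaseChange M) :
    ∃ (F : SheafMod 𝒪) (π : F ⟶ M), Epi π ∧ HasIrreducibleBaseChange F ∧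
      ∀ B, IsIrreducible (Opens.grothendieckTopology T) B →
        Module.Flat (𝒪.obj.obj (op B)) ((ev 𝒪 B).obj F) := by
  have : Finite (Opens T) := Finite.of_injective _ SetLike.coe_injective
  have key (S : Set (Opens T)) (hS : S.Finite)
      (hS' : ∀ B ∈ S, IsIrreducible (Opens.grothendieckTopology T) B) :
      ∃ (F : SheafMod 𝒪) (π : F ⟶ M), Epi π ∧ HasIrreducibleBaseChange F ∧
        ∀ B ∈ S, Module.Flat (𝒪.obj.obj (op B)) ((ev 𝒪 B).obj F) := by
    induction S, hS using Set.Finite.induction_on with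
    | empty => exact ⟨M, 𝟙 M, inferInstance, hM, fun _ h ↦ h.elim⟩
    | @insert V S hV hS ih =>
      obtain ⟨F', π', _, hF', hflat'⟩ := ih fun B hB ↦ hS' B (.inr hB)
      obtain ⟨F, π, _, hF, hflatV, hflat⟩ :=
        (hgood V (hS' V (.inl rfl))).exists_epi hfl F' hF'
      refine ⟨F, π ≫ π', epi_comp _ _, hF, ?_⟩
      rintro B (rfl | hB)
      exacts [hflatV, hflat B (hS' B (.inr hB)) (hflat' B hB)]
  exact key {B | IsIrreducible _ B} (Set.toFinite _) fun _ h ↦ h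

lemma HasIrreducibleBaseChange.kernel [Finite T]
    (hfl : ∀ (B B' : Opens T) (f : B' ⟶ B), IsIrreducible (Opens.grothendieckTopology T) B →
      IsIrreducible (Opens.grothendieckTopology T) B' → (𝒪.obj.map f.op).hom.Flat)
    {M N : SheafMod 𝒪} (hM : HasIrreducibleBaseChange M) (hN : HasIrreducibleBaseChange N)
    (f : M ⟶ N) : HasIrreducibleBaseChange (Limits.kernel f) := fun B B' g hB hB' ↦
  hasBaseChange_of_exact g (hfl B B' g hB hB') (ShortComplex.mk (kernel.ι f) f (kernel.condition _))
    (ShortComplex.exact_of_f_is_kernel _ (kernelIsKernel _)) (hM B B' g hB hB') (hN B B' g hB hB')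

end FlatCover

section SemiSeparated

variable {X : RingedSpace.{u, u}}

lemma IsSemiSeparated.isGoodOpen (hX : IsSemiSeparated X) (V : Opens X.carrier)
    (hV : IsIrreducible (Opens.grothendieckTopology X.carrier) V) : IsGoodOpen X.sheaf V := by
  have hq := fun M ↦ hX.toIsFiniteSpace.isQuasicoherent_iff M
  exact
  { isIrreducible := hV
    flat := fun B hB ↦ hX.flat_inf hB hV
    left := fun M hM B hB ↦ hX.hasBaseChange_inf_left ((hq M).2 hM) hB hV
    right := fun M hM B hB ↦ hX.hasBaseChange_inf_right ((hq M).2 hM) hB hV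
    interMod := fun M hM ↦ (hq _).1 (hX.isQuasicoherent_interMod ((hq M).2 hM) hV) }

end SemiSeparated

end FiniteSpace

end

theorem theorem3p6 (X : RingedSpace.{u, u}) (hX : FiniteSpace.IsSemiSeparated X)
    (M : FiniteSpace.Modules X) (hM : FiniteSpace.IsQuasicoherent M) :
    ∃ (P : ChainComplex (FiniteSpace.Modules X) ℕ)
      (π : P ⟶ (ChainComplex.single₀ (FiniteSpace.Modules X)).obj M),
      (∀ n : ℕ, FiniteSpace.IsQuasicoherent (P.X n) ∧ FiniteSpace.IsFlat (P.X n)) ∧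
        QuasiIso π := by
  have := hX.finite
  have hfl : ∀ (B B' : Opens X.carrier) (f : B' ⟶ B),
      FiniteSpace.IsIrreducible (Opens.grothendieckTopology X.carrier) B →
      FiniteSpace.IsIrreducible (Opens.grothendieckTopology X.carrier) B' →
      (X.sheaf.obj.map f.op).hom.Flat :=
    fun B B' f hB hB' ↦ hX.toIsFiniteSpace.flat_map hB hB' f
  -- Quasi-coherence is the property kept by the syzygies, so each of them again has a flat
  -- quasi-coherent cover.
  refine FiniteSpace.exists_resolution (fun M : FiniteSpace.Modules X ↦
    FiniteSpace.IsQuasicoherent M) (fun F ↦ FiniteSpace.IsQuasicoherent F ∧ FiniteSpace.IsFlat F)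
    (fun M hM ↦ ?_) M hM
  have hq := fun M ↦ hX.toIsFiniteSpace.isQuasicoherent_iff M
  obtain ⟨F, π, hπ, hF, hflat⟩ := FiniteSpace.exists_epi_flat (𝒪 := X.sheaf) hfl hX.isGoodOpen M
    ((hq M).1 hM)
  exact ⟨F, π, hπ, ⟨(hq F).2 hF, FiniteSpace.isFlat_of_flat F hflat⟩,
    (hq _).2 (hF.kernel (𝒪 := X.sheaf) hfl ((hq M).1 hM) π)⟩
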